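/- Let $D_0=[0,\infty)^2$ and $D_1=(0,\infty)^2$. An instance of $\mathsf{Multi\text{-}TOP}_k$ consists of integers $m,n\ge 0$ and $0\le k\le n$, non-negative real scores $a_{ij},b_{ij}$ ($i\in[m]$, $j\in[n]$), and functions $f_1,\dots,f_m,F$ of two real variables; each of these functions has a range, which is $D_0$ or $D_1$, and on its range it is concave, strictly increasing in each coordinate and continuously differentiable. For a sequence $S=(S_1,\dots,S_m)$ of subsets of $[n]$ put $$\mathrm{co}(S)=F\Big(\sum_{i=1}^m\sum_{j\in S_i}a_{ij},\ \sum_{i=1}^m\sum_{j\in S_i}b_{ij}\Big)+\sum_{i=1}^m f_i\Big(\sum_{j\in S_i}a_{ij},\ \sum_{j\in S_i}b_{ij}\Big).$$ It is assumed that whenever $|T_1|=\dots=|T_m|=k$ the arguments of $F$ and of $f_1,\dots,f_m$ in $\mathrm{co}(T_1,\dots,T_m)$ lie in the respective ranges, and likewise that $\big(\sum_{j\in T}a_{ij},\sum_{j\in T}b_{ij}\big)$ lies in the range of $f_i$ for all $i$ and all $T\subseteq[n]$ with $|T|=k$ (this is automatic for range $D_0$). There is a polynomial-time algorithm, that is,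 a single program for a real random access machine (unit-cost exact arithmetic and comparisons on reals; unit-cost addition, subtraction and comparison of integers; unit-cost oracle calls for the values and the partial derivatives of $f_1,\dots,f_m,F$) and constants $C,d$, such that on every instance the program halts after at most $C\,(m+n+1)^d$ steps and outputs a sequence $S=(S_1,\dots,S_m)$ of subsets of $[n]$, each of size at most $k+1$, with $$\mathrm{co}(S)\ \ge\ \max_{|T_1|=\dots=|T_m|=k}\mathrm{co}(T_1,\dots,T_m).$$ -/

import Mathlib

/-! ### The optimization problem -/

namespace MultiTop

/-- The closed quadrant `[0, ∞) × [0, ∞)`. -/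
def closedQuadrant : Set (ℝ × ℝ) := {x | 0 ≤ x.1 ∧ 0 ≤ x.2}

/-- The open quadrant `(0, ∞) × (0, ∞)`. -/
def openQuadrant : Set (ℝ × ℝ) := {x | 0 < x.1 ∧ 0 < x.2}

/-- `f` is an admissible combining function on the range `D`: `D` is the closed or the open quadrant
(the latter allows functions such as `log (α * β)`), and on `D` the function `f` is concave,
strictly increasing in each coordinate and continuously differentiable. -/
structure IsCombining (D : Set (ℝ × ℝ)) (f : ℝ × ℝ → ℝ) : Prop where
  range : D = closedQuadrant ∨ D = openQuadrant
  concave : ConcaveOn ℝ D f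
  strictMono_fst : ∀ α α' β : ℝ, (α, β) ∈ D → (α', β) ∈ D → α < α' → f (α, β) < f (α', β)
  strictMono_snd : ∀ α β β' : ℝ, (α, β) ∈ D → (α, β') ∈ D → β < β' → f (α, β) < f (α, β')
  contDiff : ContDiffOn ℝ 1 f D

/-- The data of a `Multi-TOP_k` problem: `m` instances with `n` results each, the two scores `a i j`
and `b i j` of result `j` for instance `i`, the local functions `f i` with range `D i`, and the
global function `F` with range `DF`. -/
structure Problem where
  m : ℕ
  n : ℕ
  k : ℕ
  a : Fin m → Fin n → ℝ
  b : Fin m → Fin n → ℝ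
  D : Fin m → Set (ℝ × ℝ)
  f : Fin m → ℝ × ℝ → ℝ
  DF : Set (ℝ × ℝ)
  F : ℝ × ℝ → ℝ

namespace Problem

variable (P : Problem)

/-- The pair of cumulative scores of the subset `S` of results in instance `i`. -/
def score (i : Fin P.m) (S : Finset (Fin P.n)) : ℝ × ℝ :=
  (∑ j ∈ S, P.a i j, ∑ j ∈ S, P.b i j)

/-- The pair of global cumulative scores of a sequence of subsets. -/
def globalScore (S : Fin P.m → Finset (Fin P.n)) : ℝ × ℝ :=
  (∑ i, ∑ j ∈ S i, P.a i j, ∑ i, ∑ j ∈ S i, P.b i j)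

/-- The combined (global plus local) objective of a sequence of subsets. -/
def co (S : Fin P.m → Finset (Fin P.n)) : ℝ :=
  P.F (P.globalScore S) + ∑ i, P.f i (P.score i (S i))

/-- The standing assumptions. The last two hold automatically for functions on the closed quadrant;
they say that the objective is defined at the candidates of the maximization. -/
structure IsValid : Prop where
  k_le : P.k ≤ P.n
  a_nonneg : ∀ i j, 0 ≤ P.a i j
  b_nonneg : ∀ i j, 0 ≤ P.b i j
  isCombining_f : ∀ i, IsCombining (P.D i) (P.f i)
  isCombining_F : IsCombining P.DF P.F
  score_mem : ∀ (i : Fin P.m) (T : Finset (Fin P.n)), T.card = P.k → P.score i T ∈ P.D i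
  globalScore_mem : ∀ T : Fin P.m → Finset (Fin P.n), (∀ i, (T i).card = P.k) →
    P.globalScore T ∈ P.DF

end Problem

end MultiTop

/-! ### A real random access machine with evaluation oracles

Programs of a small imperative language over natural numbers and exact real numbers, with arrays.
Every arithmetic operation, comparison, memory access and oracle call costs one step. As usual for
unit cost, integers can be added and subtracted but not multiplied (so that `t` steps only produce
integers of `O(t)` bits), and reals can be compared, but not rounded or turned into integers. -/

namespace RealRAM

/-- What is asked about a function of two variables at a point: its value or a partial derivative. -/
inductive Query
  | value
  | dfst
  | dsnd

/-- The black boxes that a program may call: one function for each index, and a further one. -/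
structure Oracles where
  loc : ℕ → Query → ℝ → ℝ → ℝ
  glob : Query → ℝ → ℝ → ℝ

/-- The memory: two-dimensional arrays of natural numbers and of reals. The first argument is the
name of the array, the other two are the indices of the cell. -/
structure State where
  nat : ℕ → ℕ → ℕ → ℕ
  real : ℕ → ℕ → ℕ → ℝ

/-- Integer expressions. Names of arrays and constants are fixed by the program text. -/
inductive NatExp
  | const (c : ℕ)
  | get (x : ℕ) (i j : NatExp)
  | add (e e' : NatExp)
  | sub (e e' : NatExp)

/-- Real expressions. -/
inductive RealExp
  | const (c : ℕ)
  | get (x : ℕ) (i j : NatExp)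
  | add (r r' : RealExp)
  | sub (r r' : RealExp)
  | mul (r r' : RealExp)
  | div (r r' : RealExp)
  | loc (i : NatExp) (q : Query) (r r' : RealExp)
  | glob (q : Query) (r r' : RealExp)

/-- Tests. -/
inductive Test
  | natLe (e e' : NatExp)
  | realLe (r r' : RealExp)
  | neg (b : Test)
  | and (b b' : Test)

/-- Programs. -/
inductive Prog
  | skip
  | setNat (x : ℕ) (i j : NatExp) (e : NatExp)
  | setReal (x : ℕ) (i j : NatExp) (r : RealExp)
  | seq (p p' : Prog)
  | ite (b : Test) (p p' : Prog)
  | while (b : Test) (p : Prog)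

/-- Subtraction is truncated. -/
def NatExp.eval (σ : State) : NatExp → ℕ
  | const c => c
  | get x i j => σ.nat x (i.eval σ) (j.eval σ)
  | add e e' => e.eval σ + e'.eval σ
  | sub e e' => e.eval σ - e'.eval σ

/-- The number of operations in an integer expression. -/
def NatExp.cost : NatExp → ℕ
  | const _ => 1
  | get _ i j => i.cost + j.cost + 1
  | add e e' => e.cost + e'.cost + 1
  | sub e e' => e.cost + e'.cost + 1

/-- Division by zero gives zero. -/
noncomputable def RealExp.eval (O : Oracles) (σ : State) : RealExp → ℝ
  | const c => c
  | get x i j => σ.real x (i.eval σ) (j.eval σ)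
  | add r r' => r.eval O σ + r'.eval O σ
  | sub r r' => r.eval O σ - r'.eval O σ
  | mul r r' => r.eval O σ * r'.eval O σ
  | div r r' => r.eval O σ / r'.eval O σ
  | loc i q r r' => O.loc (i.eval σ) q (r.eval O σ) (r'.eval O σ)
  | glob q r r' => O.glob q (r.eval O σ) (r'.eval O σ)

/-- The number of operations in a real expression. -/
def RealExp.cost : RealExp → ℕ
  | const _ => 1
  | get _ i j => i.cost + j.cost + 1
  | add r r' => r.cost + r'.cost + 1
  | sub r r' => r.cost + r'.cost + 1
  | mul r r' => r.cost + r'.cost + 1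
  | div r r' => r.cost + r'.cost + 1
  | loc i _ r r' => i.cost + r.cost + r'.cost + 1
  | glob _ r r' => r.cost + r'.cost + 1

/-- The truth of a test in a state. -/
def Test.Holds (O : Oracles) (σ : State) : Test → Prop
  | natLe e e' => e.eval σ ≤ e'.eval σ
  | realLe r r' => r.eval O σ ≤ r'.eval O σ
  | neg b => ¬ b.Holds O σ
  | and b b' => b.Holds O σ ∧ b'.Holds O σ

/-- The number of operations in a test. -/
def Test.cost : Test → ℕ
  | natLe e e' => e.cost + e'.cost + 1
  | realLe r r' => r.cost + r'.cost + 1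
  | neg b => b.cost + 1
  | and b b' => b.cost + b'.cost + 1

/-- The state after writing `v` to a cell of an integer array. -/
def State.setNat (σ : State) (x i j v : ℕ) : State where
  nat x' i' j' := if x' = x ∧ i' = i ∧ j' = j then v else σ.nat x' i' j'
  real := σ.real

/-- The state after writing `v` to a cell of a real array. -/
noncomputable def State.setReal (σ : State) (x i j : ℕ) (v : ℝ) : State where
  nat := σ.nat
  real x' i' j' := if x' = x ∧ i' = i ∧ j' = j then v else σ.real x' i' j'

/-- `Run O p σ t τ`: started in state `σ`, the program `p` halts after exactly `t` steps in
state `τ`. -/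
inductive Run (O : Oracles) : Prog → State → ℕ → State → Prop
  | skip (σ : State) : Run O Prog.skip σ 1 σ
  | setNat (x : ℕ) (i j e : NatExp) (σ : State) :
      Run O (Prog.setNat x i j e) σ (i.cost + j.cost + e.cost + 1)
        (σ.setNat x (i.eval σ) (j.eval σ) (e.eval σ))
  | setReal (x : ℕ) (i j : NatExp) (r : RealExp) (σ : State) :
      Run O (Prog.setReal x i j r) σ (i.cost + j.cost + r.cost + 1)
        (σ.setReal x (i.eval σ) (j.eval σ) (r.eval O σ))
  | seq {p p' : Prog} {σ τ ρ : State} {s t : ℕ} :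
      Run O p σ s τ → Run O p' τ t ρ → Run O (Prog.seq p p') σ (s + t) ρ
  | ite_true {b : Test} {p p' : Prog} {σ τ : State} {t : ℕ} :
      b.Holds O σ → Run O p σ t τ → Run O (Prog.ite b p p') σ (b.cost + t) τ
  | ite_false {b : Test} {p p' : Prog} {σ τ : State} {t : ℕ} :
      ¬ b.Holds O σ → Run O p' σ t τ → Run O (Prog.ite b p p') σ (b.cost + t) τ
  | while_true {b : Test} {p : Prog} {σ τ ρ : State} {s t : ℕ} :
      b.Holds O σ → Run O p σ s τ → Run O (Prog.while b p) τ t ρ →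
        Run O (Prog.while b p) σ (b.cost + s + t) ρ
  | while_false {b : Test} {p : Prog} {σ : State} :
      ¬ b.Holds O σ → Run O (Prog.while b p) σ b.cost σ

/-- The answers of a first-order oracle for `f` on `D`. -/
noncomputable def answer (D : Set (ℝ × ℝ)) (f : ℝ × ℝ → ℝ) : Query → ℝ → ℝ → ℝ
  | Query.value, α, β => f (α, β)
  | Query.dfst, α, β => fderivWithin ℝ f D (α, β) (1, 0)
  | Query.dsnd, α, β => fderivWithin ℝ f D (α, β) (0, 1)

end RealRAM

/-! ### Input and output -/

namespace MultiTop.Problem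

variable (P : Problem)

/-- First-order access to the functions `f i` and `F`. -/
noncomputable def oracles : RealRAM.Oracles where
  loc i := if h : i < P.m then RealRAM.answer (P.D ⟨i, h⟩) (P.f ⟨i, h⟩) else fun _ _ _ => 0
  glob := RealRAM.answer P.DF P.F

/-- The input: `m`, `n`, `k` are the first cells of the integer arrays 1, 2, 3, and the score
matrices `a`, `b` are the real arrays 0, 1. Everything else is zero. -/
noncomputable def input : RealRAM.State where
  nat x i j :=
    if i = 0 ∧ j = 0 then
      (if x = 1 then P.m else if x = 2 then P.n else if x = 3 then P.k else 0)
    else 0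
  real x i j :=
    if h : i < P.m ∧ j < P.n then
      (if x = 0 then P.a ⟨i, h.1⟩ ⟨j, h.2⟩ else if x = 1 then P.b ⟨i, h.1⟩ ⟨j, h.2⟩ else 0)
    else 0

/-- The output: row `i` of the integer array 0 is the indicator of the `i`-th subset. -/
def output (τ : RealRAM.State) (i : Fin P.m) : Finset (Fin P.n) :=
  Finset.univ.filter fun j => τ.nat 0 i j ≠ 0

end MultiTop.Problem

/-! For each instance, the score pairs of the `k`-subsets have an upper right hull: a concave chain
that starts at a `k`-subset with the largest second score and ends at one with the largest first
score. The chain is built greedily. As long as some exchange of one result for another raises the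
first score, carry out one with the smallest loss of second score per unit of first score. Every set
met on the way is optimal for a weighting of the two scores (`IsTop.of_slope_min`, `IsTop.swap`),
and `rankSum` increases with each exchange, so a chain has fewer than `n * n` segments when `n > 0`
and none otherwise. Both ends of a segment lie in one set with `k + 1` elements, the old set
together with the new result. As scores are non-negative, this set dominates the whole segment.

Every `k`-subset is dominated by a point on its chain (`exists_le_point`), so the optimum is at most
the maximum of the relaxed problem, in which each of the `M` segments gets a multiplicity in `[0,
1]`. It remains to find out which segments are used by some relaxed maximizer: rounding up the last
used segment of each chain to its set with `k + 1` elements can only increase the objective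
(`point_le_candidate`).

Linearizing `F` at a relaxed maximizer gives a price `π` for the two scores, and the problem splits
into the instances (`lin_le_of_obj_le`, `g_point_le`). Whether a segment `l` is used depends on the
sign of the derivative `theta π l` of the local objective at its start (`theta_nonneg`,
`theta_nonpos`). This is the position of the point `(π.2, π.1)` relative to the line `y = ρ l * x -
c l`, whose coefficients do not involve `π`. So, although `π` is unknown, only the cells of an
arrangement of `M` lines matter, and these can be enumerated through the meeting points of pairs of
lines.

The difficulty is the segments whose line passes through the point, as several chains may share them
out in different ways. Among the relevant maximizers with the same total, take the lexicographically
least one, last coordinate first. Exchanges of two or three tied segments that preserve the total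
then show (`exists_direction`) that the tied segments in use can be separated by an index bound `s`
and a threshold in the order of slopes, read in one of two directions. Hence all choices are
described by two lines, an index and a direction (`exists_maximizer`). The program tries the
resulting `2 * M ^ 3` candidates and the starts of the chains, and keeps the best one.

To verify the program, it is written with counting loops only: its effect is then a function `exec`,
and its time is bounded by `exists_run`. -/

namespace RealRAM

/-! ### Loop programs

Programs whose only loops run a counter from zero up to a bound that they do not change. They always
halt, so their effect is a function of the initial state. -/

/-- Programs with counting loops: in `loop x b p` the counter is the first cell of the integer array
`x`, and the bound is the first cell of the integer array `b`. -/
inductive LoopProg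
  | skip
  | setNat (x : ℕ) (i j e : NatExp)
  | setReal (x : ℕ) (i j : NatExp) (r : RealExp)
  | seq (p p' : LoopProg)
  | ite (b : Test) (p p' : LoopProg)
  | loop (x b : ℕ) (p : LoopProg)

/-- The first cell of an integer array. -/
def natVar (x : ℕ) : NatExp := .get x (.const 0) (.const 0)

/-- The first cell of a real array. -/
def realVar (x : ℕ) : RealExp := .get x (.const 0) (.const 0)

@[simp] lemma natVar_eval (σ : State) (x : ℕ) : (natVar x).eval σ = σ.nat x 0 0 := rfl

@[simp] lemma realVar_eval (O : Oracles) (σ : State) (x : ℕ) :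
    (realVar x).eval O σ = σ.real x 0 0 := rfl

namespace State

lemma setNat_nat (σ : State) (x i j v x' i' j' : ℕ) :
    (σ.setNat x i j v).nat x' i' j' = if x' = x ∧ i' = i ∧ j' = j then v else σ.nat x' i' j' := rfl

lemma setReal_real (σ : State) (x i j : ℕ) (v : ℝ) (x' i' j' : ℕ) :
    (σ.setReal x i j v).real x' i' j' =
      if x' = x ∧ i' = i ∧ j' = j then v else σ.real x' i' j' := rfl

@[simp] lemma setNat_real (σ : State) (x i j v : ℕ) : (σ.setNat x i j v).real = σ.real := rfl

@[simp] lemma setReal_nat (σ : State) (x i j : ℕ) (v : ℝ) : (σ.setReal x i j v).nat = σ.nat := rfl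

lemma setNat_nat_of_ne (σ : State) {x y : ℕ} (i j v : ℕ) (h : y ≠ x) :
    (σ.setNat x i j v).nat y = σ.nat y := by
  funext i' j'; simp [setNat_nat, h]

lemma setReal_real_of_ne (σ : State) {x y : ℕ} (i j : ℕ) (v : ℝ) (h : y ≠ x) :
    (σ.setReal x i j v).real y = σ.real y := by
  funext i' j'; simp [setReal_real, h]

@[simp] lemma setNat_nat_self (σ : State) (x i j v : ℕ) : (σ.setNat x i j v).nat x i j = v := by
  simp [setNat_nat]

@[simp] lemma setReal_real_self (σ : State) (x i j : ℕ) (v : ℝ) :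
    (σ.setReal x i j v).real x i j = v := by
  simp [setReal_real]

end State

namespace LoopProg

/-- The integer arrays that a program may change. -/
def natWrites : LoopProg → List ℕ
  | skip => []
  | setNat x _ _ _ => [x]
  | setReal _ _ _ _ => []
  | seq p p' => p.natWrites ++ p'.natWrites
  | ite _ p p' => p.natWrites ++ p'.natWrites
  | loop x _ p => x :: p.natWrites

/-- The real arrays that a program may change. -/
def realWrites : LoopProg → List ℕ
  | skip => []
  | setNat _ _ _ _ => []
  | setReal x _ _ _ => [x]
  | seq p p' => p.realWrites ++ p'.realWrites
  | ite _ p p' => p.realWrites ++ p'.realWrites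
  | loop _ _ p => p.realWrites

/-- The integer arrays that hold bounds of loops. -/
def bounds : LoopProg → List ℕ
  | skip => []
  | setNat _ _ _ _ => []
  | setReal _ _ _ _ => []
  | seq p p' => p.bounds ++ p'.bounds
  | ite _ p p' => p.bounds ++ p'.bounds
  | loop _ b p => b :: p.bounds

/-- No loop body changes the counter of the loop. -/
def CountersSafe : LoopProg → Prop
  | skip => True
  | setNat _ _ _ _ => True
  | setReal _ _ _ _ => True
  | seq p p' => p.CountersSafe ∧ p'.CountersSafe
  | ite _ p p' => p.CountersSafe ∧ p'.CountersSafe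
  | loop x _ p => x ∉ p.natWrites ∧ p.CountersSafe

/-- The translation into programs with general loops. -/
def toProg : LoopProg → Prog
  | skip => .skip
  | setNat x i j e => .setNat x i j e
  | setReal x i j r => .setReal x i j r
  | seq p p' => .seq p.toProg p'.toProg
  | ite b p p' => .ite b p.toProg p'.toProg
  | loop x b p => .seq (.setNat x (.const 0) (.const 0) (.const 0))
      (.while (.neg (.natLe (natVar b) (natVar x)))
        (.seq p.toProg (.setNat x (.const 0) (.const 0) (.add (natVar x) (.const 1)))))

open Classical in
/-- The effect of a program. -/
noncomputable def exec (O : Oracles) : LoopProg → State → State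
  | skip, σ => σ
  | setNat x i j e, σ => σ.setNat x (i.eval σ) (j.eval σ) (e.eval σ)
  | setReal x i j r, σ => σ.setReal x (i.eval σ) (j.eval σ) (r.eval O σ)
  | seq p p', σ => p'.exec O (p.exec O σ)
  | ite b p p', σ => if b.Holds O σ then p.exec O σ else p'.exec O σ
  | loop x b p, σ =>
      (fun τ => (p.exec O τ).setNat x 0 0 ((p.exec O τ).nat x 0 0 + 1))^[σ.nat b 0 0]
        (σ.setNat x 0 0 0)

/-- A factor in the running time that depends on the program text only. -/
def size : LoopProg → ℕ
  | skip => 1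
  | setNat _ i j e => i.cost + j.cost + e.cost + 1
  | setReal _ i j r => i.cost + j.cost + r.cost + 1
  | seq p p' => p.size + p'.size
  | ite b p p' => b.cost + p.size + p'.size
  | loop _ _ p => p.size + 28

/-- The nesting depth of the loops. -/
def depth : LoopProg → ℕ
  | skip => 0
  | setNat _ _ _ _ => 0
  | setReal _ _ _ _ => 0
  | seq p p' => max p.depth p'.depth
  | ite _ p p' => max p.depth p'.depth
  | loop _ _ p => p.depth + 1

variable {O : Oracles}

lemma exec_nat_eq (p : LoopProg) {y : ℕ} (hy : y ∉ p.natWrites) (σ : State) :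
    (p.exec O σ).nat y = σ.nat y := by
  induction p generalizing σ with
  | skip => rfl
  | setNat x i j e =>
    simp only [natWrites, List.mem_singleton] at hy
    exact State.setNat_nat_of_ne _ _ _ _ hy
  | setReal x i j r => rfl
  | seq p p' ih ih' =>
    simp only [natWrites, List.mem_append, not_or] at hy
    simp only [exec]
    rw [ih' hy.2, ih hy.1]
  | ite b p p' ih ih' =>
    simp only [natWrites, List.mem_append, not_or] at hy
    simp only [exec]
    split_ifs
    · exact ih hy.1 σ
    · exact ih' hy.2 σ
  | loop x b p ih =>
    simp only [natWrites, List.mem_cons, not_or] at hy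
    simp only [exec]
    generalize σ.nat b 0 0 = N
    induction N with
    | zero => exact State.setNat_nat_of_ne _ _ _ _ hy.1
    | succ N ihN =>
      rw [Function.iterate_succ_apply', State.setNat_nat_of_ne _ _ _ _ hy.1, ih hy.2, ihN]

lemma exec_real_eq (p : LoopProg) {y : ℕ} (hy : y ∉ p.realWrites) (σ : State) :
    (p.exec O σ).real y = σ.real y := by
  induction p generalizing σ with
  | skip => rfl
  | setNat x i j e => rfl
  | setReal x i j r =>
    simp only [realWrites, List.mem_singleton] at hy
    exact State.setReal_real_of_ne _ _ _ _ hy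
  | seq p p' ih ih' =>
    simp only [realWrites, List.mem_append, not_or] at hy
    simp only [exec]
    rw [ih' hy.2, ih hy.1]
  | ite b p p' ih ih' =>
    simp only [realWrites, List.mem_append, not_or] at hy
    simp only [exec]
    split_ifs
    · exact ih hy.1 σ
    · exact ih' hy.2 σ
  | loop x b p ih =>
    simp only [realWrites] at hy
    simp only [exec]
    generalize σ.nat b 0 0 = N
    induction N with
    | zero => rfl
    | succ N ihN =>
      rw [Function.iterate_succ_apply', State.setNat_real, ih hy, ihN]

/-- The rule for loops: the iterations see the initial contents of all arrays that the loop does not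
change, and the number of previous iterations in the counter. -/
theorem exec_loop_induction {x b : ℕ} {p : LoopProg} (σ : State) (hx : x ∉ p.natWrites)
    (I : ℕ → State → Prop) (h0 : I 0 (σ.setNat x 0 0 0))
    (hs : ∀ k < σ.nat b 0 0, ∀ τ : State, τ.nat x 0 0 = k →
      (∀ y ∉ x :: p.natWrites, τ.nat y = σ.nat y) → (∀ y ∉ p.realWrites, τ.real y = σ.real y) →
      I k τ → I (k + 1) ((p.exec O τ).setNat x 0 0 (k + 1))) :
    I (σ.nat b 0 0) ((loop x b p).exec O σ) := by
  have key : ∀ N ≤ σ.nat b 0 0,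
      let τ := (fun τ => (p.exec O τ).setNat x 0 0 ((p.exec O τ).nat x 0 0 + 1))^[N]
        (σ.setNat x 0 0 0)
      τ.nat x 0 0 = N ∧ (∀ y ∉ x :: p.natWrites, τ.nat y = σ.nat y) ∧
        (∀ y ∉ p.realWrites, τ.real y = σ.real y) ∧ I N τ := by
    intro N
    induction N with
    | zero =>
      intro _
      refine ⟨by simp, fun y hy => ?_, fun y hy => rfl, h0⟩
      exact State.setNat_nat_of_ne _ _ _ _ (List.ne_of_not_mem_cons hy)
    | succ N ih =>
      intro hN
      obtain ⟨h1, h2, h3, h4⟩ := ih (by omega)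
      rw [Function.iterate_succ_apply']
      set τ := (fun τ => (p.exec O τ).setNat x 0 0 ((p.exec O τ).nat x 0 0 + 1))^[N]
        (σ.setNat x 0 0 0)
      have hc : (p.exec O τ).nat x 0 0 = N := by rw [exec_nat_eq p hx, h1]
      refine ⟨by simp [hc], fun y hy => ?_, fun y hy => ?_, ?_⟩
      · rw [State.setNat_nat_of_ne _ _ _ _ (List.ne_of_not_mem_cons hy),
          exec_nat_eq p (List.not_mem_of_not_mem_cons hy), h2 y hy]
      · rw [State.setNat_real, exec_real_eq p hy, h3 y hy]
      · rw [hc]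
        exact hs N (by omega) τ h1 h2 h3 h4
  exact (key _ le_rfl).2.2.2

/-- Loop bounds are never overwritten, so they keep their initial values, at most `B`, and each
level of nesting costs a factor `B + 1`. -/
theorem exists_run (p : LoopProg) (hp : p.CountersSafe) (B : ℕ) (σ : State)
    (hw : ∀ b ∈ p.bounds, b ∉ p.natWrites) (hB : ∀ b ∈ p.bounds, σ.nat b 0 0 ≤ B) :
    ∃ t, Run O p.toProg σ t (p.exec O σ) ∧ t ≤ p.size * (B + 1) ^ p.depth := by
  induction p generalizing σ with
  | skip => exact ⟨1, .skip σ, by simp [size, depth]⟩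
  | setNat x i j e => exact ⟨_, .setNat x i j e σ, by simp [size, depth]⟩
  | setReal x i j r => exact ⟨_, .setReal x i j r σ, by simp [size, depth]⟩
  | seq p p' ih ih' =>
    simp only [bounds, natWrites, List.mem_append] at hw hB
    obtain ⟨s, hs, hs'⟩ := ih hp.1 σ (fun b hb => fun h => hw b (.inl hb) (.inl h))
      (fun b hb => hB b (.inl hb))
    obtain ⟨t, ht, ht'⟩ := ih' hp.2 (p.exec O σ) (fun b hb => fun h => hw b (.inr hb) (.inr h))
      (fun b hb => by
        rw [exec_nat_eq p (fun h => hw b (.inr hb) (.inl h))]; exact hB b (.inr hb))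
    refine ⟨s + t, .seq hs ht, ?_⟩
    simp only [size, depth, add_mul]
    have h1 : (B + 1) ^ p.depth ≤ (B + 1) ^ max p.depth p'.depth :=
      Nat.pow_le_pow_right (by omega) (le_max_left _ _)
    have h2 : (B + 1) ^ p'.depth ≤ (B + 1) ^ max p.depth p'.depth :=
      Nat.pow_le_pow_right (by omega) (le_max_right _ _)
    exact add_le_add (hs'.trans (Nat.mul_le_mul_left _ h1)) (ht'.trans (Nat.mul_le_mul_left _ h2))
  | ite b p p' ih ih' =>
    simp only [bounds, natWrites, List.mem_append] at hw hB
    have h1 : (B + 1) ^ p.depth ≤ (B + 1) ^ max p.depth p'.depth :=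
      Nat.pow_le_pow_right (by omega) (le_max_left _ _)
    have h2 : (B + 1) ^ p'.depth ≤ (B + 1) ^ max p.depth p'.depth :=
      Nat.pow_le_pow_right (by omega) (le_max_right _ _)
    have h3 : b.cost ≤ b.cost * (B + 1) ^ max p.depth p'.depth :=
      Nat.le_mul_of_pos_right _ (by positivity)
    simp only [size, depth, add_mul, exec]
    by_cases hb : b.Holds O σ
    · obtain ⟨s, hs, hs'⟩ := ih hp.1 σ (fun b hb => fun h => hw b (.inl hb) (.inl h))
        (fun b hb => hB b (.inl hb))
      refine ⟨_, by simpa only [if_pos hb] using .ite_true hb hs, ?_⟩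
      have := hs'.trans (Nat.mul_le_mul_left _ h1)
      omega
    · obtain ⟨s, hs, hs'⟩ := ih' hp.2 σ (fun b hb => fun h => hw b (.inr hb) (.inr h))
        (fun b hb => hB b (.inr hb))
      refine ⟨_, by simpa only [if_neg hb] using .ite_false hb hs, ?_⟩
      have := hs'.trans (Nat.mul_le_mul_left _ h2)
      omega
  | loop x b p ih =>
    simp only [bounds, natWrites, List.mem_cons, not_or] at hw hB
    have hxb : x ≠ b := fun h => (hw b (.inl rfl)).1 h.symm
    -- Induction on the number `d` of remaining iterations. Apart from the body, an iteration takes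
    -- 8 steps for the test and 8 for the counter.
    have key : ∀ (d : ℕ) (τ : State), τ.nat x 0 0 + d = τ.nat b 0 0 →
        (∀ y ∈ p.bounds, τ.nat y 0 0 ≤ B) →
        ∃ t, Run O (.while (.neg (.natLe (natVar b) (natVar x)))
          (.seq p.toProg (.setNat x (.const 0) (.const 0) (.add (natVar x) (.const 1))))) τ t
          ((fun τ => (p.exec O τ).setNat x 0 0 ((p.exec O τ).nat x 0 0 + 1))^[d] τ) ∧
          t ≤ d * (p.size * (B + 1) ^ p.depth + 16) + 8 := by
      intro d
      induction d with
      | zero =>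
        intro τ h1 _
        refine ⟨_, .while_false ?_, by simp [Test.cost, NatExp.cost, natVar]⟩
        simp only [Test.Holds, natVar_eval]
        omega
      | succ d ihd =>
        intro τ h1 h2
        obtain ⟨s, hs, hs'⟩ := ih hp.2 τ (fun y hy h => (hw y (.inr hy)).2 h) h2
        have hc : (p.exec O τ).nat x 0 0 = τ.nat x 0 0 := by rw [exec_nat_eq p hp.1]
        obtain ⟨t, ht, ht'⟩ := ihd
          ((p.exec O τ).setNat x 0 0 ((p.exec O τ).nat x 0 0 + 1)) (by
            rw [State.setNat_nat_self, State.setNat_nat_of_ne _ _ _ _ hxb.symm,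
              exec_nat_eq p (hw b (.inl rfl)).2, hc]
            omega) (fun y hy => by
            rw [State.setNat_nat_of_ne _ _ _ _ (hw y (.inr hy)).1,
              exec_nat_eq p (hw y (.inr hy)).2]
            exact h2 y hy)
        refine ⟨_, .while_true ?_ (.seq hs (.setNat x _ _ _ _)) ht, ?_⟩
        · simp only [Test.Holds, natVar_eval]
          omega
        · simp only [Test.cost, NatExp.cost, natVar]
          rw [add_mul]
          omega
    obtain ⟨t, ht, ht'⟩ := key (σ.nat b 0 0) (σ.setNat x 0 0 0) (by
      rw [State.setNat_nat_self, State.setNat_nat_of_ne _ _ _ _ hxb.symm]; omega) (fun y hy => by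
      rw [State.setNat_nat_of_ne _ _ _ _ (hw y (.inr hy)).1]
      exact hB y (.inr hy))
    refine ⟨_, .seq (.setNat x _ _ _ _) ht, ?_⟩
    simp only [NatExp.cost, size, depth]
    have h1 : σ.nat b 0 0 ≤ B := hB b (.inl rfl)
    have h2 : 1 ≤ (B + 1) ^ p.depth := Nat.one_le_pow _ _ (by omega)
    -- The 12 steps outside the iterations are 4 for the initialization and 8 for the failing test;
    -- together with the 16 per iteration this is the 28 in `size`.
    calc 1 + 1 + 1 + 1 + t ≤ σ.nat b 0 0 * (p.size * (B + 1) ^ p.depth + 16) + 12 := by omega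
      _ ≤ B * (p.size * (B + 1) ^ p.depth + 16) + 12 := by gcongr
      _ ≤ (p.size + 28) * (B + 1) ^ (p.depth + 1) := by
        rw [pow_succ]
        nlinarith [Nat.zero_le (p.size * (B + 1) ^ p.depth), Nat.zero_le B]

end LoopProg
end RealRAM

/-! ### Combining functions -/

namespace MultiTop.IsCombining

variable {D : Set (ℝ × ℝ)} {f : ℝ × ℝ → ℝ}

/-- Membership in a quadrant is tested coordinate by coordinate, so lower bounds from two different
points suffice. This puts the lower left corner of a chain into the range. -/
lemma mem_of_le_of_le (h : IsCombining D f) {x y w : ℝ × ℝ} (hx : x ∈ D) (hy : y ∈ D)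
    (h1 : x.1 ≤ w.1) (h2 : y.2 ≤ w.2) : w ∈ D := by
  rcases h.range with rfl | rfl
  · exact ⟨le_trans hx.1 h1, le_trans hy.2 h2⟩
  · exact ⟨lt_of_lt_of_le hx.1 h1, lt_of_lt_of_le hy.2 h2⟩

lemma mem_of_le (h : IsCombining D f) {x y : ℝ × ℝ} (hx : x ∈ D) (hxy : x ≤ y) : y ∈ D :=
  h.mem_of_le_of_le hx hx hxy.1 hxy.2

lemma le_of_le (h : IsCombining D f) {x y : ℝ × ℝ} (hx : x ∈ D) (hxy : x ≤ y) : f x ≤ f y := by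
  have hm : (y.1, x.2) ∈ D := h.mem_of_le hx ⟨hxy.1, le_rfl⟩
  have h1 : f x ≤ f (y.1, x.2) := by
    rcases hxy.1.lt_or_eq with h1 | h1
    · exact (h.strictMono_fst x.1 y.1 x.2 hx hm h1).le
    · rw [← h1]
  have h2 : f (y.1, x.2) ≤ f y := by
    rcases hxy.2.lt_or_eq with h2 | h2
    · exact (h.strictMono_snd y.1 x.2 y.2 hm (h.mem_of_le hx hxy) h2).le
    · rw [h2]
  exact h1.trans h2

lemma lt_add_snd (h : IsCombining D f) {x : ℝ × ℝ} (hx : x ∈ D) {t : ℝ} (ht : 0 < t) :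
    f x < f (x + (0, t)) := by
  have e : x + (0, t) = (x.1, x.2 + t) := by ext <;> simp
  rw [e]
  exact h.strictMono_snd x.1 x.2 (x.2 + t) hx
    (h.mem_of_le (y := (x.1, x.2 + t)) hx ⟨le_rfl, by simpa using ht.le⟩) (by linarith)

lemma hasFDerivWithinAt (h : IsCombining D f) {x : ℝ × ℝ} (hx : x ∈ D) :
    HasFDerivWithinAt f (fderivWithin ℝ f D x) D x :=
  ((h.contDiff.differentiableOn one_ne_zero) x hx).hasFDerivWithinAt

lemma continuousOn (h : IsCombining D f) : ContinuousOn f D := h.contDiff.continuousOn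

/-- The quotients are one-sided because `x` may lie on the boundary of the closed quadrant;
convexity keeps the segment towards `y` inside the range. -/
lemma tendsto_slope (h : IsCombining D f) {x y : ℝ × ℝ} (hx : x ∈ D) (hy : y ∈ D) :
    Filter.Tendsto (fun t : ℝ => (f (x + t • (y - x)) - f x) / t) (nhdsWithin 0 (Set.Ioc 0 1))
      (nhds (fderivWithin ℝ f D x (y - x))) := by
  have h1 : HasFDerivWithinAt f (fderivWithin ℝ f D x) D (x + (0 : ℝ) • (y - x)) := by
    simpa using h.hasFDerivWithinAt hx
  have h2 : HasDerivWithinAt (fun t : ℝ => x + t • (y - x)) (y - x) (Set.Icc 0 1) 0 := by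
    simpa using (((hasDerivAt_id (0 : ℝ)).smul_const (y - x)).const_add x).hasDerivWithinAt
  have h3 : Set.MapsTo (fun t : ℝ => x + t • (y - x)) (Set.Icc 0 1) D := fun t ht =>
    h.concave.1.add_smul_sub_mem hx hy ht
  have h4 := HasFDerivWithinAt.comp_hasDerivWithinAt (0 : ℝ) h1 h2 h3
  have h5 := hasDerivWithinAt_iff_tendsto_slope.1 h4
  have e : Set.Icc (0 : ℝ) 1 \ {0} = Set.Ioc 0 1 := Set.Icc_sdiff_left
  rw [e] at h5
  refine h5.congr fun t => ?_
  simp [slope_def_field]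

lemma neBot_Ioc : (nhdsWithin (0 : ℝ) (Set.Ioc 0 1)).NeBot :=
  left_nhdsWithin_Ioc_neBot zero_lt_one

lemma fderivWithin_le (h : IsCombining D f) {x y : ℝ × ℝ} (hx : x ∈ D) (hy : y ∈ D) {K : ℝ}
    (hK : ∀ t ∈ Set.Ioc (0 : ℝ) 1, f (x + t • (y - x)) ≤ f x + t * K) :
    fderivWithin ℝ f D x (y - x) ≤ K := by
  have := neBot_Ioc
  refine le_of_tendsto (h.tendsto_slope hx hy) ?_
  filter_upwards [self_mem_nhdsWithin] with t ht
  rw [div_le_iff₀ ht.1]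
  linarith [hK t ht]

lemma concave_segment (h : IsCombining D f) {x y : ℝ × ℝ} (hx : x ∈ D) (hy : y ∈ D) {t : ℝ}
    (ht : t ∈ Set.Icc (0 : ℝ) 1) : f x + t * (f y - f x) ≤ f (x + t • (y - x)) := by
  have := h.concave.2 hx hy (sub_nonneg.2 ht.2) ht.1 (by ring)
  have e : (1 - t) • x + t • y = x + t • (y - x) := by module
  rw [e] at this
  simp only [smul_eq_mul] at this
  linarith

/-- The supergradient inequality: by concavity all difference quotients towards `y` are at least `f
y - f x`. -/
lemma le_fderivWithin (h : IsCombining D f) {x y : ℝ × ℝ} (hx : x ∈ D) (hy : y ∈ D) :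
    f y ≤ f x + fderivWithin ℝ f D x (y - x) := by
  have := neBot_Ioc
  have : f y - f x ≤ fderivWithin ℝ f D x (y - x) := by
    refine ge_of_tendsto (h.tendsto_slope hx hy) ?_
    filter_upwards [self_mem_nhdsWithin] with t ht
    rw [le_div_iff₀ ht.1]
    linarith [h.concave_segment hx hy ⟨ht.1.le, ht.2⟩]
  linarith

lemma fderivWithin_snd_pos (h : IsCombining D f) {x : ℝ × ℝ} (hx : x ∈ D) :
    0 < fderivWithin ℝ f D x (0, 1) := by
  have hy : x + (0, 1) ∈ D := h.mem_of_le hx (by constructor <;> simp)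
  have := h.le_fderivWithin hx hy
  rw [add_sub_cancel_left] at this
  linarith [h.lt_add_snd hx zero_lt_one]

end MultiTop.IsCombining

/-! ### Arrangements of lines -/

namespace MultiTop

section Arrangement

variable {L : Type*} [LinearOrder L]

/-- The order of lines by slope (increasing or decreasing), and then by index. -/
def SlopeLE (ρ : L → ℝ) (up : Bool) (l l' : L) : Prop :=
  (if up = true then ρ l < ρ l' else ρ l' < ρ l) ∨ (ρ l = ρ l' ∧ l ≤ l')

/-- The line `l` with the equation `y = ρ l * x - c l` is below the line `l₁` at the abscissa `q`,
or it meets it there and is among the lines up to the index `s` and up to `l₁` in the order of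
slopes. -/
def IsBelow (ρ c : L → ℝ) (q : ℝ) (l₁ s : L) (up : Bool) (l : L) : Prop :=
  ρ l * q - c l < ρ l₁ * q - c l₁ ∨
    (ρ l * q - c l = ρ l₁ * q - c l₁ ∧ l ≤ s ∧ SlopeLE ρ up l l₁)

/-- The abscissa where two lines meet. -/
noncomputable def crossing (ρ c : L → ℝ) (l₁ l₂ : L) : ℝ := (c l₁ - c l₂) / (ρ l₁ - ρ l₂)

lemma crossing_self {L : Type*} {ρ c : L → ℝ} (l : L) : crossing ρ c l l = 0 := by simp [crossing]

lemma sub_eq_mul_sub_crossing {L : Type*} {ρ c : L → ℝ} {l₁ l : L} (h : ρ l ≠ ρ l₁) (q : ℝ) :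
    (ρ l * q - c l) - (ρ l₁ * q - c l₁) = (ρ l - ρ l₁) * (q - crossing ρ c l₁ l) := by
  have : ρ l₁ - ρ l ≠ 0 := sub_ne_zero.2 h.symm
  unfold crossing
  field_simp
  ring

variable {ρ c : L → ℝ}

lemma SlopeLE.total (up : Bool) (l l' : L) : SlopeLE ρ up l l' ∨ SlopeLE ρ up l' l := by
  unfold SlopeLE
  rcases lt_trichotomy (ρ l) (ρ l') with h | h | h <;> rcases le_total l l' with h' | h' <;>
    cases up <;> simp only [if_true, if_false, Bool.false_eq_true] <;> grind

lemma SlopeLE.trans {up : Bool} {a b d : L} (h : SlopeLE ρ up a b) (h' : SlopeLE ρ up b d) :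
    SlopeLE ρ up a d := by
  unfold SlopeLE at *
  cases up <;> simp only [if_true, if_false, Bool.false_eq_true] at * <;> grind

lemma SlopeLE.exists_max (up : Bool) {S : Finset L} (hS : S.Nonempty) :
    ∃ e ∈ S, ∀ l ∈ S, SlopeLE ρ up l e := by
  induction hS using Finset.Nonempty.cons_induction with
  | singleton a => exact ⟨a, by simp, by simp [SlopeLE]⟩
  | cons a S _ _ ih =>
    obtain ⟨e, he, h⟩ := ih
    rcases SlopeLE.total (ρ := ρ) up a e with h1 | h1
    · refine ⟨e, by simp [he], fun l hl => ?_⟩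
      rcases Finset.mem_cons.1 hl with rfl | hl
      exacts [h1, h l hl]
    · refine ⟨a, by simp, fun l hl => ?_⟩
      rcases Finset.mem_cons.1 hl with rfl | hl
      exacts [.inr ⟨rfl, le_rfl⟩, (h l hl).trans h1]

/-- Every abscissa can be replaced by one where the first line meets another one, or by zero. -/
lemma exists_isBelow_crossing [Finite L] {q : ℝ} (hq : 0 ≤ q) {e s : L} (hes : e ≤ s) (up : Bool) :
    ∃ l₂ s' up', ∀ l, IsBelow ρ c q e s up l ↔ IsBelow ρ c (crossing ρ c e l₂) e s' up' l := by
  by_cases hA : ∃ l₂, ρ l₂ * q - c l₂ = ρ e * q - c e ∧ ρ l₂ ≠ ρ e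
  · obtain ⟨l₂, h1, h2⟩ := hA
    refine ⟨l₂, s, up, fun l => ?_⟩
    have h3 := sub_eq_mul_sub_crossing (c := c) h2 q
    rw [h1, sub_self, eq_comm, mul_eq_zero, or_iff_right (sub_ne_zero.2 h2), sub_eq_zero] at h3
    rw [h3]
  push Not at hA
  -- No line of another slope meets `e` at `q`, so slide left along `e` to the last crossing in `[0,
  -- q]`; the convention `crossing ρ c e e = 0` ensures that there is one. Immediately to the right
  -- of it the lines are ordered against `e` as they are at `q`. Hence ties at the new abscissa are
  -- broken by increasing slope, with no restriction on the index.
  have hfin : {l | 0 ≤ crossing ρ c e l ∧ crossing ρ c e l ≤ q}.Finite := Set.toFinite _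
  obtain ⟨l₂, ⟨h0, h0'⟩, hmax⟩ := hfin.exists_maximalFor (fun l => crossing ρ c e l) _
    ⟨e, by simp [crossing_self, hq]⟩
  have hmax' : ∀ l, 0 ≤ crossing ρ c e l → crossing ρ c e l ≤ q →
      crossing ρ c e l ≤ crossing ρ c e l₂ := fun l h1 h2 =>
    (le_total (crossing ρ c e l) (crossing ρ c e l₂)).elim id fun h => hmax ⟨h1, h2⟩ h
  have : Nonempty L := ⟨e⟩
  obtain ⟨top, htop⟩ := Finite.exists_max (id : L → L)
  refine ⟨l₂, top, true, fun l => ?_⟩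
  set q₀ := crossing ρ c e l₂
  by_cases hl : ρ l = ρ e
  · have hup : SlopeLE ρ up l e ↔ l ≤ e := by cases up <;> simp [SlopeLE, hl]
    have hup' : SlopeLE ρ true l e ↔ l ≤ e := by simp [SlopeLE, hl]
    simp only [IsBelow, hl, hup, hup', sub_lt_sub_iff_left, sub_right_inj]
    have : l ≤ top := htop l
    grind
  · have h1 := sub_eq_mul_sub_crossing (c := c) hl q
    have h2 := sub_eq_mul_sub_crossing (c := c) hl q₀
    have hne : crossing ρ c e l ≠ q := by
      intro h
      rw [h, sub_self, mul_zero, sub_eq_zero] at h1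
      exact hl (hA l h1)
    have hne' : ρ l * q - c l ≠ ρ e * q - c e := fun h => hl (hA l h)
    set x := crossing ρ c e l
    have hL : IsBelow ρ c q e s up l ↔ (ρ l - ρ e) * (q - x) < 0 := by
      rw [← h1]
      simp [IsBelow, hne', sub_neg]
    have hR : IsBelow ρ c q₀ e top true l ↔
        (ρ l - ρ e) * (q₀ - x) < 0 ∨ ((ρ l - ρ e) * (q₀ - x) = 0 ∧ ρ l < ρ e) := by
      rw [← h2]
      have : l ≤ top := htop l
      simp [IsBelow, SlopeLE, hl, this, sub_neg, sub_eq_zero]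
    rw [hL, hR]
    have hd : ρ l - ρ e ≠ 0 := sub_ne_zero.2 hl
    rcases lt_or_gt_of_ne hne with hx | hx
    · have hx0 : x ≤ q₀ := by
        by_contra! h
        exact absurd (hmax' l (h0.trans h.le) hx.le) (not_le.2 h)
      rw [mul_neg_iff, mul_neg_iff, mul_eq_zero]
      have a1 : 0 < q - x := by linarith
      have a2 : 0 ≤ q₀ - x := by linarith
      grind
    · have a1 : q - x < 0 := by linarith
      have a2 : q₀ - x < 0 := by linarith
      rw [mul_neg_iff, mul_neg_iff, mul_eq_zero]
      grind

/-- The set of the lines that pass below a point, or none, is found at a meeting point. -/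
lemma exists_isBelow_of_lt [Finite L] {q : ℝ} (hq : 0 ≤ q) (p : ℝ) :
    (∀ l, ¬ ρ l * q - c l < p) ∨ ∃ l₁ l₂ s up, ∀ l,
      ρ l * q - c l < p ↔ IsBelow ρ c (crossing ρ c l₁ l₂) l₁ s up l := by
  classical
  refine or_iff_not_imp_left.2 fun h => ?_
  push Not at h
  have : Nonempty L := h.nonempty
  have := Fintype.ofFinite L
  -- Lower the point to the highest line under it. With the last line through the new point, in the
  -- order of slopes, as the reference, all lines through it count as below.
  have hfin : {l | ρ l * q - c l < p}.Finite := Set.toFinite _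
  obtain ⟨e₀, he₀, hmax⟩ := hfin.exists_maximalFor (fun l => ρ l * q - c l) _ h
  obtain ⟨e, he, hemax⟩ := SlopeLE.exists_max (ρ := ρ) true
    (S := Finset.univ.filter fun l => ρ l * q - c l = ρ e₀ * q - c e₀) ⟨e₀, by simp⟩
  simp only [Finset.mem_filter, Finset.mem_univ, true_and] at he hemax
  obtain ⟨top, htop⟩ := Finite.exists_max (id : L → L)
  have htop' : e ≤ top := htop e
  obtain ⟨l₂, s', up', h'⟩ := exists_isBelow_crossing (ρ := ρ) (c := c) hq htop' true
  refine ⟨e, l₂, s', up', fun l => ?_⟩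
  rw [← h']
  have hle : l ≤ top := htop l
  have := hemax l
  have h3 : ρ l * q - c l < p → ρ l * q - c l ≤ ρ e₀ * q - c e₀ := fun h1 =>
    (le_total (ρ l * q - c l) (ρ e₀ * q - c e₀)).elim id fun h => hmax h1 h
  have h4 : ρ e₀ * q - c e₀ < p := he₀
  unfold IsBelow
  rw [he]
  constructor
  · intro h1
    rcases (h3 h1).lt_or_eq with h2 | h2
    · exact .inl h2
    · exact .inr ⟨h2, hle, this h2⟩
  · rintro (h1 | h1)
    · exact h1.trans h4
    · exact h1.1.trans_lt h4

end Arrangement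

end MultiTop

/-! ### Feasible directions and lexicographic minimizers -/

namespace MultiTop

/-- `v` points from `x` into the set `A`. -/
def FeasibleDir {E : Type*} [AddCommGroup E] [Module ℝ E] (A : Set E) (x v : E) : Prop :=
  ∃ ε > (0 : ℝ), ∀ t ∈ Set.Icc 0 ε, x + t • v ∈ A

namespace FeasibleDir

variable {E : Type*} [AddCommGroup E] [Module ℝ E] {A : Set E} {x v w : E}

/-- The point `x + t • (v + w)` is the midpoint of `x + (2 * t) • v` and `x + (2 * t) • w`. -/
lemma add (hA : Convex ℝ A) (hv : FeasibleDir A x v) (hw : FeasibleDir A x w) :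
    FeasibleDir A x (v + w) := by
  obtain ⟨ε, hε, h⟩ := hv
  obtain ⟨ε', hε', h'⟩ := hw
  refine ⟨min ε ε' / 2, by positivity, fun t ht => ?_⟩
  have h1 := h (2 * t) ⟨by linarith [ht.1], by linarith [ht.2, min_le_left ε ε']⟩
  have h2 := h' (2 * t) ⟨by linarith [ht.1], by linarith [ht.2, min_le_right ε ε']⟩
  have := hA h1 h2 (a := 1 / 2) (b := 1 / 2) (by norm_num) (by norm_num) (by norm_num)
  convert this using 1
  module

lemma smul (hv : FeasibleDir A x v) {a : ℝ} (ha : 0 < a) : FeasibleDir A x (a • v) := by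
  obtain ⟨ε, hε, h⟩ := hv
  refine ⟨ε / a, by positivity, fun t ht => ?_⟩
  rw [smul_smul]
  exact h _ ⟨mul_nonneg ht.1 ha.le, by rw [← le_div_iff₀ ha]; exact ht.2⟩

end FeasibleDir

/-- Minimize the coordinates one after another, starting with the last; each time the minimizers
that remain form a compact set. -/
lemma exists_lex_min {M : ℕ} {K : Set (Fin M → ℝ)} (hK : IsCompact K) (hne : K.Nonempty) :
    ∃ y ∈ K, ∀ y' ∈ K, ∀ l, (∀ l', l < l' → y' l' = y l') → y l ≤ y' l := by
  suffices h : ∀ r ≤ M, ∃ y ∈ K, ∀ y' ∈ K, ∀ l : Fin M, M ≤ l.val + r →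
      (∀ l', l < l' → y' l' = y l') → y l ≤ y' l by
    obtain ⟨y, hy, h⟩ := h M le_rfl
    exact ⟨y, hy, fun y' hy' l => h y' hy' l (by omega)⟩
  intro r
  induction r with
  | zero =>
    intro _
    obtain ⟨y, hy⟩ := hne
    exact ⟨y, hy, fun y' _ l h => absurd l.2 (by omega)⟩
  | succ r ih =>
    intro hr
    obtain ⟨y, hy, h⟩ := ih (by omega)
    let a : Fin M := ⟨M - (r + 1), by omega⟩
    have hK' : IsCompact (K ∩ {y' | ∀ l', a < l' → y' l' = y l'}) := by
      refine hK.inter_right ?_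
      simp only [Set.ofPred_forall]
      exact isClosed_iInter fun l' => isClosed_iInter fun _ =>
        isClosed_eq (continuous_apply l') continuous_const
    obtain ⟨w, ⟨hw, hw'⟩, hmin⟩ := hK'.exists_isMinOn ⟨y, hy, fun _ _ => rfl⟩
      (f := fun y' => y' a) (continuous_apply a).continuousOn
    refine ⟨w, hw, fun y' hy' l hl h' => ?_⟩
    rcases eq_or_ne l a with rfl | hla
    · exact hmin ⟨hy', fun l' hl' => (h' l' hl').trans (hw' l' hl')⟩
    · have hal : a < l := by
        refine lt_of_le_of_ne ?_ hla.symm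
        change M - (r + 1) ≤ l.val
        omega
      rw [hw' l hal]
      refine h y' hy' l ?_ fun l' hl' => (h' l' hl').trans (hw' l' (hal.trans hl'))
      have : M - (r + 1) < l.val := hal
      omega

lemma convex_unitBox (M : ℕ) : Convex ℝ (Set.Icc (0 : Fin M → ℝ) 1) := convex_Icc 0 1

lemma feasibleDir_single {M : ℕ} {y : Fin M → ℝ} (hy : y ∈ Set.Icc (0 : Fin M → ℝ) 1) {l : Fin M}
    (h : y l < 1) : FeasibleDir (Set.Icc (0 : Fin M → ℝ) 1) y (Pi.single l 1) := by
  refine ⟨1 - y l, by linarith, fun t ht => ⟨fun k => ?_, fun k => ?_⟩⟩ <;>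
  · have h1 := hy.1 k
    have h2 := hy.2 k
    rcases eq_or_ne k l with rfl | hk
    · simp at *; linarith [ht.1, ht.2]
    · simp [hk] at h1 h2 ⊢; assumption

lemma feasibleDir_neg_single {M : ℕ} {y : Fin M → ℝ} (hy : y ∈ Set.Icc (0 : Fin M → ℝ) 1)
    {l : Fin M} (h : 0 < y l) :
    FeasibleDir (Set.Icc (0 : Fin M → ℝ) 1) y (-Pi.single l 1) := by
  refine ⟨y l, h, fun t ht => ⟨fun k => ?_, fun k => ?_⟩⟩ <;>
  · have h1 := hy.1 k
    have h2 := hy.2 k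
    rcases eq_or_ne k l with rfl | hk
    · simp at *; linarith [ht.1, ht.2]
    · simp [hk] at h1 h2 ⊢; assumption

/-! ### Concave chains and the relaxed problem -/

/-- For each instance a concave chain of segments in the plane, that starts at the point `z i`. The
segment `l` belongs to the chain `own l`, and it is the vector `δ l • (1, -ρ l)`. -/
structure ChainSystem (ι : Type*) [Fintype ι] [DecidableEq ι] (M : ℕ) where
  own : Fin M → ι
  z : ι → ℝ × ℝ
  δ : Fin M → ℝ
  ρ : Fin M → ℝ
  D : ι → Set (ℝ × ℝ)
  f : ι → ℝ × ℝ → ℝ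
  DF : Set (ℝ × ℝ)
  F : ℝ × ℝ → ℝ
  δ_pos : ∀ l, 0 < δ l
  ρ_nonneg : ∀ l, 0 ≤ ρ l
  ρ_mono : ∀ l l', own l = own l' → l ≤ l' → ρ l ≤ ρ l'
  comb : ∀ i, IsCombining (D i) (f i)
  combF : IsCombining DF F
  corner_mem : ∀ i, z i + (0, -∑ l with own l = i, δ l * ρ l) ∈ D i
  cornerF_mem : ∑ i, (z i + (0, -∑ l with own l = i, δ l * ρ l)) ∈ DF

namespace ChainSystem

variable {ι : Type*} [Fintype ι] [DecidableEq ι] {M : ℕ} (C : ChainSystem ι M)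

/-- The segments as vectors. -/
def d (l : Fin M) : ℝ × ℝ := (C.δ l, -(C.δ l * C.ρ l))

/-- The displacement of a chain, if each segment `l` is taken with the multiplicity `w l`. -/
def disp (w : Fin M → ℝ) (i : ι) : ℝ × ℝ := ∑ l with C.own l = i, w l • C.d l

/-- The point reached along the chain `i`. -/
def point (y : Fin M → ℝ) (i : ι) : ℝ × ℝ := C.z i + C.disp y i

/-- The sum of the points. -/
def total (y : Fin M → ℝ) : ℝ × ℝ := ∑ i, C.point y i

/-- The relaxed objective. -/
def obj (y : Fin M → ℝ) : ℝ := C.F (C.total y) + ∑ i, C.f i (C.point y i)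

/-- The local objective, with a price for the scores. -/
def g (π : ℝ × ℝ) (i : ι) (x : ℝ × ℝ) : ℝ := π.1 * x.1 + π.2 * x.2 + C.f i x

/-- The sum of the local objectives. -/
def lin (π : ℝ × ℝ) (y : Fin M → ℝ) : ℝ := ∑ i, C.g π i (C.point y i)

/-- The multiplicities of the segments before `l`. -/
def before (l : Fin M) : Fin M → ℝ := fun l' => if l' < l then 1 else 0

/-- The start of the segment `l`. -/
def vertex (l : Fin M) : ℝ × ℝ := C.point (before l) (C.own l)

/-- The derivative of the local function at the start of the segment `l`, per unit of the first
score. -/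
noncomputable def c (l : Fin M) : ℝ :=
  fderivWithin ℝ (C.f (C.own l)) (C.D (C.own l)) (C.vertex l) (1, -C.ρ l)

lemma before_mem (l : Fin M) : before l ∈ Set.Icc (0 : Fin M → ℝ) 1 := by
  constructor <;> intro k <;> simp only [before] <;> split_ifs <;> simp

lemma disp_add (v w : Fin M → ℝ) (i : ι) : C.disp (v + w) i = C.disp v i + C.disp w i := by
  simp [disp, add_smul, Finset.sum_add_distrib]

lemma disp_smul (t : ℝ) (w : Fin M → ℝ) (i : ι) : C.disp (t • w) i = t • C.disp w i := by
  simp [disp, mul_smul, Finset.smul_sum]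

lemma disp_neg (w : Fin M → ℝ) (i : ι) : C.disp (-w) i = -C.disp w i := by
  simp [disp]

lemma disp_single (l : Fin M) (i : ι) :
    C.disp (Pi.single l 1) i = if C.own l = i then C.d l else 0 := by
  unfold disp
  rw [Finset.sum_filter, Finset.sum_eq_single l]
  · simp
  · intro k _ hk; simp [hk]
  · simp

lemma point_add_smul (y w : Fin M → ℝ) (t : ℝ) (i : ι) :
    C.point (y + t • w) i = C.point y i + t • C.disp w i := by
  simp only [point, disp_add, disp_smul]; abel

lemma point_add_smul_sub (y y' : Fin M → ℝ) (t : ℝ) (i : ι) :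
    C.point (y + t • (y' - y)) i = C.point y i + t • (C.point y' i - C.point y i) := by
  rw [point_add_smul]
  simp [point, disp, sub_smul]

lemma point_sub (y y' : Fin M → ℝ) (i : ι) :
    C.point y i - C.point y' i = ∑ l with C.own l = i, (y l - y' l) • C.d l := by
  simp [point, disp, sub_smul]

lemma total_add_smul (y w : Fin M → ℝ) (t : ℝ) :
    C.total (y + t • w) = C.total y + t • ∑ i, C.disp w i := by
  simp [total, point_add_smul, Finset.sum_add_distrib, Finset.smul_sum]

/-- The multiplicities need not fill a chain in order, so a point may lie below the chain. It still
lies above the corner formed by the smallest first and the smallest second score of the chain, which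
is why the corner is required to be in the range. -/
lemma corner_le {y : Fin M → ℝ} (hy : y ∈ Set.Icc (0 : Fin M → ℝ) 1) (i : ι) :
    C.z i + (0, -∑ l with C.own l = i, C.δ l * C.ρ l) ≤ C.point y i := by
  unfold point
  gcongr
  constructor
  · simp only [disp, Prod.fst_sum]
    exact Finset.sum_nonneg fun l _ => mul_nonneg (hy.1 l) (C.δ_pos l).le
  · simp only [disp, Prod.snd_sum, ← Finset.sum_neg_distrib]
    refine Finset.sum_le_sum fun l _ => ?_
    simp only [d, Prod.smul_mk, smul_eq_mul]
    have := mul_nonneg (C.δ_pos l).le (C.ρ_nonneg l)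
    have h2 : y l ≤ 1 := hy.2 l
    nlinarith

lemma point_mem {y : Fin M → ℝ} (hy : y ∈ Set.Icc (0 : Fin M → ℝ) 1) (i : ι) :
    C.point y i ∈ C.D i :=
  (C.comb i).mem_of_le (C.corner_mem i) (C.corner_le hy i)

lemma total_mem {y : Fin M → ℝ} (hy : y ∈ Set.Icc (0 : Fin M → ℝ) 1) : C.total y ∈ C.DF :=
  C.combF.mem_of_le C.cornerF_mem (Finset.sum_le_sum fun i _ => C.corner_le hy i)

lemma continuous_point (i : ι) : Continuous fun y => C.point y i := by
  unfold point disp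
  fun_prop

lemma continuous_total : Continuous C.total :=
  continuous_finsetSum _ fun i _ => C.continuous_point i

lemma continuousOn_f (i : ι) :
    ContinuousOn (fun y => C.f i (C.point y i)) (Set.Icc (0 : Fin M → ℝ) 1) :=
  (C.comb i).continuousOn.comp (C.continuous_point i).continuousOn fun _ hy => C.point_mem hy i

lemma continuousOn_obj : ContinuousOn C.obj (Set.Icc (0 : Fin M → ℝ) 1) :=
  (C.combF.continuousOn.comp C.continuous_total.continuousOn fun _ hy => C.total_mem hy).add
    (continuousOn_finsetSum _ fun i _ => C.continuousOn_f i)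

lemma continuousOn_lin (π : ℝ × ℝ) : ContinuousOn (C.lin π) (Set.Icc (0 : Fin M → ℝ) 1) := by
  refine continuousOn_finsetSum _ fun i _ => ContinuousOn.add ?_ (C.continuousOn_f i)
  exact (((C.continuous_point i).fst.const_mul _).add
    ((C.continuous_point i).snd.const_mul _)).continuousOn

lemma lin_eq (π : ℝ × ℝ) (y : Fin M → ℝ) : C.lin π y =
    π.1 * (C.total y).1 + π.2 * (C.total y).2 + ∑ i, C.f i (C.point y i) := by
  simp [lin, g, total, Finset.sum_add_distrib, Finset.mul_sum, Prod.fst_sum, Prod.snd_sum]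

lemma g_concave (π : ℝ × ℝ) (i : ι) : ConcaveOn ℝ (C.D i) (C.g π i) := by
  refine ConcaveOn.add ?_ (C.comb i).concave
  refine ⟨(C.comb i).concave.1, fun x _ y _ a b _ _ _ => le_of_eq ?_⟩
  simp
  ring

lemma lin_concave (π : ℝ × ℝ) : ConcaveOn ℝ (Set.Icc (0 : Fin M → ℝ) 1) (C.lin π) := by
  refine ⟨convex_unitBox M, fun x hx y hy a b ha hb hab => ?_⟩
  simp only [lin, smul_eq_mul, Finset.mul_sum, ← Finset.sum_add_distrib]
  refine Finset.sum_le_sum fun i _ => ?_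
  have := (C.g_concave π i).2 (C.point_mem hx i) (C.point_mem hy i) ha hb hab
  have e : C.point (a • x + b • y) i = a • C.point x i + b • C.point y i := by
    simp only [point, disp_add, disp_smul, smul_add]
    have : C.z i = a • C.z i + b • C.z i := by rw [← add_smul, hab, one_smul]
    nth_rewrite 1 [this]
    abel
  rw [e]
  simpa using this

/-- The gradient of the global function, as a price. -/
noncomputable def price (y : Fin M → ℝ) : ℝ × ℝ :=
  (fderivWithin ℝ C.F C.DF (C.total y) (1, 0), fderivWithin ℝ C.F C.DF (C.total y) (0, 1))

lemma apply_eq (φ : ℝ × ℝ →L[ℝ] ℝ) (v : ℝ × ℝ) : φ v = φ (1, 0) * v.1 + φ (0, 1) * v.2 := by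
  have : v = v.1 • ((1 : ℝ), (0 : ℝ)) + v.2 • ((0 : ℝ), (1 : ℝ)) := by ext <;> simp
  conv_lhs => rw [this, map_add, map_smul, map_smul]
  simp only [smul_eq_mul]
  ring

/-- A maximizer of the relaxed objective maximizes its linearization. -/
lemma lin_le_of_obj_le {y₀ : Fin M → ℝ} (h₀ : y₀ ∈ Set.Icc (0 : Fin M → ℝ) 1)
    (hmax : ∀ y ∈ Set.Icc (0 : Fin M → ℝ) 1, C.obj y ≤ C.obj y₀) {y : Fin M → ℝ}
    (hy : y ∈ Set.Icc (0 : Fin M → ℝ) 1) : C.lin (C.price y₀) y ≤ C.lin (C.price y₀) y₀ := by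
  set Φ : (Fin M → ℝ) → ℝ := fun y => ∑ i, C.f i (C.point y i) with hΦ
  -- On the way from `y₀` to `y` the concave local part `Φ` gains at least `t * (Φ y - Φ y₀)`; as
  -- `y₀` is optimal, `F` gains at most `t * K`, and this bounds its derivative.
  have key := C.combF.fderivWithin_le (C.total_mem h₀) (C.total_mem hy) (K := Φ y₀ - Φ y)
    fun t ht => by
      have hmem := (convex_unitBox M).add_smul_sub_mem h₀ hy ⟨ht.1.le, ht.2⟩
      have h1 := hmax _ hmem
      have e : C.total (y₀ + t • (y - y₀)) = C.total y₀ + t • (C.total y - C.total y₀) := by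
        simp only [total, point_add_smul_sub, Finset.sum_add_distrib, ← Finset.smul_sum,
          Finset.sum_sub_distrib]
      have h2 : (1 - t) * Φ y₀ + t * Φ y ≤ Φ (y₀ + t • (y - y₀)) := by
        simp only [hΦ, Finset.mul_sum, ← Finset.sum_add_distrib]
        refine Finset.sum_le_sum fun i _ => ?_
        rw [point_add_smul_sub]
        linarith [(C.comb i).concave_segment (C.point_mem h₀ i) (C.point_mem hy i)
          ⟨ht.1.le, ht.2⟩]
      simp only [obj] at h1
      rw [e] at h1
      simp only [hΦ] at h2 ⊢
      linarith
  rw [apply_eq] at key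
  rw [lin_eq, lin_eq]
  simp only [price, Prod.fst_sub, Prod.snd_sub, hΦ] at key ⊢
  linarith

/-- The linearized objective is a sum over the instances with independent variables. Replacing the
multiplicities of one chain only isolates its summand. -/
lemma g_point_le {π : ℝ × ℝ} {y : Fin M → ℝ} (hy : y ∈ Set.Icc (0 : Fin M → ℝ) 1)
    (hmax : ∀ y' ∈ Set.Icc (0 : Fin M → ℝ) 1, C.lin π y' ≤ C.lin π y) {y' : Fin M → ℝ}
    (hy' : y' ∈ Set.Icc (0 : Fin M → ℝ) 1) (i : ι) :
    C.g π i (C.point y' i) ≤ C.g π i (C.point y i) := by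
  let w : Fin M → ℝ := fun l => if C.own l = i then y' l else y l
  have hw : w ∈ Set.Icc (0 : Fin M → ℝ) 1 := by
    constructor <;> intro l <;> simp only [w] <;> split_ifs
    exacts [hy'.1 l, hy.1 l, hy'.2 l, hy.2 l]
  have h1 : C.point w i = C.point y' i := by
    simp only [point, disp, add_right_inj]
    refine Finset.sum_congr rfl fun l hl => ?_
    simp only [Finset.mem_filter] at hl
    simp [w, hl.2]
  have h2 : ∀ j ≠ i, C.point w j = C.point y j := by
    intro j hj
    simp only [point, disp, add_right_inj]
    refine Finset.sum_congr rfl fun l hl => ?_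
    simp only [Finset.mem_filter] at hl
    simp [w, hl.2, hj]
  have h3 := hmax w hw
  unfold lin at h3
  rw [← Finset.add_sum_erase _ _ (Finset.mem_univ i),
    ← Finset.add_sum_erase (a := i) _ (fun j => C.g π j (C.point y j)) (Finset.mem_univ i), h1,
    Finset.sum_congr rfl fun j hj => by rw [h2 j (Finset.ne_of_mem_erase hj)]] at h3
  linarith

end ChainSystem

end MultiTop

namespace MultiTop.ChainSystem

variable {ι : Type*} [Fintype ι] [DecidableEq ι] {M : ℕ} (C : ChainSystem ι M)

/-! ### Canonical maximizers -/

/-- The multiplicities at which the linearized objective is at least as large as at `y`. -/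
def upper (π : ℝ × ℝ) (y : Fin M → ℝ) : Set (Fin M → ℝ) :=
  {y' ∈ Set.Icc 0 1 | C.lin π y ≤ C.lin π y'}

/-- `y` maximizes the linearized objective, and it is lexicographically minimal (with the last
segments first) among the maximizers with the same total. -/
structure Canonical (π : ℝ × ℝ) (y : Fin M → ℝ) : Prop where
  price_nonneg : 0 ≤ π.2
  mem : y ∈ Set.Icc (0 : Fin M → ℝ) 1
  lin_le : ∀ y' ∈ Set.Icc (0 : Fin M → ℝ) 1, C.lin π y' ≤ C.lin π y
  lex : ∀ y' ∈ C.upper π y, C.total y' = C.total y → ∀ l, (∀ l', l < l' → y' l' = y l') →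
    y l ≤ y' l

/-- The derivative of the local objective at the start of the segment `l`, per unit of the first
score. -/
noncomputable def theta (π : ℝ × ℝ) (l : Fin M) : ℝ := π.1 - C.ρ l * π.2 + C.c l

/-- The derivative of the local objective with respect to the second score at the start of the
segment `l`. -/
noncomputable def gam (π : ℝ × ℝ) (l : Fin M) : ℝ :=
  π.2 + fderivWithin ℝ (C.f (C.own l)) (C.D (C.own l)) (C.vertex l) (0, 1)

/-- The vector of multiplicities that moves along the segment `l` by one unit of the first score. -/
noncomputable def unit (l : Fin M) : Fin M → ℝ := (C.δ l)⁻¹ • Pi.single l 1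

lemma unit_def (l : Fin M) : C.unit l = (C.δ l)⁻¹ • Pi.single l 1 := rfl

lemma disp_unit (l : Fin M) (i : ι) :
    C.disp (C.unit l) i = if C.own l = i then (1, -C.ρ l) else 0 := by
  have := (C.δ_pos l).ne'
  rw [unit, disp_smul, disp_single]
  split_ifs
  · ext <;> simp [d, this]
  · simp

lemma sum_disp_unit (l : Fin M) : ∑ i, C.disp (C.unit l) i = (1, -C.ρ l) := by
  simp [disp_unit]

lemma unit_self (l : Fin M) : C.unit l l = (C.δ l)⁻¹ := by simp [unit]

lemma unit_of_ne {l k : Fin M} (h : k ≠ l) : C.unit l k = 0 := by simp [unit, h]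

/-- Restrict to the total of a relaxed maximizer `y₀`. There `F` and the price term are constant, so
being at least as good as `y₀` for the linearization means the same for the original objective, and
the lexicographic minimum can be taken without loss. -/
lemma exists_canonical : ∃ π y, C.Canonical π y ∧
    ∀ y' ∈ Set.Icc (0 : Fin M → ℝ) 1, C.obj y' ≤ C.obj y := by
  obtain ⟨y₀, h₀, hmax⟩ := (isCompact_Icc (a := (0 : Fin M → ℝ)) (b := 1)).exists_isMaxOn
    ⟨0, by simp⟩ C.continuousOn_obj
  set π := C.price y₀
  have hlin : ∀ y ∈ Set.Icc (0 : Fin M → ℝ) 1, C.lin π y ≤ C.lin π y₀ := fun y hy =>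
    C.lin_le_of_obj_le h₀ (fun y hy => hmax hy) hy
  have hK : IsCompact ((Set.Icc (0 : Fin M → ℝ) 1 ∩ C.lin π ⁻¹' Set.Ici (C.lin π y₀)) ∩
      C.total ⁻¹' {C.total y₀}) :=
    (isCompact_Icc.of_isClosed_subset
      ((C.continuousOn_lin π).preimage_isClosed_of_isClosed isClosed_Icc isClosed_Ici)
      Set.inter_subset_left).inter_right (isClosed_singleton.preimage C.continuous_total)
  obtain ⟨y, ⟨⟨hy, hy1⟩, hy2⟩, hlex⟩ := exists_lex_min hK ⟨y₀, ⟨⟨h₀, le_refl (C.lin π y₀)⟩, rfl⟩⟩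
  have hy1 : C.lin π y₀ ≤ C.lin π y := hy1
  have hy2 : C.total y = C.total y₀ := hy2
  refine ⟨π, y, ⟨(C.combF.fderivWithin_snd_pos (C.total_mem h₀)).le, hy,
    fun y' hy' => (hlin y' hy').trans hy1, ?_⟩, fun y' hy' => (hmax hy').trans ?_⟩
  · rintro y' ⟨h1, h2⟩ h3 l
    exact hlex y' ⟨⟨h1, hy1.trans h2⟩, h3.trans hy2⟩ l
  · rw [lin_eq, lin_eq, hy2] at hy1
    simp only [obj, hy2]
    linarith

variable {C} {π : ℝ × ℝ} {y : Fin M → ℝ}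

lemma gam_pos (h : 0 ≤ π.2) (l : Fin M) : 0 < C.gam π l :=
  add_pos_of_nonneg_of_pos h ((C.comb _).fderivWithin_snd_pos (C.point_mem (before_mem l) _))

namespace Canonical

lemma convex_upper : Convex ℝ (C.upper π y) := (C.lin_concave π).convex_ge _

variable (h : C.Canonical π y)
include h

/-- A small step along `w` keeps the total and the optimality but lowers the last coordinate that it
changes, against the lexicographic minimality. All exchange arguments end here. -/
lemma not_feasible {w : Fin M → ℝ} (hw : FeasibleDir (C.upper π y) y w)
    (hd : ∑ i, C.disp w i = 0) {l : Fin M} (hl : w l < 0) (htop : ∀ l', l < l' → w l' = 0) :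
    False := by
  obtain ⟨ε, hε, hw⟩ := hw
  have := h.lex _ (hw ε ⟨hε.le, le_rfl⟩) (by rw [total_add_smul, hd, smul_zero, add_zero]) l
    (fun l' hl' => by simp [htop l' hl'])
  simp only [Pi.add_apply, Pi.smul_apply, smul_eq_mul] at this
  nlinarith

/-- A chain is filled in order. Otherwise shift one unit of first score from the later segment to
the earlier one. If the earlier slope is smaller, this gains second score at no cost; if the slopes
agree, nothing changes except that the multiplicities become lexicographically smaller. -/
lemma eq_one_of_pos {l l' : Fin M} (hl : l < l') (ho : C.own l = C.own l') (hp : 0 < y l') :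
    y l = 1 := by
  by_contra hne
  have hlt : y l < 1 := lt_of_le_of_ne (h.mem.2 l) hne
  have hδ := inv_pos.2 (C.δ_pos l)
  have hδ' := inv_pos.2 (C.δ_pos l')
  set w : Fin M → ℝ := C.unit l + (C.δ l')⁻¹ • (-Pi.single l' 1) with hw
  have hw' : w = C.unit l + -C.unit l' := by simp [hw, unit]
  have hfeas : FeasibleDir (Set.Icc (0 : Fin M → ℝ) 1) y w :=
    ((feasibleDir_single h.mem hlt).smul hδ).add (convex_unitBox M)
      ((feasibleDir_neg_single h.mem hp).smul hδ')
  have hdisp : ∀ i, C.disp w i = if C.own l = i then (0, C.ρ l' - C.ρ l) else 0 := by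
    intro i
    rw [hw', disp_add, disp_neg, disp_unit, disp_unit, ← ho]
    split_ifs
    · ext <;> simp; ring
    · simp
  rcases (C.ρ_mono l l' ho hl.le).lt_or_eq with hρ | hρ
  · obtain ⟨ε, hε, hf⟩ := hfeas
    have h1 := C.g_point_le h.mem h.lin_le (hf ε ⟨hε.le, le_rfl⟩) (C.own l)
    rw [point_add_smul, hdisp, if_pos rfl] at h1
    have hpos : 0 < ε * (C.ρ l' - C.ρ l) := mul_pos hε (sub_pos.2 hρ)
    have h2 := (C.comb (C.own l)).lt_add_snd (C.point_mem h.mem (C.own l)) hpos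
    simp only [g, Prod.smul_mk, smul_eq_mul, mul_zero, Prod.fst_add, Prod.snd_add, add_zero] at h1
    nlinarith [mul_nonneg h.price_nonneg hpos.le]
  · have hz : ∀ i, C.disp w i = 0 := fun i => by simp [hdisp, hρ]
    refine h.not_feasible (w := w) (l := l') ?_ (by simp [hz]) ?_ ?_
    · obtain ⟨ε, hε, hf⟩ := hfeas
      refine ⟨ε, hε, fun t ht => ⟨hf t ht, le_of_eq ?_⟩⟩
      simp [lin, point_add_smul, hz]
    · simp [hw', unit_of_ne C hl.ne', unit_self, C.δ_pos]
    · intro k hk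
      simp [hw', unit_of_ne C hk.ne', unit_of_ne C (hl.trans hk).ne']

lemma eq_zero_of_zero {l l' : Fin M} (hl : l < l') (ho : C.own l = C.own l') (hp : y l = 0) :
    y l' = 0 := by
  by_contra hne
  have := h.eq_one_of_pos hl ho (lt_of_le_of_ne (h.mem.1 l') (Ne.symm hne))
  rw [hp] at this
  exact zero_ne_one this

omit h in
/-- The summands of the supergradient inequality at the start of the segment `l`. -/
lemma g_le_vertex (hy : y ∈ Set.Icc (0 : Fin M → ℝ) 1) (l : Fin M) :
    C.g π (C.own l) (C.point y (C.own l)) ≤ C.g π (C.own l) (C.vertex l) +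
      ∑ k with C.own k = C.own l, (y k - before l k) *
        (C.δ k * (C.theta π l - (C.ρ k - C.ρ l) * C.gam π l)) := by
  have h1 := (C.comb (C.own l)).le_fderivWithin (C.point_mem (before_mem l) (C.own l))
    (C.point_mem hy (C.own l))
  set φ := fderivWithin ℝ (C.f (C.own l)) (C.D (C.own l)) (C.point (before l) (C.own l)) with hφ
  have h2 : φ (C.point y (C.own l) - C.point (before l) (C.own l)) +
      π.1 * (C.point y (C.own l) - C.point (before l) (C.own l)).1 +
      π.2 * (C.point y (C.own l) - C.point (before l) (C.own l)).2 =
      ∑ k with C.own k = C.own l, (y k - before l k) *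
        (C.δ k * (C.theta π l - (C.ρ k - C.ρ l) * C.gam π l)) := by
    rw [point_sub, map_sum, Prod.fst_sum, Prod.snd_sum, Finset.mul_sum, Finset.mul_sum,
      ← Finset.sum_add_distrib, ← Finset.sum_add_distrib]
    refine Finset.sum_congr rfl fun k _ => ?_
    have e1 : C.c l = φ (1, 0) - C.ρ l * φ (0, 1) := by
      rw [c, apply_eq]; simp only [hφ, vertex]; ring
    have e2 : C.gam π l = π.2 + φ (0, 1) := rfl
    rw [map_smul, apply_eq φ (C.d k), theta, e1, e2]
    simp only [d, Prod.smul_mk, smul_eq_mul]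
    ring
  rw [← h2]
  simp only [g, vertex, Prod.fst_sub, Prod.snd_sub]
  linarith

/-- The point of `y` is optimal in its chain, so the value at the start of `l` is no larger. If no
summand of the supergradient inequality is positive, equality must hold throughout. -/
lemma term_eq_zero {l : Fin M}
    (ht : ∀ k, C.own k = C.own l → (y k - before l k) *
        (C.δ k * (C.theta π l - (C.ρ k - C.ρ l) * C.gam π l)) ≤ 0) :
    C.g π (C.own l) (C.vertex l) = C.g π (C.own l) (C.point y (C.own l)) ∧
    ∀ k, C.own k = C.own l → (y k - before l k) *
        (C.δ k * (C.theta π l - (C.ρ k - C.ρ l) * C.gam π l)) = 0 := by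
  have h1 := g_le_vertex (C := C) (π := π) h.mem l
  have h2 : C.g π (C.own l) (C.vertex l) ≤ C.g π (C.own l) (C.point y (C.own l)) :=
    C.g_point_le h.mem h.lin_le (before_mem l) (C.own l)
  have h3 : ∀ k ∈ Finset.univ.filter fun k => C.own k = C.own l, (y k - before l k) *
        (C.δ k * (C.theta π l - (C.ρ k - C.ρ l) * C.gam π l)) ≤ 0 :=
    fun k hk => ht k (Finset.mem_filter.1 hk).2
  have h4 := Finset.sum_nonpos h3
  refine ⟨by linarith, fun k hk => ?_⟩
  exact (Finset.sum_eq_zero_iff_of_nonpos h3).1 (by linarith) k (by simp [hk])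

lemma sub_before_nonneg {l : Fin M} (hl : 0 < y l) {k : Fin M} (hk : C.own k = C.own l) :
    0 ≤ y k - before l k := by
  unfold before
  split_ifs with hkl
  · rw [h.eq_one_of_pos hkl hk hl, sub_self]
  · simpa using h.mem.1 k

lemma sub_before_nonpos {l : Fin M} (hl : y l = 0) {k : Fin M} (hk : C.own k = C.own l) :
    y k - before l k ≤ 0 := by
  unfold before
  split_ifs with hkl
  · exact sub_nonpos.2 (h.mem.2 k)
  · rcases (not_lt.1 hkl).eq_or_lt with rfl | hlt
    · simp [hl]
    · simp [h.eq_zero_of_zero hlt hk.symm hl]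

/-- Segments before `l` are full and contribute nothing; later ones are at least as steep, so their
factor is at most that of `l`. -/
lemma term_nonpos_of_pos {l : Fin M} (hl : 0 < y l) (hθ : C.theta π l ≤ 0) (k : Fin M)
    (hk : C.own k = C.own l) :
    (y k - before l k) * (C.δ k * (C.theta π l - (C.ρ k - C.ρ l) * C.gam π l)) ≤ 0 := by
  by_cases hkl : k < l
  · simp [before, hkl, h.eq_one_of_pos hkl hk hl]
  · refine mul_nonpos_of_nonneg_of_nonpos (h.sub_before_nonneg hl hk)
      (mul_nonpos_of_nonneg_of_nonpos (C.δ_pos k).le ?_)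
    have := C.ρ_mono l k hk.symm (not_lt.1 hkl)
    nlinarith [gam_pos (C := C) h.price_nonneg l]

/-- Here the later segments are empty and contribute nothing, while the earlier ones are at most as
steep, with a non-negative factor. -/
lemma term_nonpos_of_zero {l : Fin M} (hl : y l = 0) (hθ : 0 ≤ C.theta π l) (k : Fin M)
    (hk : C.own k = C.own l) :
    (y k - before l k) * (C.δ k * (C.theta π l - (C.ρ k - C.ρ l) * C.gam π l)) ≤ 0 := by
  by_cases hkl : k < l
  · refine mul_nonpos_of_nonpos_of_nonneg (h.sub_before_nonpos hl hk)
      (mul_nonneg (C.δ_pos k).le ?_)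
    have := C.ρ_mono k l hk hkl.le
    nlinarith [gam_pos (C := C) h.price_nonneg l]
  · have : y k = 0 := by
      rcases (not_lt.1 hkl).eq_or_lt with rfl | hlt
      exacts [hl, h.eq_zero_of_zero hlt hk.symm hl]
    simp [before, hkl, this]

/-- If `theta` were negative, the summand of `l` itself would be negative, but all summands vanish.
-/
lemma theta_nonneg {l : Fin M} (hl : 0 < y l) : 0 ≤ C.theta π l := by
  by_contra! hθ
  have := (h.term_eq_zero (h.term_nonpos_of_pos hl hθ.le)).2 l rfl
  simp only [before, lt_irrefl, if_false, sub_zero, sub_self, zero_mul, mul_eq_zero, hl.ne',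
    (C.δ_pos l).ne', hθ.ne, or_self] at this

/-- If `theta` were positive, the start of `l` would have the same value as the optimum, and moving
on along `l` would improve it. -/
lemma theta_nonpos {l : Fin M} (hl : y l = 0) : C.theta π l ≤ 0 := by
  by_contra! hθ
  have hv := (h.term_eq_zero (h.term_nonpos_of_zero hl hθ.le)).1
  have hw : ∀ t ∈ Set.Icc (0 : ℝ) 1, before l + t • Pi.single l 1 ∈ Set.Icc (0 : Fin M → ℝ) 1 := by
    refine fun t ht => ⟨fun k => ?_, fun k => ?_⟩ <;>
    · rcases eq_or_ne k l with rfl | hk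
      · simp [before, ht.1, ht.2]
      · have h1 := (before_mem l).1 k
        have h2 := (before_mem l).2 k
        simp [hk] at h1 h2 ⊢
        assumption
  have hpt : ∀ t : ℝ, C.point (before l + t • Pi.single l 1) (C.own l) =
      C.vertex l + t • C.d l := fun t => by
    rw [point_add_smul, disp_single, if_pos rfl]; rfl
  have hmem : C.vertex l ∈ C.D (C.own l) := C.point_mem (before_mem l) _
  have hmem' : C.vertex l + C.d l ∈ C.D (C.own l) := by
    have := C.point_mem (hw 1 ⟨zero_le_one, le_rfl⟩) (C.own l)
    rwa [hpt, one_smul] at this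
  have key := (C.comb (C.own l)).fderivWithin_le hmem hmem'
    (K := -(π.1 * (C.d l).1 + π.2 * (C.d l).2)) fun t ht => by
      have h1 := C.g_point_le h.mem h.lin_le (hw t ⟨ht.1.le, ht.2⟩) (C.own l)
      rw [← hv, hpt] at h1
      simp only [g, Prod.fst_add, Prod.snd_add, Prod.smul_fst, Prod.smul_snd, smul_eq_mul] at h1
      rw [add_sub_cancel_left]
      linarith
  rw [add_sub_cancel_left] at key
  have e : C.d l = C.δ l • ((1 : ℝ), -C.ρ l) := by ext <;> simp [d]
  rw [e, map_smul] at key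
  change C.δ l * C.c l ≤ _ at key
  simp only [Prod.smul_mk, smul_eq_mul] at key
  have : C.δ l * C.theta π l ≤ 0 := by unfold theta; linarith
  nlinarith [C.δ_pos l]

/-- Where the local objective is flat up to the start of the segment `l`, one may move to it. -/
lemma feasible_of_flat {l k : Fin M} (hk : C.own k = C.own l) (hθ : C.theta π l = 0)
    (ht : ∀ k, C.own k = C.own l → (y k - before l k) *
        (C.δ k * (C.theta π l - (C.ρ k - C.ρ l) * C.gam π l)) ≤ 0)
    (hs : (∀ k, C.own k = C.own l → 0 ≤ y k - before l k) ∨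
      (∀ k, C.own k = C.own l → y k - before l k ≤ 0)) (hne : y k - before l k ≠ 0) :
    C.ρ k = C.ρ l ∧ FeasibleDir (C.upper π y) y (-((y k - before l k) • Pi.single k 1)) := by
  obtain ⟨hv, hz⟩ := h.term_eq_zero ht
  have hρ : ∀ k, C.own k = C.own l → y k - before l k ≠ 0 → C.ρ k = C.ρ l := by
    intro k hk hne
    have := hz k hk
    simp only [hθ, mul_eq_zero, hne, (C.δ_pos k).ne', false_or, zero_sub, neg_eq_zero,
      (gam_pos (C := C) h.price_nonneg l).ne', or_false] at this
    linarith
  refine ⟨hρ k hk hne, 1, one_pos, fun t ht => ⟨?_, ?_⟩⟩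
  · have h1 := h.mem.1
    have h2 := h.mem.2
    have h3 := (before_mem l).1
    have h4 := (before_mem l).2
    refine ⟨fun j => ?_, fun j => ?_⟩ <;>
    · have h1 := h1 j
      have h2 := h2 j
      have h3 := h3 j
      have h4 := h4 j
      rcases eq_or_ne j k with rfl | hj
      · simp at h1 h2 h3 h4 ⊢
        nlinarith [ht.1, ht.2]
      · simp [hj] at h1 h2 ⊢
        assumption
  · set a : Fin M → ℝ := fun k => y k - before l k with ha
    have hsub : C.point y (C.own l) - C.vertex l =
        (∑ k with C.own k = C.own l, a k * C.δ k) • ((1 : ℝ), -C.ρ l) := by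
      rw [vertex, point_sub, Finset.sum_smul]
      refine Finset.sum_congr rfl fun j hj => ?_
      have hj := (Finset.mem_filter.1 hj).2
      by_cases hj0 : a j = 0
      · simp only [ha] at hj0 ⊢; simp [hj0]
      · ext <;> simp [d, ha, hρ j hj hj0]; ring
    set η := ∑ k with C.own k = C.own l, a k * C.δ k with hη
    -- All segments between the start of `l` and the point of `y` are parallel to `l`, and their
    -- contributions have the same sign. So changing the coordinate `k` alone covers a fraction `r`
    -- of the way to the start of `l`, where the objective has the same value; by concavity it is no
    -- smaller in between.
    obtain ⟨r, hr0, hr1, hr⟩ : ∃ r : ℝ, 0 ≤ r ∧ r ≤ 1 ∧ a k * C.δ k = r * η := by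
      have hkm : k ∈ Finset.univ.filter fun j => C.own j = C.own l := by simp [hk]
      rcases hs with hs | hs
      · have h1 : 0 < a k * C.δ k :=
          mul_pos (lt_of_le_of_ne (hs k hk) (Ne.symm hne)) (C.δ_pos k)
        have h2 : a k * C.δ k ≤ η := Finset.single_le_sum (f := fun k => a k * C.δ k)
          (fun j hj => mul_nonneg (hs j (Finset.mem_filter.1 hj).2) (C.δ_pos j).le) hkm
        have h3 : 0 < η := h1.trans_le h2
        exact ⟨a k * C.δ k / η, by positivity, (div_le_one h3).2 h2, by field_simp⟩
      · have h1 : a k * C.δ k < 0 :=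
          mul_neg_of_neg_of_pos (lt_of_le_of_ne (hs k hk) hne) (C.δ_pos k)
        have h2 : η ≤ a k * C.δ k := by
          have := Finset.single_le_sum (f := fun k => -(a k * C.δ k))
            (fun j hj => by
              have := mul_nonpos_of_nonpos_of_nonneg (hs j (Finset.mem_filter.1 hj).2)
                (C.δ_pos j).le
              simp only [ha]
              linarith) hkm
          rw [Finset.sum_neg_distrib] at this
          linarith
        have h3 : η < 0 := h2.trans_lt h1
        refine ⟨a k * C.δ k / η, div_nonneg_of_nonpos h1.le h3.le, ?_, ?_⟩
        · rw [div_le_one_of_neg h3]; exact h2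
        · exact (div_mul_cancel₀ _ h3.ne).symm
    refine Finset.sum_le_sum fun i _ => ?_
    have hd : C.disp (-((y k - before l k) • Pi.single k 1)) i =
        if C.own l = i then r • (C.vertex l - C.point y (C.own l)) else 0 := by
      rw [disp_neg, disp_smul, disp_single, hk]
      split_ifs
      · rw [← neg_sub (C.point y (C.own l)) (C.vertex l), hsub, smul_neg, smul_smul, ← hr]
        ext <;> simp [d, ha, hρ k hk hne]; ring
      · simp
    rw [point_add_smul, hd]
    split_ifs with hi
    · subst hi
      have hc := (C.g_concave π (C.own l)).2 (C.point_mem h.mem (C.own l))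
        (C.point_mem (before_mem l) (C.own l))
        (show 0 ≤ 1 - t * r by nlinarith [ht.1, ht.2]) (mul_nonneg ht.1 hr0) (by ring)
      have e : (1 - t * r) • C.point y (C.own l) + (t * r) • C.point (before l) (C.own l) =
          C.point y (C.own l) + t • r • (C.vertex l - C.point y (C.own l)) := by
        rw [vertex]; module
      rw [e] at hc
      have hv' : C.g π (C.own l) (C.point (before l) (C.own l)) =
        C.g π (C.own l) (C.point y (C.own l)) := hv
      rw [hv'] at hc
      simp only [smul_eq_mul] at hc
      linarith
    · simp

lemma feasible_neg_single {l : Fin M} (hl : 0 < y l) (hθ : C.theta π l = 0) :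
    FeasibleDir (C.upper π y) y (-Pi.single l 1) := by
  have hb : y l - before l l = y l := by simp [before]
  have := (h.feasible_of_flat rfl hθ (h.term_nonpos_of_pos hl hθ.le)
    (.inl fun k hk => h.sub_before_nonneg hl hk) (k := l) (by rw [hb]; exact hl.ne')).2
  have := this.smul (inv_pos.2 hl)
  rwa [hb, smul_neg, smul_smul, inv_mul_cancel₀ hl.ne', one_smul] at this

/-- With `l` unused and tied, its start is again optimal, so an earlier segment that is not full can
be filled further. It is necessarily parallel to `l`. -/
lemma feasible_single {l k : Fin M} (hk : C.own k = C.own l) (hl : y l = 0)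
    (hθ : C.theta π l = 0) (hkl : k < l) (hk1 : y k < 1) :
    C.ρ k = C.ρ l ∧ FeasibleDir (C.upper π y) y (Pi.single k 1) := by
  have hb : y k - before l k = -(1 - y k) := by simp [before, hkl]
  have h1 : 0 < 1 - y k := by linarith
  have := h.feasible_of_flat hk hθ (h.term_nonpos_of_zero hl hθ.ge)
    (.inr fun k hk => h.sub_before_nonpos hl hk) (k := k) (by rw [hb]; linarith)
  refine ⟨this.1, ?_⟩
  have := this.2.smul (inv_pos.2 h1)
  rwa [hb, neg_smul, neg_neg, smul_smul, inv_mul_cancel₀ h1.ne', one_smul] at this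

/-! ### Exchange of segments -/

/-- Otherwise trade `j` for the parallel segment `i` of smaller index. -/
lemma le_of_slope_eq {i j : Fin M} (hi : FeasibleDir (C.upper π y) y (Pi.single i 1))
    (hj : FeasibleDir (C.upper π y) y (-Pi.single j 1)) (hρ : C.ρ j = C.ρ i) : j ≤ i := by
  by_contra! hij
  refine h.not_feasible (w := C.unit i + (C.δ j)⁻¹ • (-Pi.single j 1)) (l := j)
    ((hi.smul (inv_pos.2 (C.δ_pos i))).add convex_upper (hj.smul (inv_pos.2 (C.δ_pos j))))
    ?_ ?_ ?_
  · rw [smul_neg, ← unit_def]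
    simp [disp_add, disp_neg, Finset.sum_add_distrib, sum_disp_unit, hρ]
  · simp [unit_of_ne C hij.ne', C.δ_pos]
  · intro k hk
    simp [unit_of_ne C (hij.trans hk).ne', hk.ne']

/-- The direction of `s` is a positive combination of those of `i` and `i'`, so `s` could be traded
for these two segments of smaller index. -/
lemma not_between_up {i i' s : Fin M} (hi : FeasibleDir (C.upper π y) y (Pi.single i 1))
    (hi' : FeasibleDir (C.upper π y) y (Pi.single i' 1))
    (hs : FeasibleDir (C.upper π y) y (-Pi.single s 1)) (his : i < s) (his' : i' < s)
    (h1 : C.ρ i < C.ρ s) (h2 : C.ρ s < C.ρ i') : False := by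
  have a1 : 0 < C.ρ i' - C.ρ s := sub_pos.2 h2
  have a2 : 0 < C.ρ s - C.ρ i := sub_pos.2 h1
  have a3 : 0 < C.ρ i' - C.ρ i := by linarith
  refine h.not_feasible (w := (C.ρ i' - C.ρ s) • C.unit i + (C.ρ s - C.ρ i) • C.unit i' +
      (C.ρ i' - C.ρ i) • (C.δ s)⁻¹ • (-Pi.single s 1)) (l := s)
    ((((hi.smul (inv_pos.2 (C.δ_pos i))).smul a1).add convex_upper
      ((hi'.smul (inv_pos.2 (C.δ_pos i'))).smul a2)).add convex_upper
      ((hs.smul (inv_pos.2 (C.δ_pos s))).smul a3)) ?_ ?_ ?_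
  · simp only [smul_neg, ← unit_def, disp_add, disp_smul, disp_neg, Finset.sum_add_distrib, ← Finset.smul_sum,
      Finset.sum_neg_distrib, sum_disp_unit]
    ext <;> simp; ring
  · simp [unit_of_ne C his.ne', unit_of_ne C his'.ne', C.δ_pos, h1.trans h2]
  · intro k hk
    simp [unit_of_ne C (his.trans hk).ne', unit_of_ne C (his'.trans hk).ne', hk.ne']

/-- Now `i` replaces a positive combination of `s` and `j`, both of which can be reduced; the
largest index involved is that of `s`, which decreases. -/
lemma not_between_down {i j s : Fin M} (hi : FeasibleDir (C.upper π y) y (Pi.single i 1))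
    (hj : FeasibleDir (C.upper π y) y (-Pi.single j 1))
    (hs : FeasibleDir (C.upper π y) y (-Pi.single s 1)) (his : i < s) (hjs : j < s) {u v : ℝ}
    (hu : 0 < u) (hv : 0 < v) (huv : (u + v) * C.ρ i = u * C.ρ s + v * C.ρ j) : False := by
  refine h.not_feasible (w := (u + v) • C.unit i + v • (C.δ j)⁻¹ • (-Pi.single j 1) +
      u • (C.δ s)⁻¹ • (-Pi.single s 1)) (l := s)
    ((((hi.smul (inv_pos.2 (C.δ_pos i))).smul (add_pos hu hv)).add convex_upper
      ((hj.smul (inv_pos.2 (C.δ_pos j))).smul hv)).add convex_upper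
      ((hs.smul (inv_pos.2 (C.δ_pos s))).smul hu)) ?_ ?_ ?_
  · simp only [smul_neg, ← unit_def, disp_add, disp_smul, disp_neg, Finset.sum_add_distrib, ← Finset.smul_sum,
      Finset.sum_neg_distrib, sum_disp_unit]
    ext <;> simp; linarith
  · simp [unit_of_ne C his.ne', hjs.ne', C.δ_pos, hu]
  · intro k hk
    simp [unit_of_ne C (his.trans hk).ne', (hjs.trans hk).ne', hk.ne']

/-- By the exchanges, the segments before `s` that can be increased all have slopes on the same side
of that of `s`, and no element of `T` lies strictly beyond any of them on that side. This determines
the direction `up`; equal slopes are settled by the index. -/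
lemma exists_direction {T : Set (Fin M)} {s : Fin M} (hs : s ∈ T) (hmax : ∀ j ∈ T, j ≤ s)
    (hT : ∀ j ∈ T, FeasibleDir (C.upper π y) y (-Pi.single j 1)) :
    ∃ up, ∀ j ∈ T, ∀ i < s, FeasibleDir (C.upper π y) y (Pi.single i 1) →
      SlopeLE C.ρ up j i := by
  have hne : ∀ i < s, FeasibleDir (C.upper π y) y (Pi.single i 1) → C.ρ i ≠ C.ρ s :=
    fun i his hi hρ => absurd (h.le_of_slope_eq hi (hT s hs) hρ.symm) (not_le.2 his)
  by_cases hex : ∃ i < s, FeasibleDir (C.upper π y) y (Pi.single i 1) ∧ C.ρ s < C.ρ i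
  · obtain ⟨i', his', hi', hρ'⟩ := hex
    refine ⟨true, fun j hj i his hi => ?_⟩
    have h1 : C.ρ s < C.ρ i := by
      refine lt_of_le_of_ne (not_lt.1 fun hlt => ?_) (hne i his hi).symm
      exact h.not_between_up hi hi' (hT s hs) his his' hlt hρ'
    rcases lt_trichotomy (C.ρ j) (C.ρ i) with h2 | h2 | h2
    · exact .inl (by simpa using h2)
    · exact .inr ⟨h2, h.le_of_slope_eq hi (hT j hj) h2⟩
    · have hjs : j ≠ s := by rintro rfl; linarith
      exact (h.not_between_down hi (hT j hj) (hT s hs) his (lt_of_le_of_ne (hmax j hj) hjs)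
        (u := C.ρ j - C.ρ i) (v := C.ρ i - C.ρ s) (by linarith) (by linarith) (by ring)).elim
  · push Not at hex
    refine ⟨false, fun j hj i his hi => ?_⟩
    have h1 : C.ρ i < C.ρ s := lt_of_le_of_ne (hex i his hi) (hne i his hi)
    rcases lt_trichotomy (C.ρ j) (C.ρ i) with h2 | h2 | h2
    · have hjs : j ≠ s := by rintro rfl; linarith
      exact (h.not_between_down hi (hT j hj) (hT s hs) his (lt_of_le_of_ne (hmax j hj) hjs)
        (u := C.ρ i - C.ρ j) (v := C.ρ s - C.ρ i) (by linarith) (by linarith) (by ring)).elim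
    · exact .inr ⟨h2, h.le_of_slope_eq hi (hT j hj) h2⟩
    · exact .inl (by simpa using h2)

end Canonical

/-- Some maximizer of the relaxed problem is described by the position of the lines of the segments
relative to a point where two of the lines meet. -/
theorem exists_maximizer (C : ChainSystem ι M) : ∃ y ∈ Set.Icc (0 : Fin M → ℝ) 1,
    (∀ y' ∈ Set.Icc (0 : Fin M → ℝ) 1, C.obj y' ≤ C.obj y) ∧ ∃ χ : Fin M → Prop,
      ((∀ l, ¬ χ l) ∨ ∃ l₁ l₂ s up, ∀ l,
        χ l ↔ IsBelow C.ρ C.c (crossing C.ρ C.c l₁ l₂) l₁ s up l) ∧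
      (∀ l, ¬ χ l → y l = 0) ∧
      ∀ l l', χ l → l' < l → C.own l' = C.own l → y l' = 1 := by
  obtain ⟨π, y, h, hmax⟩ := C.exists_canonical
  refine ⟨y, h.mem, hmax, ?_⟩
  set q := π.2
  have hpos : ∀ l, 0 < C.theta π l → 0 < y l := fun l hl =>
    lt_of_le_of_ne (h.mem.1 l) fun h0 => absurd (h.theta_nonpos h0.symm) (not_le.2 hl)
  have hline : ∀ l, C.theta π l = π.1 - (C.ρ l * q - C.c l) := fun l => by
    unfold theta; ring
  by_cases hT : ∃ l, 0 < y l ∧ C.theta π l = 0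
  · have hTne : (Finset.univ.filter fun l => 0 < y l ∧ C.theta π l = 0).Nonempty := by
      obtain ⟨l, hl⟩ := hT
      exact ⟨l, by simp [hl]⟩
    obtain ⟨s, hs, hsmax⟩ := Finset.exists_max_image _ id hTne
    have hTf : ∀ j ∈ {l | 0 < y l ∧ C.theta π l = 0},
        FeasibleDir (C.upper π y) y (-Pi.single j 1) := fun j hj =>
      h.feasible_neg_single hj.1 hj.2
    obtain ⟨up, hup⟩ := h.exists_direction (T := {l | 0 < y l ∧ C.theta π l = 0}) (s := s)
      (by simpa using hs) (fun j hj => hsmax j (by simpa using hj)) hTf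
    obtain ⟨e, he, hemax⟩ := SlopeLE.exists_max (ρ := C.ρ) up hTne
    simp only [Finset.mem_filter, Finset.mem_univ, true_and, id] at hs hsmax he hemax
    have heq : C.ρ e * q - C.c e = π.1 := by have := hline e; rw [he.2] at this; linarith
    refine ⟨IsBelow C.ρ C.c q e s up, .inr ?_, fun l hl => ?_, fun l l' hl hl' ho => ?_⟩
    · obtain ⟨l₂, s', up', h'⟩ :=
        exists_isBelow_crossing (ρ := C.ρ) (c := C.c) h.price_nonneg (hsmax e he) up
      exact ⟨e, l₂, s', up', h'⟩
    · by_contra hne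
      have hyl : 0 < y l := lt_of_le_of_ne (h.mem.1 l) (Ne.symm hne)
      refine hl ?_
      unfold IsBelow
      rw [heq]
      rcases (h.theta_nonneg hyl).lt_or_eq with hθ | hθ
      · left; have := hline l; linarith
      · exact .inr ⟨by have := hline l; linarith, hsmax l ⟨hyl, hθ.symm⟩,
          hemax l ⟨hyl, hθ.symm⟩⟩
    · rcases (h.mem.1 l).lt_or_eq with hyl | hyl
      · exact h.eq_one_of_pos hl' ho hyl
      · have hyl : y l = 0 := hyl.symm
        by_contra hne
        have hθ' := h.theta_nonpos hyl
        unfold IsBelow at hl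
        rw [heq] at hl
        rcases hl with hl | ⟨hl, hls, hle⟩
        · have := hline l; linarith
        · have hθ : C.theta π l = 0 := by rw [hline]; linarith
          -- The rule may also select a tied segment `l` that is not in use. If an earlier segment
          -- `l'` of its chain were not full, it could be increased, hence it would come after `e`,
          -- and thus after `l`, in the order of slopes. But `l'` is parallel to `l` and has a
          -- smaller index.
          obtain ⟨hρ, hf⟩ := h.feasible_single ho hyl hθ hl'
            (lt_of_le_of_ne (h.mem.2 l') hne)
          have := hle.trans (hup e he l' (hl'.trans_le hls) hf)
          simp only [SlopeLE, hρ, lt_irrefl, ite_self, false_or, true_and] at this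
          exact absurd this (not_le.2 hl')
  · push Not at hT
    refine ⟨fun l => C.ρ l * q - C.c l < π.1, exists_isBelow_of_lt h.price_nonneg π.1,
      fun l hl => ?_, fun l l' hl hl' ho => ?_⟩
    · by_contra hne
      have hyl : 0 < y l := lt_of_le_of_ne (h.mem.1 l) (Ne.symm hne)
      have h1 := lt_of_le_of_ne (h.theta_nonneg hyl) (hT l hyl).symm
      rw [hline] at h1
      exact hl (by linarith)
    · refine h.eq_one_of_pos hl' ho (hpos l ?_)
      rw [hline]
      linarith

end MultiTop.ChainSystem

/-! ### Sets of results -/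

namespace MultiTop

/-- A threshold `θ` separates the weights inside `V` from those of the elements of `T` outside; as
the cardinalities agree, `θ` may be subtracted from all weights. -/
lemma sum_le_sum_of_top {α : Type*} [DecidableEq α] {V T : Finset α} {w : α → ℝ}
    (h : ∀ l ∈ V, ∀ l' ∉ V, w l' ≤ w l) (hc : T.card = V.card) : ∑ l ∈ T, w l ≤ ∑ l ∈ V, w l := by
  obtain ⟨θ, h1, h2⟩ : ∃ θ, (∀ l ∈ V, θ ≤ w l) ∧ ∀ l' ∈ T, l' ∉ V → w l' ≤ θ := by
    rcases V.eq_empty_or_nonempty with rfl | hV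
    · rw [Finset.card_empty, Finset.card_eq_zero] at hc
      exact ⟨0, by simp, by simp [hc]⟩
    · obtain ⟨l, hl, hmin⟩ := V.exists_min_image w hV
      exact ⟨w l, hmin, fun l' _ hl' => h l hl l' hl'⟩
  have h3 : ∑ l ∈ T, (w l - θ) ≤ ∑ l ∈ V, (w l - θ) := by
    rw [← Finset.sum_filter_add_sum_filter_not T (· ∈ V)]
    have h4 : ∑ l ∈ T with l ∉ V, (w l - θ) ≤ 0 := Finset.sum_nonpos fun l hl => by
      linarith [h2 l (Finset.mem_filter.1 hl).1 (Finset.mem_filter.1 hl).2]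
    have h5 : ∑ l ∈ T with l ∈ V, (w l - θ) ≤ ∑ l ∈ V, (w l - θ) :=
      Finset.sum_le_sum_of_subset_of_nonneg (fun l hl => (Finset.mem_filter.1 hl).2)
        fun l hl _ => sub_nonneg.2 (h1 l hl)
    linarith
  simp only [Finset.sum_sub_distrib, Finset.sum_const, hc] at h3
  linarith

namespace Problem

variable (P : Problem)

/-- The scores of a set of results, for an instance that is given as a natural number. -/
noncomputable def pt (i : ℕ) (S : Finset (Fin P.n)) : ℝ × ℝ :=
  (∑ j ∈ S, P.input.real 0 i j, ∑ j ∈ S, P.input.real 1 i j)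

variable {P}

lemma input_real_zero (i : Fin P.m) (j : Fin P.n) : P.input.real 0 i j = P.a i j := by
  simp [input]

lemma input_real_one (i : Fin P.m) (j : Fin P.n) : P.input.real 1 i j = P.b i j := by
  simp [input]

lemma pt_eq_score (i : Fin P.m) (S : Finset (Fin P.n)) : P.pt i S = P.score i S := by
  simp [pt, score, input_real_zero, input_real_one]

lemma pt_mono (hP : P.IsValid) {i : ℕ} (hi : i < P.m) {S T : Finset (Fin P.n)} (h : S ⊆ T) :
    P.pt i S ≤ P.pt i T := by
  lift i to Fin P.m using hi
  rw [pt_eq_score, pt_eq_score]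
  exact ⟨Finset.sum_le_sum_of_subset_of_nonneg h fun j _ _ => hP.a_nonneg i j,
    Finset.sum_le_sum_of_subset_of_nonneg h fun j _ _ => hP.b_nonneg i j⟩

lemma pt_swap {i : ℕ} {V : Finset (Fin P.n)} {j j' : Fin P.n} (hj : j ∈ V) (hj' : j' ∉ V) :
    P.pt i ((insert j' V).erase j) = P.pt i V +
      (P.input.real 0 i j' - P.input.real 0 i j, P.input.real 1 i j' - P.input.real 1 i j) := by
  have hmem : j ∈ insert j' V := Finset.mem_insert_of_mem hj
  ext <;> simp only [pt, Prod.fst_add, Prod.snd_add] <;>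
  · rw [Finset.sum_erase_eq_sub hmem, Finset.sum_insert hj']
    ring

lemma card_swap {V : Finset (Fin P.n)} {j j' : Fin P.n} (hj : j ∈ V) (hj' : j' ∉ V) :
    ((insert j' V).erase j).card = V.card := by
  rw [Finset.card_erase_of_mem (Finset.mem_insert_of_mem hj), Finset.card_insert_of_notMem hj']
  rfl

/-- The number of results with a smaller first score, summed up over a set. -/
noncomputable def rankSum (i : ℕ) (V : Finset (Fin P.n)) : ℕ :=
  ∑ j ∈ V, (Finset.univ.filter fun l : Fin P.n => P.input.real 0 i l < P.input.real 0 i j).card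

/-- This potential bounds the number of swaps in a chain, even if several swaps have the same slope.
-/
lemma rankSum_swap {i : ℕ} {V : Finset (Fin P.n)} {j j' : Fin P.n} (hj : j ∈ V) (hj' : j' ∉ V)
    (h : P.input.real 0 i j < P.input.real 0 i j') :
    rankSum i V + 1 ≤ rankSum i ((insert j' V).erase j) := by
  have hmem : j ∈ insert j' V := Finset.mem_insert_of_mem hj
  have h1 := Finset.sum_erase_add (insert j' V) (fun j => (Finset.univ.filter fun l : Fin P.n =>
    P.input.real 0 i l < P.input.real 0 i j).card) hmem
  rw [Finset.sum_insert hj'] at h1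
  have h2 : (Finset.univ.filter fun l : Fin P.n => P.input.real 0 i l < P.input.real 0 i j).card <
      (Finset.univ.filter fun l : Fin P.n => P.input.real 0 i l < P.input.real 0 i j').card := by
    refine Finset.card_lt_card ⟨fun l hl => ?_, fun hs => ?_⟩
    · simp only [Finset.mem_filter, Finset.mem_univ, true_and] at hl ⊢
      exact hl.trans h
    · have := @hs j (by simp [h])
      simp at this
  unfold rankSum
  omega

lemma rankSum_lt {i : ℕ} (V : Finset (Fin P.n)) (hn : 0 < P.n) : rankSum i V < P.n * P.n := by
  have h1 : ∀ j ∈ (Finset.univ : Finset (Fin P.n)),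
      (Finset.univ.filter fun l : Fin P.n => P.input.real 0 i l < P.input.real 0 i j).card <
        P.n := by
    intro j _
    have := Finset.card_lt_card (s := Finset.univ.filter fun l : Fin P.n =>
      P.input.real 0 i l < P.input.real 0 i j) (t := Finset.univ)
      ⟨Finset.subset_univ _, fun hs => by simpa using @hs j (Finset.mem_univ j)⟩
    simpa using this
  calc rankSum i V ≤ ∑ j : Fin P.n, (Finset.univ.filter fun l : Fin P.n =>
        P.input.real 0 i l < P.input.real 0 i j).card :=
        Finset.sum_le_sum_of_subset (Finset.subset_univ V)
    _ < ∑ _j : Fin P.n, P.n := Finset.sum_lt_sum_of_nonempty ⟨⟨0, hn⟩, Finset.mem_univ _⟩ h1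
    _ = P.n * P.n := by simp

/-- The set `V` maximizes the scores with the weights `r` and `1`, by comparison of results. -/
def IsTop (i : ℕ) (r : ℝ) (V : Finset (Fin P.n)) : Prop :=
  ∀ l ∈ V, ∀ l' ∉ V, r * P.input.real 0 i l' + P.input.real 1 i l' ≤
    r * P.input.real 0 i l + P.input.real 1 i l

lemma IsTop.le {i : ℕ} {r : ℝ} {V T : Finset (Fin P.n)} (h : IsTop i r V)
    (hc : T.card = V.card) : r * (P.pt i T).1 + (P.pt i T).2 ≤
      r * (P.pt i V).1 + (P.pt i V).2 := by
  have := sum_le_sum_of_top h hc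
  simpa only [pt, Finset.sum_add_distrib, ← Finset.mul_sum] using this

/-- The ratio of the loss in the second score and the gain in the first score, if `j` is replaced by
`j'`. -/
noncomputable def slope (i : ℕ) (j j' : Fin P.n) : ℝ :=
  (P.input.real 1 i j - P.input.real 1 i j') / (P.input.real 0 i j' - P.input.real 0 i j)

/-- `j'` may replace `j` in `V`, with a gain in the first score. -/
def IsSwap (i : ℕ) (V : Finset (Fin P.n)) (j j' : Fin P.n) : Prop :=
  j ∈ V ∧ j' ∉ V ∧ P.input.real 0 i j < P.input.real 0 i j'

lemma slope_mul {i : ℕ} {j j' : Fin P.n} (h : P.input.real 0 i j < P.input.real 0 i j') :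
    slope i j j' * (P.input.real 0 i j' - P.input.real 0 i j) =
      P.input.real 1 i j - P.input.real 1 i j' :=
  div_mul_cancel₀ _ (sub_pos.2 h).ne'

lemma IsTop.le_slope {i : ℕ} {r : ℝ} {V : Finset (Fin P.n)} (h : IsTop i r V) {j j' : Fin P.n}
    (hs : IsSwap i V j j') : r ≤ slope i j j' := by
  have h1 : 0 < P.input.real 0 i j' - P.input.real 0 i j := sub_pos.2 hs.2.2
  rw [slope, le_div_iff₀ h1]
  linarith [h j hs.1 j' hs.2.1]

/-- The set stays optimal until the weight reaches the smallest slope of a swap. -/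
lemma IsTop.of_slope_min {i : ℕ} {r : ℝ} {V : Finset (Fin P.n)} (h : IsTop i r V) {j j' : Fin P.n}
    (hs : IsSwap i V j j') (hmin : ∀ l l', IsSwap i V l l' → slope i j j' ≤ slope i l l') :
    IsTop i (slope i j j') V := by
  intro l hl l' hl'
  have hr := h.le_slope hs
  by_cases hll : P.input.real 0 i l < P.input.real 0 i l'
  · have h1 := hmin l l' ⟨hl, hl', hll⟩
    have h2 := slope_mul hll
    nlinarith
  · have := h l hl l' hl'
    nlinarith

/-- After the swap the set is again optimal. -/
lemma IsTop.swap {i : ℕ} {V : Finset (Fin P.n)} {j j' : Fin P.n}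
    (h : IsTop i (slope i j j') V) (hs : IsSwap i V j j') :
    IsTop i (slope i j j') ((insert j' V).erase j) := by
  have h1 := slope_mul hs.2.2
  have h2 := h j hs.1
  have h3 := fun l hl => h l hl j' hs.2.1
  intro l hl l' hl'
  simp only [Finset.mem_erase, Finset.mem_insert, not_and, not_or] at hl hl'
  have hjl' : l' = j ∨ l' ∉ V := by
    by_cases e : l' = j
    exacts [.inl e, .inr (hl' e).2]
  rcases hl.2 with rfl | hlV <;> rcases hjl' with rfl | hl'V
  · linarith
  · linarith [h2 l' hl'V]
  · linarith [h3 l hlV]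
  · exact h l hlV l' hl'V

lemma fst_le_of_no_swap {i : ℕ} {V T : Finset (Fin P.n)} (h : ∀ j j', ¬ IsSwap i V j j')
    (hc : T.card = V.card) : (P.pt i T).1 ≤ (P.pt i V).1 :=
  sum_le_sum_of_top (fun l hl l' hl' => not_lt.1 fun hlt => h l l' ⟨hl, hl', hlt⟩) hc

/-! ### Chains of sets -/

/-- The chains for the instances below `I`, with `M` swaps altogether. The swap `l` belongs to the
instance `own l`, it leads from the set `W l` to the set `W' l`, which both lie in `U l`, and its
slope is `ρ l`. The chain for the instance `i` leads from `V₀ i` to `cur i`. -/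
structure IsChains (P : Problem) (I M : ℕ) (own : ℕ → ℕ) (ρ c : ℕ → ℝ)
    (V₀ U W W' cur : ℕ → Finset (Fin P.n)) : Prop where
  own_lt : ∀ l < M, own l < I
  card_V₀ : ∀ i < I, (V₀ i).card = P.k
  top_V₀ : ∀ i < I, IsTop i 0 (V₀ i)
  card_cur : ∀ i < I, (cur i).card = P.k
  pt_cur : ∀ i < I, P.pt i (cur i) =
    P.pt i (V₀ i) + ∑ l ∈ Finset.range M with own l = i, (P.pt i (W' l) - P.pt i (W l))
  card_W : ∀ l < M, (W l).card = P.k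
  W_subset : ∀ l < M, W l ⊆ U l
  W'_subset : ∀ l < M, W' l ⊆ U l
  card_U : ∀ l < M, (U l).card ≤ P.k + 1
  fst_lt : ∀ l < M, (P.pt (own l) (W l)).1 < (P.pt (own l) (W' l)).1
  slope_eq : ∀ l < M, ρ l * ((P.pt (own l) (W' l)).1 - (P.pt (own l) (W l)).1) =
    (P.pt (own l) (W l)).2 - (P.pt (own l) (W' l)).2
  ρ_nonneg : ∀ l < M, 0 ≤ ρ l
  top_W : ∀ l < M, IsTop (own l) (ρ l) (W l)
  c_eq : ∀ l < M, c l =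
    P.oracles.loc (own l) .dfst (P.pt (own l) (W l)).1 (P.pt (own l) (W l)).2 -
    ρ l * P.oracles.loc (own l) .dsnd (P.pt (own l) (W l)).1 (P.pt (own l) (W l)).2
  pt_W : ∀ l < M, P.pt (own l) (W l) = P.pt (own l) (V₀ (own l)) +
    ∑ l' ∈ Finset.range l with own l' = own l, (P.pt (own l) (W' l') - P.pt (own l) (W l'))
  ρ_mono : ∀ l < M, ∀ l' < l, own l' = own l → ρ l' ≤ ρ l

/-- The sets that are chosen if, in each chain, the last swap with the property `χ` is taken. -/
noncomputable def candidate {n : ℕ} (own : ℕ → ℕ) (V₀ U : ℕ → Finset (Fin n)) (χ : ℕ → Prop) :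
    ℕ → ℕ → Finset (Fin n)
  | 0, i => V₀ i
  | L + 1, i => open Classical in
      if χ L ∧ own L = i then U L else candidate own V₀ U χ L i

/-- The recursion lets later swaps overwrite earlier ones, as the program does. -/
lemma candidate_cases {n : ℕ} (own : ℕ → ℕ) (V₀ U : ℕ → Finset (Fin n)) (χ : ℕ → Prop) (L i : ℕ) :
    (candidate own V₀ U χ L i = V₀ i ∧ ∀ l < L, own l = i → ¬ χ l) ∨
    ∃ l < L, own l = i ∧ χ l ∧ candidate own V₀ U χ L i = U l ∧
      ∀ l' < L, l < l' → own l' = i → ¬ χ l' := by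
  induction L with
  | zero => exact .inl ⟨rfl, by simp⟩
  | succ L ih =>
    by_cases hL : χ L ∧ own L = i
    · exact .inr ⟨L, by omega, hL.2, hL.1, by simp [candidate, hL], fun l' h1 h2 => by omega⟩
    · simp only [candidate, if_neg hL]
      rcases ih with ⟨h1, h2⟩ | ⟨l, h1, h2, h3, h4, h5⟩
      · refine .inl ⟨h1, fun l hl ho hχ => ?_⟩
        rcases Nat.lt_succ_iff_lt_or_eq.1 hl with hl | rfl
        exacts [h2 l hl ho hχ, hL ⟨hχ, ho⟩]
      · refine .inr ⟨l, by omega, h2, h3, h4, fun l' hl' hll ho hχ => ?_⟩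
        rcases Nat.lt_succ_iff_lt_or_eq.1 hl' with hl' | rfl
        exacts [h5 l' hl' hll ho hχ, hL ⟨hχ, ho⟩]

namespace IsChains

variable {I M : ℕ} {own : ℕ → ℕ} {ρ c : ℕ → ℝ} {V₀ U W W' cur : ℕ → Finset (Fin P.n)}

lemma empty (own : ℕ → ℕ) (ρ c : ℕ → ℝ) (V₀ U W W' cur : ℕ → Finset (Fin P.n)) :
    IsChains P 0 0 own ρ c V₀ U W W' cur := by
  constructor <;> intro l hl <;> exact absurd hl (Nat.not_lt_zero _)

/-- A new chain is started. -/
lemma start (h : IsChains P I M own ρ c V₀ U W W' cur) {V₀' : ℕ → Finset (Fin P.n)}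
    (hV : ∀ i < I, V₀' i = V₀ i) (hc : (V₀' I).card = P.k) (ht : IsTop I 0 (V₀' I)) :
    IsChains P (I + 1) M own ρ c V₀' U W W' (Function.update cur I (V₀' I)) := by
  have hI : ∀ i < I + 1, i = I ∨ i < I := fun i hi => by omega
  have h1 := h.own_lt
  refine ⟨fun l hl => (h1 l hl).trans (Nat.lt_succ_self I), ?_, ?_, ?_, ?_, h.card_W, h.W_subset,
    h.W'_subset, h.card_U, h.fst_lt, h.slope_eq, h.ρ_nonneg, h.top_W, h.c_eq, ?_, h.ρ_mono⟩
  · intro i hi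
    rcases hI i hi with rfl | hi
    exacts [hc, by rw [hV i hi]; exact h.card_V₀ i hi]
  · intro i hi
    rcases hI i hi with rfl | hi
    exacts [ht, by rw [hV i hi]; exact h.top_V₀ i hi]
  · intro i hi
    rcases hI i hi with rfl | hi
    · simpa using hc
    · rw [Function.update_of_ne hi.ne]; exact h.card_cur i hi
  · intro i hi
    rcases hI i hi with rfl | hi
    · rw [Function.update_self, Finset.sum_eq_zero, add_zero]
      intro l hl
      simp only [Finset.mem_filter, Finset.mem_range] at hl
      exact absurd hl.2 (h1 l hl.1).ne
    · rw [Function.update_of_ne hi.ne, hV i hi]; exact h.pt_cur i hi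
  · intro l hl
    rw [hV _ (h1 l hl)]
    exact h.pt_W l hl

/-- A chain is continued by a swap. -/
lemma append (h : IsChains P I M own ρ c V₀ U W W' cur) {i : ℕ} (hi : i < I) {own' : ℕ → ℕ}
    {ρ' c' : ℕ → ℝ} {U' : ℕ → Finset (Fin P.n)} (hown : ∀ l < M, own' l = own l)
    (hρ : ∀ l < M, ρ' l = ρ l) (hc : ∀ l < M, c' l = c l) (hU : ∀ l < M, U' l = U l)
    {r : ℝ} (hr : 0 ≤ r) (htop : IsTop i r (cur i)) (hle : ∀ l < M, own l = i → ρ l ≤ r)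
    {j j' : Fin P.n} (hs : IsSwap i (cur i) j j')
    (hmin : ∀ l l', IsSwap i (cur i) l l' → slope i j j' ≤ slope i l l')
    (hownM : own' M = i) (hρM : ρ' M = slope i j j') (hUM : U' M = insert j' (cur i))
    (hcM : c' M = P.oracles.loc i .dfst (P.pt i (cur i)).1 (P.pt i (cur i)).2 -
      slope i j j' * P.oracles.loc i .dsnd (P.pt i (cur i)).1 (P.pt i (cur i)).2) :
    IsChains P I (M + 1) own' ρ' c' V₀ U' (Function.update W M (cur i))
      (Function.update W' M ((insert j' (cur i)).erase j))
      (Function.update cur i ((insert j' (cur i)).erase j)) := by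
  have hM : ∀ l < M + 1, l = M ∨ l < M := fun l hl => by omega
  have hsum : ∀ L ≤ M, ∀ k : ℕ, ∑ l ∈ Finset.range L with own' l = k,
      (P.pt k (Function.update W' M ((insert j' (cur i)).erase j) l) -
        P.pt k (Function.update W M (cur i) l)) =
      ∑ l ∈ Finset.range L with own l = k, (P.pt k (W' l) - P.pt k (W l)) := by
    intro L hL k
    rw [Finset.sum_filter, Finset.sum_filter]
    refine Finset.sum_congr rfl fun l hl => ?_
    have hl' : l < M := (Finset.mem_range.1 hl).trans_le hL
    rw [hown l hl', Function.update_of_ne hl'.ne, Function.update_of_ne hl'.ne]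
  have hsw := P.pt_swap (i := i) hs.1 hs.2.1
  have hsl := slope_mul hs.2.2
  refine ⟨?_, h.card_V₀, h.top_V₀, ?_, ?_, ?_, ?_, ?_, ?_, ?_, ?_, ?_, ?_, ?_, ?_, ?_⟩
  · intro l hl
    rcases hM l hl with rfl | hl
    exacts [hownM ▸ hi, hown l hl ▸ h.own_lt l hl]
  · intro k hk
    rcases eq_or_ne k i with rfl | hki
    · rw [Function.update_self, card_swap hs.1 hs.2.1]; exact h.card_cur k hk
    · rw [Function.update_of_ne hki]; exact h.card_cur k hk
  · intro k hk
    rw [Finset.range_add_one, Finset.filter_insert]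
    rcases eq_or_ne k i with rfl | hki
    · rw [if_pos hownM, Finset.sum_insert (by simp), hsum M le_rfl, Function.update_self,
        Function.update_self, Function.update_self, add_left_comm, ← h.pt_cur k hk]
      abel
    · rw [if_neg (by rw [hownM]; exact hki.symm), hsum M le_rfl, Function.update_of_ne hki]
      exact h.pt_cur k hk
  · intro l hl
    rcases hM l hl with rfl | hl
    · rw [Function.update_self]; exact h.card_cur i hi
    · rw [Function.update_of_ne hl.ne]; exact h.card_W l hl
  · intro l hl
    rcases hM l hl with rfl | hl
    · rw [Function.update_self, hUM]; exact Finset.subset_insert _ _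
    · rw [Function.update_of_ne hl.ne, hU l hl]; exact h.W_subset l hl
  · intro l hl
    rcases hM l hl with rfl | hl
    · rw [Function.update_self, hUM]; exact Finset.erase_subset _ _
    · rw [Function.update_of_ne hl.ne, hU l hl]; exact h.W'_subset l hl
  · intro l hl
    rcases hM l hl with rfl | hl
    · rw [hUM, ← h.card_cur i hi]; exact Finset.card_insert_le _ _
    · rw [hU l hl]; exact h.card_U l hl
  · intro l hl
    rcases hM l hl with rfl | hl
    · rw [Function.update_self, Function.update_self, hownM, hsw]
      have := hs.2.2
      simp only [Prod.fst_add]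
      linarith
    · rw [Function.update_of_ne hl.ne, Function.update_of_ne hl.ne, hown l hl]
      exact h.fst_lt l hl
  · intro l hl
    rcases hM l hl with rfl | hl
    · rw [Function.update_self, Function.update_self, hownM, hsw, hρM]
      simp only [Prod.fst_add, Prod.snd_add]
      linarith
    · rw [Function.update_of_ne hl.ne, Function.update_of_ne hl.ne, hown l hl, hρ l hl]
      exact h.slope_eq l hl
  · intro l hl
    rcases hM l hl with rfl | hl
    · rw [hρM]; exact hr.trans (htop.le_slope hs)
    · rw [hρ l hl]; exact h.ρ_nonneg l hl
  · intro l hl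
    rcases hM l hl with rfl | hl
    · rw [Function.update_self, hownM, hρM]; exact htop.of_slope_min hs hmin
    · rw [Function.update_of_ne hl.ne, hown l hl, hρ l hl]; exact h.top_W l hl
  · intro l hl
    rcases hM l hl with rfl | hl
    · rw [Function.update_self, hownM, hρM, hcM]
    · rw [Function.update_of_ne hl.ne, hown l hl, hρ l hl, hc l hl]; exact h.c_eq l hl
  · intro l hl
    rcases hM l hl with rfl | hl
    · rw [hownM, hsum _ le_rfl, Function.update_self, h.pt_cur i hi]
    · rw [hown l hl, hsum l hl.le, Function.update_of_ne hl.ne]; exact h.pt_W l hl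
  · intro l hl l' hl' ho
    rcases hM l hl with rfl | hl
    · rw [hρM, hρ l' hl']
      rw [hownM, hown l' hl'] at ho
      exact (hle l' hl' ho).trans (htop.le_slope hs)
    · have hl'M := hl'.trans hl
      rw [hown l hl, hown l' hl'M] at ho
      rw [hρ l hl, hρ l' hl'M]
      exact h.ρ_mono l hl l' hl' ho

end IsChains

end Problem

end MultiTop

namespace MultiTop.Problem.IsChains

variable {P : Problem} {M : ℕ} {own : ℕ → ℕ} {ρ c : ℕ → ℝ} {V₀ U W W' cur : ℕ → Finset (Fin P.n)}

/-! ### From chains of sets to chains of points -/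

/-- The instance of a swap. -/
def owner (h : IsChains P P.m M own ρ c V₀ U W W' cur) (l : Fin M) : Fin P.m :=
  ⟨own l, h.own_lt l l.2⟩

lemma sum_owner (h : IsChains P P.m M own ρ c V₀ U W W' cur) {E : Type*} [AddCommMonoid E]
    (φ : ℕ → E) (i : Fin P.m) :
    ∑ l with h.owner l = i, φ l = ∑ l ∈ Finset.range M with own l = i, φ l := by
  rw [Finset.sum_filter, Finset.sum_filter, Finset.sum_range]
  refine Finset.sum_congr rfl fun l _ => ?_
  simp [owner, Fin.ext_iff]

/-- The losses of second score telescope along the chain; this identifies the corner of the chain.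
-/
lemma sum_eq (h : IsChains P P.m M own ρ c V₀ U W W' cur) (i : Fin P.m) :
    ∑ l ∈ Finset.range M with own l = i,
      (((P.pt (own l) (W' l)).1 - (P.pt (own l) (W l)).1) * ρ l) =
    (P.pt i (V₀ i)).2 - (P.pt i (cur i)).2 := by
  rw [h.pt_cur i i.2, Prod.snd_add, Prod.snd_sum, sub_add_cancel_left, ← Finset.sum_neg_distrib]
  refine Finset.sum_congr rfl fun l hl => ?_
  simp only [Finset.mem_filter, Finset.mem_range] at hl
  rw [mul_comm, h.slope_eq l hl.1, hl.2]
  simp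

/-- The chains of points. -/
noncomputable def system (hP : P.IsValid) (h : IsChains P P.m M own ρ c V₀ U W W' cur) :
    ChainSystem (Fin P.m) M where
  own := h.owner
  z i := P.pt i (V₀ i)
  δ l := (P.pt (own l) (W' l)).1 - (P.pt (own l) (W l)).1
  ρ l := ρ l
  D := P.D
  f := P.f
  DF := P.DF
  F := P.F
  δ_pos l := sub_pos.2 (h.fst_lt l l.2)
  ρ_nonneg l := h.ρ_nonneg l l.2
  ρ_mono l l' ho hl := by
    rcases hl.eq_or_lt with rfl | hl
    · exact le_rfl
    · exact h.ρ_mono l' l'.2 l hl (congrArg Fin.val ho)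
  comb := hP.isCombining_f
  combF := hP.isCombining_F
  corner_mem i := by
    rw [h.sum_owner (fun l => ((P.pt (own l) (W' l)).1 - (P.pt (own l) (W l)).1) * ρ l), h.sum_eq]
    have h1 := hP.score_mem i _ (h.card_V₀ i i.2)
    have h2 := hP.score_mem i _ (h.card_cur i i.2)
    rw [← pt_eq_score] at h1 h2
    -- The corner has the first score of `V₀ i` and the second score of `cur i`.
    exact (hP.isCombining_f i).mem_of_le_of_le h1 h2 (by simp) (by simp)
  cornerF_mem := by
    have e : ∀ (T : Fin P.m → Finset (Fin P.n)), P.globalScore T = ∑ i : Fin P.m, P.pt i (T i) := by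
      intro T
      simp only [pt_eq_score]
      ext <;> simp [globalScore, score, Prod.fst_sum, Prod.snd_sum]
    have h1 := hP.globalScore_mem (fun i => V₀ i) fun i => h.card_V₀ i i.2
    have h2 := hP.globalScore_mem (fun i => cur i) fun i => h.card_cur i i.2
    rw [e] at h1 h2
    refine hP.isCombining_F.mem_of_le_of_le h1 h2 ?_ ?_
    · simp [Prod.fst_sum]
    · rw [Prod.snd_sum, Prod.snd_sum]
      refine le_of_eq (Finset.sum_congr rfl fun i _ => ?_)
      rw [h.sum_owner (fun l => ((P.pt (own l) (W' l)).1 - (P.pt (own l) (W l)).1) * ρ l), h.sum_eq]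
      simp

lemma system_d (hP : P.IsValid) (h : IsChains P P.m M own ρ c V₀ U W W' cur) (l : Fin M) :
    (h.system hP).d l = P.pt (own l) (W' l) - P.pt (own l) (W l) := by
  have := h.slope_eq l l.2
  ext
  · rfl
  · simp only [ChainSystem.d, system, Prod.snd_sub]
    linarith

/-- Filling all earlier segments leads to the set before the swap, so the abstract vertices are
scores of actual sets and `c` can be computed with oracle calls. -/
lemma point_before (hP : P.IsValid) (h : IsChains P P.m M own ρ c V₀ U W W' cur) (l : Fin M) :
    (h.system hP).point (ChainSystem.before l) (h.owner l) = P.pt (own l) (W l) := by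
  have e : (h.system hP).disp (ChainSystem.before l) (h.owner l) =
      ∑ k with h.owner k = h.owner l, if (k : ℕ) < l then
        (P.pt (own l) (W' k) - P.pt (own l) (W k)) else 0 := by
    refine Finset.sum_congr rfl fun k hk => ?_
    have ho : own k = own l := congrArg Fin.val (Finset.mem_filter.1 hk).2
    rw [system_d, ho]
    simp only [ChainSystem.before, Fin.lt_def]
    split_ifs <;> simp
  rw [ChainSystem.point, e, h.sum_owner fun k => if k < (l : ℕ) then
    (P.pt (own l) (W' k) - P.pt (own l) (W k)) else 0, h.pt_W l l.2]
  change P.pt (own l) (V₀ (own l)) + _ = _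
  congr 1
  rw [Finset.sum_filter, Finset.sum_filter, ← Finset.sum_subset (Finset.range_mono l.2.le)]
  · refine Finset.sum_congr rfl fun k hk => ?_
    rw [if_pos (Finset.mem_range.1 hk)]
    rfl
  · intro k _ hk
    rw [if_neg fun h' => hk (Finset.mem_range.2 h'), ite_self]

lemma system_c (hP : P.IsValid) (h : IsChains P P.m M own ρ c V₀ U W W' cur) (l : Fin M) :
    (h.system hP).c l = c l := by
  rw [h.c_eq l l.2, ChainSystem.c, ChainSystem.apply_eq, ChainSystem.vertex]
  change fderivWithin ℝ (P.f (h.owner l)) (P.D (h.owner l))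
    ((h.system hP).point (ChainSystem.before l) (h.owner l)) _ * _ +
    fderivWithin ℝ (P.f (h.owner l)) (P.D (h.owner l))
    ((h.system hP).point (ChainSystem.before l) (h.owner l)) _ * _ = _
  rw [point_before]
  simp only [oracles, dif_pos (h.own_lt l l.2), RealRAM.answer, system, owner, mul_one]
  ring

/-- Every set of the right size is dominated by a point on the chain. -/
lemma exists_le_point (hP : P.IsValid) (h : IsChains P P.m M own ρ c V₀ U W W' cur) (i : Fin P.m)
    (hlast : ∀ T : Finset (Fin P.n), T.card = P.k → (P.pt i T).1 ≤ (P.pt i (cur i)).1)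
    {T : Finset (Fin P.n)} (hT : T.card = P.k) :
    ∃ y ∈ Set.Icc (0 : Fin M → ℝ) 1, P.pt i T ≤ (h.system hP).point y i := by
  have key : ∀ L ≤ M, (P.pt i T).1 ≤ (P.pt i (V₀ i) +
      ∑ l ∈ Finset.range L with own l = i, (P.pt i (W' l) - P.pt i (W l))).1 →
      ∃ y ∈ Set.Icc (0 : Fin M → ℝ) 1, P.pt i T ≤ (h.system hP).point y i := by
    intro L
    induction L with
    | zero =>
      intro _ hle
      refine ⟨0, by simp, ?_⟩
      have e : (h.system hP).point 0 i = P.pt i (V₀ i) := by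
        simp [ChainSystem.point, ChainSystem.disp, system]
      rw [e]
      have := (h.top_V₀ i i.2).le (hT.trans (h.card_V₀ i i.2).symm)
      simp at this hle
      exact ⟨hle, this⟩
    | succ L ih =>
      intro hL hle
      rw [Finset.range_add_one, Finset.filter_insert] at hle
      by_cases ho : own L = i
      · by_cases hle' : (P.pt i T).1 ≤ (P.pt i (V₀ i) +
            ∑ l ∈ Finset.range L with own l = i, (P.pt i (W' l) - P.pt i (W l))).1
        · exact ih (by omega) hle'
        · let l : Fin M := ⟨L, hL⟩
          have hW := h.pt_W L hL
          rw [ho] at hW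
          rw [if_pos ho, Finset.sum_insert (by simp), add_left_comm, ← hW] at hle
          rw [← hW] at hle'
          have hsl := h.slope_eq L hL
          have hlt := h.fst_lt L hL
          have htop := (h.top_W L hL).le (hT.trans (h.card_W L hL).symm)
          rw [ho] at hsl hlt htop
          simp only [sub_add_cancel] at hle
          set x := P.pt i (W L)
          set x' := P.pt i (W' L)
          -- The segment `L` is the one that passes the first score of `T`, and `s` makes the first
          -- scores equal. Optimality of `W L` for the weights `ρ L` and `1` places `T` on or below
          -- the line through the segment.
          set s := ((P.pt i T).1 - x.1) / (x'.1 - x.1) with hs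
          have hpos : 0 < x'.1 - x.1 := sub_pos.2 hlt
          have hs0 : 0 ≤ s := div_nonneg (by linarith) hpos.le
          have hs1 : s ≤ 1 := (div_le_one hpos).2 (by linarith)
          have hsm : s * (x'.1 - x.1) = (P.pt i T).1 - x.1 := div_mul_cancel₀ _ hpos.ne'
          refine ⟨ChainSystem.before l + s • Pi.single l 1, ⟨fun k => ?_, fun k => ?_⟩, ?_⟩
          · have := (ChainSystem.before_mem l).1 k
            rcases eq_or_ne k l with rfl | hk
            · simp [ChainSystem.before, hs0]
            · simpa [hk] using this
          · have := (ChainSystem.before_mem l).2 k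
            rcases eq_or_ne k l with rfl | hk
            · simp [ChainSystem.before, hs1]
            · simpa [hk] using this
          · have hoi : h.owner l = i := Fin.ext ho
            have e := h.point_before hP l
            have ed := h.system_d hP l
            have eo : (h.system hP).own l = i := hoi
            simp only [l] at ed e
            rw [hoi, ho] at e
            rw [ho] at ed
            rw [ChainSystem.point_add_smul, ChainSystem.disp_single, if_pos eo, e, ed]
            refine ⟨?_, ?_⟩
            · simp only [Prod.fst_add, Prod.smul_fst, Prod.fst_sub, smul_eq_mul]
              linarith
            · have h5 : s * (x'.2 - x.2) = -(ρ L * ((P.pt i T).1 - x.1)) := by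
                rw [← hsm]
                linear_combination s * hsl
              change (P.pt i T).2 ≤ x.2 + s * (x'.2 - x.2)
              linarith
      · rw [if_neg ho] at hle
        exact ih (by omega) hle
  refine key M le_rfl ?_
  rw [← h.pt_cur i i.2]
  exact hlast T hT

lemma card_candidate (h : IsChains P P.m M own ρ c V₀ U W W' cur) (χ : ℕ → Prop) {i : ℕ}
    (hi : i < P.m) : (candidate own V₀ U χ M i).card ≤ P.k + 1 := by
  rcases candidate_cases own V₀ U χ M i with ⟨h1, _⟩ | ⟨l, hl, _, _, h1, _⟩
  · rw [h1, h.card_V₀ i hi]; omega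
  · rw [h1]; exact h.card_U l hl

/-- The last selected segment is the only one of its chain that may be used in part. The point lies
between the scores of `W` and `W'`, and both sets are contained in `U`. -/
lemma point_le_candidate (hP : P.IsValid) (h : IsChains P P.m M own ρ c V₀ U W W' cur)
    {χ : ℕ → Prop} {y : Fin M → ℝ} (hy : y ∈ Set.Icc (0 : Fin M → ℝ) 1)
    (h0 : ∀ l : Fin M, ¬ χ l → y l = 0)
    (h1 : ∀ l l' : Fin M, χ l → l' < l → h.owner l' = h.owner l → y l' = 1) (i : Fin P.m) :
    (h.system hP).point y i ≤ P.pt i (candidate own V₀ U χ M i) := by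
  rcases candidate_cases own V₀ U χ M i with ⟨e, h2⟩ | ⟨L, hL, ho, hχ, e, h2⟩
  · rw [e, ChainSystem.point, ChainSystem.disp, Finset.sum_eq_zero, add_zero]
    · exact le_rfl
    · intro l hl
      rw [h0 l (h2 l l.2 (congrArg Fin.val (Finset.mem_filter.1 hl).2)), zero_smul]
  · rw [e]
    let l : Fin M := ⟨L, hL⟩
    have hoi : h.owner l = i := Fin.ext ho
    have e1 := h.point_before hP l
    have ed := h.system_d hP l
    simp only [l] at ed e1
    rw [hoi, ho] at e1
    rw [ho] at ed
    have e2 : (h.system hP).disp y i =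
        (h.system hP).disp (ChainSystem.before l + y l • Pi.single l 1) i := by
      refine Finset.sum_congr rfl fun k hk => ?_
      have hk : h.owner k = i := (Finset.mem_filter.1 hk).2
      congr 1
      rcases lt_trichotomy k l with hkl | rfl | hkl
      · simp [ChainSystem.before, hkl, hkl.ne, h1 l k hχ hkl (hk.trans hoi.symm)]
      · simp [ChainSystem.before]
      · simp [ChainSystem.before, hkl.not_gt, hkl.ne',
          h0 k (h2 k k.2 hkl (congrArg Fin.val hk))]
    have eo : (h.system hP).own l = i := hoi
    have e3 : (h.system hP).point y i =
        P.pt i (W L) + y l • (P.pt i (W' L) - P.pt i (W L)) := by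
      rw [ChainSystem.point, e2, ← ChainSystem.point, ChainSystem.point_add_smul,
        ChainSystem.disp_single, if_pos eo, e1, ed]
    rw [e3]
    have a1 : 0 ≤ y l := hy.1 l
    have a2 : y l ≤ 1 := hy.2 l
    have b1 := pt_mono hP i.2 (h.W_subset L hL)
    have b2 := pt_mono hP i.2 (h.W'_subset L hL)
    refine ⟨?_, ?_⟩
    · simp only [Prod.fst_add, Prod.smul_fst, Prod.fst_sub, smul_eq_mul]
      nlinarith [b1.1, b2.1]
    · simp only [Prod.snd_add, Prod.smul_snd, Prod.snd_sub, smul_eq_mul]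
      nlinarith [b1.2, b2.2]

lemma globalScore_eq (T : Fin P.m → Finset (Fin P.n)) : P.globalScore T = ∑ i, P.score i (T i) := by
  ext <;> simp [globalScore, score, Prod.fst_sum, Prod.snd_sum]

/-- One of the candidates that are found at the meeting points of two lines is good enough. -/
theorem exists_candidate (hP : P.IsValid) (h : IsChains P P.m M own ρ c V₀ U W W' cur)
    (hlast : ∀ i < P.m, ∀ T : Finset (Fin P.n), T.card = P.k → (P.pt i T).1 ≤ (P.pt i (cur i)).1) :
    ∃ χ : ℕ → Prop, ((∀ l < M, ¬ χ l) ∨ ∃ l₁ < M, ∃ l₂ < M, ∃ s < M, ∃ up, ∀ l < M,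
      χ l ↔ IsBelow ρ c (crossing ρ c l₁ l₂) l₁ s up l) ∧
      ∀ T : Fin P.m → Finset (Fin P.n), (∀ i, (T i).card = P.k) →
        P.co T ≤ P.co fun i => candidate own V₀ U χ M i := by
  obtain ⟨y, hy, hmax, χ, hχ, h0, h1⟩ := (h.system hP).exists_maximizer
  refine ⟨fun l => ∃ hl : l < M, χ ⟨l, hl⟩, ?_, fun T hT => ?_⟩
  · rcases hχ with hχ | ⟨l₁, l₂, s, up, hχ⟩
    · exact .inl fun l hl ⟨_, h'⟩ => hχ _ h'
    · refine .inr ⟨l₁, l₁.2, l₂, l₂.2, s, s.2, up, fun l hl => ?_⟩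
      have hc : (h.system hP).c = fun l : Fin M => c l := funext fun l => h.system_c hP l
      have hρ : (h.system hP).ρ = fun l : Fin M => ρ l := rfl
      change (∃ hl : l < M, χ ⟨l, hl⟩) ↔ _
      rw [exists_prop_of_true hl, hχ, hc, hρ]
      simp [IsBelow, SlopeLE, crossing, Fin.le_def]
  · have hcand := h.point_le_candidate hP (χ := fun l => ∃ hl : l < M, χ ⟨l, hl⟩) hy
      (fun l hl => h0 l fun h' => hl ⟨l.2, h'⟩) (fun l l' hl => h1 l l' hl.2)
    choose w hw hwT using fun i : Fin P.m =>
      h.exists_le_point hP i (hlast i i.2) (hT i)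
    -- The chains have disjoint sets of segments, so the multiplicities found for the individual
    -- instances fit together.
    let v : Fin M → ℝ := fun l => w (h.owner l) l
    have hv : v ∈ Set.Icc (0 : Fin M → ℝ) 1 :=
      ⟨fun l => (hw (h.owner l)).1 l, fun l => (hw (h.owner l)).2 l⟩
    have hvp : ∀ i, (h.system hP).point v i = (h.system hP).point (w i) i := by
      intro i
      simp only [ChainSystem.point, ChainSystem.disp, add_right_inj]
      refine Finset.sum_congr rfl fun l hl => ?_
      have hl : h.owner l = i := (Finset.mem_filter.1 hl).2
      simp only [v, hl]
    have hle1 : P.co T ≤ (h.system hP).obj v := by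
      refine add_le_add ?_ (Finset.sum_le_sum fun i _ => ?_)
      · refine hP.isCombining_F.le_of_le (hP.globalScore_mem T hT) ?_
        rw [globalScore_eq]
        refine Finset.sum_le_sum fun i _ => ?_
        rw [hvp, ← pt_eq_score]
        exact hwT i
      · refine (hP.isCombining_f i).le_of_le (hP.score_mem i _ (hT i)) ?_
        rw [hvp, ← pt_eq_score]
        exact hwT i
    have hle2 : (h.system hP).obj y ≤ P.co fun i => candidate own V₀ U
        (fun l => ∃ hl : l < M, χ ⟨l, hl⟩) M i := by
      refine add_le_add ?_ (Finset.sum_le_sum fun i _ => ?_)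
      · refine hP.isCombining_F.le_of_le ((h.system hP).total_mem hy) ?_
        rw [globalScore_eq]
        refine Finset.sum_le_sum fun i _ => ?_
        rw [← pt_eq_score]
        exact hcand i
      · refine (hP.isCombining_f i).le_of_le ((h.system hP).point_mem hy i) ?_
        rw [← pt_eq_score]
        exact hcand i
    exact hle1.trans ((hmax v hv).trans hle2)

end MultiTop.Problem.IsChains

/-! ### Building blocks of the algorithm

Integer arrays: 0 output, 1 `m`, 2 `n`, 3 `k`, 4 the number `n * n`, 5 the number of swaps, 6 to 9
counters, 10 the current set, 11 to 13 results of searches, 14 the instance of each swap, 15 the sets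
with `k + 1` elements, 16 the first set of each chain, 17 to 20 counters, 21 the candidate.
Real arrays: 0 and 1 scores, 2 the best slope, 3 slopes of the swaps, 4 derivatives at the swaps,
5 to 7 accumulators, 8 the best objective, 9 the abscissa, 10 and 11 accumulators. -/

namespace RealRAM.LoopProg

open NatExp

variable {O : Oracles}

lemma exec_ite_pos {b : Test} {p p' : LoopProg} {σ : State} (h : b.Holds O σ) :
    (ite b p p').exec O σ = p.exec O σ := if_pos h

lemma exec_ite_neg {b : Test} {p p' : LoopProg} {σ : State} (h : ¬ b.Holds O σ) :
    (ite b p p').exec O σ = p'.exec O σ := if_neg h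

/-- Set the entries of a row from 0 to `n - 1`. -/
def fill (x : ℕ) (i e : NatExp) : LoopProg := loop 8 2 (.setNat x i (natVar 8) e)

/-- The hypothesis on all states that differ in the arrays 8 and `x` only expresses that the loop
affects the two expressions through its counter alone. -/
lemma exec_fill {x : ℕ} {i e : NatExp} {σ : State} {r : ℕ} {g : ℕ → ℕ} (hx : x ≠ 8)
    (h : ∀ τ : State, (∀ y ∉ [8, x], τ.nat y = σ.nat y) →
      i.eval τ = r ∧ e.eval τ = g (τ.nat 8 0 0)) :
    (∀ j < σ.nat 2 0 0, ((fill x i e).exec O σ).nat x r j = g j) ∧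
      ∀ r' ≠ r, ((fill x i e).exec O σ).nat x r' = σ.nat x r' := by
  refine exec_loop_induction σ (by simp [natWrites, hx.symm])
    (fun J τ => (∀ j < J, τ.nat x r j = g j) ∧ ∀ r' ≠ r, τ.nat x r' = σ.nat x r') ?_ ?_
  · exact ⟨by simp, fun r' _ => by rw [State.setNat_nat_of_ne _ _ _ _ hx]⟩
  · intro k _ τ hk hf _ ⟨h1, h2⟩
    obtain ⟨e1, e2⟩ := h τ hf
    rw [State.setNat_nat_of_ne _ _ _ _ hx]
    refine ⟨fun j hj => ?_, fun r' hr' => ?_⟩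
    · simp only [exec, e1, e2, natVar_eval, hk, State.setNat_nat, true_and]
      split_ifs with hjk
      · rw [hjk]
      · exact h1 j (by omega)
    · funext j
      simp only [exec, e1, e2, natVar_eval, hk, State.setNat_nat, hr', true_and, false_and,
        if_false]
      rw [h2 r' hr']

/-- Add up the scores of the instance in the counter 6 over a row. -/
def sumProg (x : ℕ) (r : NatExp) : LoopProg :=
  .seq (.setReal 10 (.const 0) (.const 0) (.const 0)) <|
  .seq (.setReal 11 (.const 0) (.const 0) (.const 0)) <|
  .loop 8 2 <| .ite (.natLe (.const 1) (.get x r (natVar 8)))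
    (.seq (.setReal 10 (.const 0) (.const 0) (.add (realVar 10) (.get 0 (natVar 6) (natVar 8))))
      (.setReal 11 (.const 0) (.const 0) (.add (realVar 11) (.get 1 (natVar 6) (natVar 8))))) .skip

end RealRAM.LoopProg

namespace MultiTop.Problem

open RealRAM RealRAM.LoopProg

variable {P : Problem} {O : Oracles}

/-- The set of results that is given by a row of an integer array. -/
def row (P : Problem) (σ : State) (x i : ℕ) : Finset (Fin P.n) :=
  Finset.univ.filter fun j => σ.nat x i j ≠ 0

lemma mem_row {σ : State} {x i : ℕ} {j : Fin P.n} : j ∈ P.row σ x i ↔ σ.nat x i j ≠ 0 := by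
  simp [row]

lemma row_congr {σ τ : State} {x y i i' : ℕ} (h : ∀ j < P.n, σ.nat x i j = τ.nat y i' j) :
    P.row σ x i = P.row τ y i' := by
  ext j
  rw [mem_row, mem_row, h j j.2]

/-- The input is still available. -/
structure HasInput (P : Problem) (σ : State) : Prop where
  nat : ∀ y ∈ [1, 2, 3], σ.nat y = P.input.nat y
  real : ∀ y ∈ [0, 1], σ.real y = P.input.real y

namespace HasInput

variable {σ : State} (h : HasInput P σ)
include h

lemma m_eq : σ.nat 1 0 0 = P.m := by rw [h.nat 1 (by simp)]; simp [input]
lemma n_eq : σ.nat 2 0 0 = P.n := by rw [h.nat 2 (by simp)]; simp [input]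
lemma k_eq : σ.nat 3 0 0 = P.k := by rw [h.nat 3 (by simp)]; simp [input]
lemma real_zero : σ.real 0 = P.input.real 0 := h.real 0 (by simp)
lemma real_one : σ.real 1 = P.input.real 1 := h.real 1 (by simp)

lemma of_eq {τ : State} (hn : ∀ y ∈ [1, 2, 3], τ.nat y = σ.nat y)
    (hr : ∀ y ∈ [0, 1], τ.real y = σ.real y) : HasInput P τ :=
  ⟨fun y hy => (hn y hy).trans (h.nat y hy), fun y hy => (hr y hy).trans (h.real y hy)⟩

lemma exec {p : LoopProg} (hn : ∀ y ∈ [1, 2, 3], y ∉ p.natWrites)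
    (hr : ∀ y ∈ [0, 1], y ∉ p.realWrites) : HasInput P (p.exec O σ) :=
  h.of_eq (fun y hy => exec_nat_eq p (hn y hy) σ) fun y hy => exec_real_eq p (hr y hy) σ

lemma of_loop {τ : State} {x : ℕ} {p : LoopProg} (hn : ∀ y ∉ x :: p.natWrites, τ.nat y = σ.nat y)
    (hr : ∀ y ∉ p.realWrites, τ.real y = σ.real y) (h1 : ∀ y ∈ [1, 2, 3], y ∉ x :: p.natWrites)
    (h2 : ∀ y ∈ [0, 1], y ∉ p.realWrites) : HasInput P τ :=
  h.of_eq (fun y hy => hn y (h1 y hy)) fun y hy => hr y (h2 y hy)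

end HasInput

lemma exec_sumProg {σ : State} {x r : ℕ} {e : NatExp} (h : HasInput P σ) (hx : x ≠ 8)
    (he : ∀ τ : State, (∀ y ≠ 8, τ.nat y = σ.nat y) → e.eval τ = r) :
    ((sumProg x e).exec O σ).real 10 0 0 = (P.pt (σ.nat 6 0 0) (P.row σ x r)).1 ∧
    ((sumProg x e).exec O σ).real 11 0 0 = (P.pt (σ.nat 6 0 0) (P.row σ x r)).2 := by
  set i := σ.nat 6 0 0 with hi
  set σ' := (σ.setReal 10 0 0 0).setReal 11 0 0 0 with hσ'
  have key : ∀ z, ∑ j ∈ P.row σ x r, P.input.real z i j =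
      ∑ j ∈ Finset.range P.n, if σ.nat x r j = 0 then 0 else P.input.real z i j := by
    intro z
    rw [Finset.sum_range, row, Finset.sum_filter]
    exact Finset.sum_congr rfl fun j _ => by simp only [ne_eq, ite_not]
  have h2 : σ'.nat 2 0 0 = P.n := h.n_eq
  have hexec : (sumProg x e).exec O σ = (loop 8 2 <| .ite (.natLe (.const 1) (.get x e (natVar 8)))
    (.seq (.setReal 10 (.const 0) (.const 0) (.add (realVar 10) (.get 0 (natVar 6) (natVar 8))))
      (.setReal 11 (.const 0) (.const 0) (.add (realVar 11) (.get 1 (natVar 6) (natVar 8)))))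
      .skip).exec O σ' := by
    simp [sumProg, LoopProg.exec, NatExp.eval, RealExp.eval, hσ']
  simp only [pt]
  rw [hexec, key, key, ← h2]
  refine exec_loop_induction σ' (by simp [natWrites]) (fun J τ =>
    τ.real 10 0 0 = ∑ j ∈ Finset.range J, (if σ.nat x r j = 0 then 0 else P.input.real 0 i j) ∧
    τ.real 11 0 0 = ∑ j ∈ Finset.range J, (if σ.nat x r j = 0 then 0 else P.input.real 1 i j))
    ?_ ?_
  · simp [hσ', State.setReal_real]
  · intro k _ τ hk hn hr ⟨h3, h4⟩
    have hn' : ∀ y ≠ 8, τ.nat y = σ.nat y := fun y hy => hn y (by simpa [natWrites] using hy)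
    have e1 : e.eval τ = r := he τ hn'
    have e2 : τ.nat x = σ.nat x := hn' x hx
    have e3 : τ.nat 6 = σ.nat 6 := hn' 6 (by simp)
    have e4 : τ.real 0 = P.input.real 0 := by
      rw [hr 0 (by simp [realWrites]), ← h.real_zero]
      funext a b; simp [hσ', State.setReal_real]
    have e5 : τ.real 1 = P.input.real 1 := by
      rw [hr 1 (by simp [realWrites]), ← h.real_one]
      funext a b; simp [hσ', State.setReal_real]
    rw [Finset.sum_range_succ, Finset.sum_range_succ, State.setNat_real]
    by_cases hz : σ.nat x r k = 0
    · simp [LoopProg.exec, Test.Holds, NatExp.eval, e1, e2, hk, hz, h3, h4]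
    · have hz' : 1 ≤ σ.nat x r k := Nat.one_le_iff_ne_zero.2 hz
      simp [LoopProg.exec, Test.Holds, NatExp.eval, RealExp.eval, e1, e2, e3, e4, e5, hk, hz, hz',
        h3, h4, State.setReal_real, ← hi]

end MultiTop.Problem

/-! ### Programs that construct the chains -/

namespace RealRAM.LoopProg

/-- Look for the best second score outside the current set. -/
def argmaxBody : LoopProg :=
  .ite (.and (.natLe (.get 10 (.const 0) (natVar 8)) (.const 0))
    (.neg (.and (.natLe (.const 1) (natVar 11))
      (.realLe (.get 1 (natVar 6) (natVar 8)) (.get 1 (natVar 6) (natVar 12))))))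
    (.seq (.setNat 12 (.const 0) (.const 0) (natVar 8))
      (.setNat 11 (.const 0) (.const 0) (.const 1))) .skip

/-- Add the result with the best second score to the current set. -/
def selectStep : LoopProg :=
  .seq (.setNat 11 (.const 0) (.const 0) (.const 0)) <| .seq (.loop 8 2 argmaxBody) <|
    .setNat 10 (.const 0) (natVar 12) (.const 1)

/-- Compute the `k` results with the best second scores. -/
def selectProg : LoopProg := .seq (fill 10 (.const 0) (.const 0)) (.loop 7 3 selectStep)

/-- Compare a swap with the best one so far. -/
def searchBody : LoopProg :=
  .ite (.and (.and (.natLe (.const 1) (.get 10 (.const 0) (natVar 8)))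
      (.natLe (.get 10 (.const 0) (natVar 9)) (.const 0)))
    (.and (.neg (.realLe (.get 0 (natVar 6) (natVar 9)) (.get 0 (natVar 6) (natVar 8))))
      (.neg (.and (.natLe (.const 1) (natVar 11)) (.realLe (realVar 2)
        (.div (.sub (.get 1 (natVar 6) (natVar 8)) (.get 1 (natVar 6) (natVar 9)))
          (.sub (.get 0 (natVar 6) (natVar 9)) (.get 0 (natVar 6) (natVar 8)))))))))
    (.seq (.setNat 12 (.const 0) (.const 0) (natVar 8)) <|
      .seq (.setNat 13 (.const 0) (.const 0) (natVar 9)) <|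
      .seq (.setReal 2 (.const 0) (.const 0)
        (.div (.sub (.get 1 (natVar 6) (natVar 8)) (.get 1 (natVar 6) (natVar 9)))
          (.sub (.get 0 (natVar 6) (natVar 9)) (.get 0 (natVar 6) (natVar 8))))) <|
      .setNat 11 (.const 0) (.const 0) (.const 1)) .skip

/-- Look for the swap with the smallest slope. -/
def searchProg : LoopProg :=
  .seq (.setNat 11 (.const 0) (.const 0) (.const 0)) (.loop 8 2 (.loop 9 2 searchBody))

/-- Write the data of the swap that was found, and add its new result to the current set. -/
def recordData : LoopProg :=
  .seq (.setNat 14 (natVar 5) (.const 0) (natVar 6)) <|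
  .seq (.setReal 3 (natVar 5) (.const 0) (realVar 2)) <|
  .seq (.setReal 4 (natVar 5) (.const 0)
    (.sub (.loc (natVar 6) .dfst (realVar 10) (realVar 11))
      (.mul (realVar 2) (.loc (natVar 6) .dsnd (realVar 10) (realVar 11))))) <|
  .setNat 10 (.const 0) (natVar 13) (.const 1)

/-- Record the swap that was found, and carry it out. -/
def recordProg : LoopProg :=
  .seq (sumProg 10 (.const 0)) <| .seq recordData <|
  .seq (fill 15 (natVar 5) (.get 10 (.const 0) (natVar 8))) <|
  .seq (.setNat 10 (.const 0) (natVar 12) (.const 0)) <|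
  .setNat 5 (.const 0) (.const 0) (.add (natVar 5) (.const 1))

/-- Continue the current chain by a swap, if there is one. -/
def chainStep : LoopProg :=
  .seq searchProg (.ite (.natLe (.const 1) (natVar 11)) recordProg .skip)

/-- Compute the chain for the instance in the counter 6. -/
def chainProg : LoopProg :=
  .seq selectProg <| .seq (fill 16 (natVar 6) (.get 10 (.const 0) (natVar 8))) <|
    .loop 7 4 chainStep

/-- Compute the number `n * n`. -/
def squareProg : LoopProg :=
  .loop 7 2 (.setNat 4 (.const 0) (.const 0) (.add (natVar 4) (natVar 2)))

/-- Compute the chains for all instances. -/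
def chainsProg : LoopProg := .loop 6 1 chainProg

end RealRAM.LoopProg

/-! ### Correctness of the selection of the first set and of the search for a swap -/

namespace MultiTop.Problem

open RealRAM RealRAM.LoopProg

variable {P : Problem} {O : Oracles}

/-- The integer cell 11 records whether a result outside the set has been found, and cell 12 holds
the best one. If none is ever found, the current set contains everything. -/
lemma exec_argmax {σ : State} (h : HasInput P σ) (h0 : σ.nat 11 0 0 = 0) :
    let τ := (loop 8 2 argmaxBody).exec O σ
    (∀ j < P.n, σ.nat 10 0 j ≠ 0) ∨ (τ.nat 12 0 0 < P.n ∧ σ.nat 10 0 (τ.nat 12 0 0) = 0 ∧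
      ∀ j < P.n, σ.nat 10 0 j = 0 → P.input.real 1 (σ.nat 6 0 0) j ≤
        P.input.real 1 (σ.nat 6 0 0) (τ.nat 12 0 0)) := by
  set i := σ.nat 6 0 0 with hi
  have key := exec_loop_induction (O := O) (b := 2) σ (x := 8) (p := argmaxBody) (by decide)
    (fun J τ => (τ.nat 11 0 0 = 0 ∧ ∀ j < J, σ.nat 10 0 j ≠ 0) ∨ (τ.nat 11 0 0 = 1 ∧
      τ.nat 12 0 0 < J ∧ σ.nat 10 0 (τ.nat 12 0 0) = 0 ∧
      ∀ j < J, σ.nat 10 0 j = 0 → P.input.real 1 i j ≤ P.input.real 1 i (τ.nat 12 0 0)))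
    ?_ ?_
  · rw [h.n_eq] at key
    rcases key with ⟨_, h1⟩ | ⟨_, h1⟩
    exacts [.inl h1, .inr h1]
  · left; simp [State.setNat_nat, h0]
  · intro k _ τ hk hn hr hI
    have e1 : τ.nat 10 = σ.nat 10 := hn 10 (by decide)
    have e2 : τ.nat 6 = σ.nat 6 := hn 6 (by decide)
    have e3 : τ.real 1 = P.input.real 1 := (hr 1 (by decide)).trans h.real_one
    have hlt : ∀ j < k + 1, j = k ∨ j < k := fun j hj => by omega
    rw [argmaxBody]
    set test : Test := .and (.natLe (.get 10 (.const 0) (natVar 8)) (.const 0))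
      (.neg (.and (.natLe (.const 1) (natVar 11))
        (.realLe (.get 1 (natVar 6) (natVar 8)) (.get 1 (natVar 6) (natVar 12))))) with htest
    have hcond : test.Holds O τ ↔ σ.nat 10 0 k = 0 ∧ ¬ (1 ≤ τ.nat 11 0 0 ∧
        P.input.real 1 i k ≤ P.input.real 1 i (τ.nat 12 0 0)) := by
      simp only [htest, Test.Holds, NatExp.eval, RealExp.eval, natVar_eval, e1, e2, e3, hk, ← hi,
        nonpos_iff_eq_zero]
    by_cases hc : test.Holds O τ
    · rw [exec_ite_pos hc]
      obtain ⟨hz, hc⟩ := hcond.1 hc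
      right
      simp only [LoopProg.exec, NatExp.eval, natVar_eval, State.setNat_nat]
      simp only [hk, Nat.reduceEqDiff, false_and, if_false,
        and_self, if_true, true_and]
      refine ⟨by omega, hz, fun j hj hj0 => ?_⟩
      rcases hlt j hj with rfl | hj
      · exact le_rfl
      · rcases hI with ⟨h1, h2⟩ | ⟨h1, h2, h3, h4⟩
        · exact absurd hj0 (h2 j hj)
        · rw [h1, not_and] at hc
          exact (h4 j hj hj0).trans (not_le.1 (hc le_rfl)).le
    · rw [exec_ite_neg hc]
      simp only [LoopProg.exec]
      rw [State.setNat_nat_of_ne _ _ _ _ (by decide), State.setNat_nat_of_ne _ _ _ _ (by decide)]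
      rcases hI with ⟨h1, h2⟩ | ⟨h1, h2, h3, h4⟩
      · left
        refine ⟨h1, fun j hj => ?_⟩
        rcases hlt j hj with rfl | hj
        · exact fun hz => hc (hcond.2 ⟨hz, by simp [h1]⟩)
        · exact h2 j hj
      · right
        refine ⟨h1, by omega, h3, fun j hj hj0 => ?_⟩
        rcases hlt j hj with rfl | hj
        · by_contra hb
          exact hc (hcond.2 ⟨hj0, fun h => hb h.2⟩)
        · exact h4 j hj hj0

lemma exec_selectStep {σ : State} (h : HasInput P σ) (hc : (P.row σ 10 0).card < P.n)
    (ht : IsTop (σ.nat 6 0 0) 0 (P.row σ 10 0)) :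
    (P.row (selectStep.exec O σ) 10 0).card = (P.row σ 10 0).card + 1 ∧
    IsTop (σ.nat 6 0 0) 0 (P.row (selectStep.exec O σ) 10 0) := by
  set σ' := σ.setNat 11 0 0 0 with hσ'
  have e1 : σ'.nat 10 = σ.nat 10 := State.setNat_nat_of_ne _ _ _ _ (by decide)
  have e2 : σ'.nat 6 = σ.nat 6 := State.setNat_nat_of_ne _ _ _ _ (by decide)
  have h' : HasInput P σ' := h.of_eq (fun y hy => State.setNat_nat_of_ne _ _ _ _ (by
    rintro rfl; simp at hy)) fun y _ => rfl
  have key := exec_argmax (O := O) h' (by simp [hσ'])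
  set τ := (loop 8 2 argmaxBody).exec O σ' with hτ
  have e3 : τ.nat 10 = σ.nat 10 := (exec_nat_eq _ (by decide) _).trans e1
  rw [e1, e2] at key
  have hex : selectStep.exec O σ = τ.setNat 10 0 (τ.nat 12 0 0) 1 := rfl
  obtain ⟨j, hj⟩ : ∃ j, j ∉ P.row σ 10 0 := by
    by_contra! hall
    rw [Finset.eq_univ_iff_forall.2 hall] at hc
    simp at hc
  rcases key with key | ⟨h1, h2, h3⟩
  · exact absurd (mem_row.2 (key j j.2)) hj
  · set best : Fin P.n := ⟨τ.nat 12 0 0, h1⟩ with hbest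
    have hb : best ∉ P.row σ 10 0 := by rw [mem_row]; simpa using h2
    have hrow : P.row (selectStep.exec O σ) 10 0 = insert best (P.row σ 10 0) := by
      ext l
      rw [hex, mem_row, Finset.mem_insert, mem_row, State.setNat_nat, e3]
      simp only [true_and, hbest, Fin.ext_iff]
      split_ifs with hl <;> simp [hl]
    rw [hrow]
    refine ⟨Finset.card_insert_of_notMem hb, fun l hl l' hl' => ?_⟩
    simp only [Finset.mem_insert, not_or] at hl hl'
    rcases hl with rfl | hl
    · have := h3 l' l'.2 (by simpa [mem_row] using hl'.2)
      simpa using this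
    · exact ht l hl l' hl'.2

/-- With the weight `0` for the first score, `IsTop` concerns the second score only, and greedy
selection preserves it. -/
lemma exec_selectProg (hP : P.IsValid) {σ : State} (h : HasInput P σ) :
    (P.row (selectProg.exec O σ) 10 0).card = P.k ∧
    IsTop (σ.nat 6 0 0) 0 (P.row (selectProg.exec O σ) 10 0) := by
  set σ' := (fill 10 (.const 0) (.const 0)).exec O σ with hσ'
  have h' : HasInput P σ' := h.exec (by decide) (by decide)
  have hfill := (exec_fill (O := O) (σ := σ) (x := 10) (i := .const 0) (e := .const 0) (r := 0)
    (g := fun _ => 0) (by decide) fun τ _ => ⟨rfl, rfl⟩).1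
  have e6 : σ'.nat 6 = σ.nat 6 := exec_nat_eq _ (by decide) _
  have hrow : P.row σ' 10 0 = ∅ := by
    ext j
    rw [mem_row, hσ', hfill j (by rw [h.n_eq]; exact j.2)]
    simp
  have key := exec_loop_induction (O := O) (b := 3) σ' (x := 7) (p := selectStep) (by decide)
    (fun J τ => (P.row τ 10 0).card = J ∧ IsTop (σ.nat 6 0 0) 0 (P.row τ 10 0)) ?_ ?_
  · rwa [h'.k_eq] at key
  · have : P.row (σ'.setNat 7 0 0 0) 10 0 = P.row σ' 10 0 := row_congr fun j _ => by
      rw [State.setNat_nat_of_ne _ _ _ _ (by decide)]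
    rw [this, hrow]
    simp [IsTop]
  · intro k hk τ _ hn hr ⟨h1, h2⟩
    have hτ : HasInput P τ := h'.of_loop hn hr (by decide) (by decide)
    have e : τ.nat 6 = σ.nat 6 := (hn 6 (by decide)).trans e6
    have : P.row ((selectStep.exec O τ).setNat 7 0 0 (k + 1)) 10 0 =
        P.row (selectStep.exec O τ) 10 0 := row_congr fun j _ => by
      rw [State.setNat_nat_of_ne _ _ _ _ (by decide)]
    rw [this]
    rw [h'.k_eq] at hk
    rw [← e] at h2 ⊢
    have := exec_selectStep (O := O) hτ (by have := hP.k_le; omega) h2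
    rwa [h1] at this

/-- The result of a search for a swap among the pairs with the property `S`. -/
def Searched (i : ℕ) (V : Finset (Fin P.n)) (S : Fin P.n → Fin P.n → Prop) (τ : State) : Prop :=
  (τ.nat 11 0 0 = 0 ∧ ∀ j j', S j j' → ¬ IsSwap i V j j') ∨
  (τ.nat 11 0 0 = 1 ∧ ∃ j j' : Fin P.n, τ.nat 12 0 0 = j ∧ τ.nat 13 0 0 = j' ∧ IsSwap i V j j' ∧
    τ.real 2 0 0 = slope i j j' ∧ ∀ l l', S l l' → IsSwap i V l l' → slope i j j' ≤ slope i l l')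

/-- Increments of the loop counters do not touch the result of the search, and the set of inspected
pairs may be renamed at the same time. -/
lemma Searched.setNat {i : ℕ} {V : Finset (Fin P.n)} {S S' : Fin P.n → Fin P.n → Prop} {τ : State}
    (h : Searched i V S τ) (x v : ℕ) (hx : x ≠ 11 ∧ x ≠ 12 ∧ x ≠ 13)
    (hS : ∀ j j', S' j j' → S j j') : Searched i V S' (τ.setNat x 0 0 v) := by
  unfold Searched at *
  rw [State.setNat_nat_of_ne _ _ _ _ hx.1.symm, State.setNat_nat_of_ne _ _ _ _ hx.2.1.symm,
    State.setNat_nat_of_ne _ _ _ _ hx.2.2.symm, State.setNat_real]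
  rcases h with ⟨h1, h2⟩ | ⟨h1, j, j', h2, h3, h4, h5, h6⟩
  · exact .inl ⟨h1, fun j j' hs => h2 j j' (hS j j' hs)⟩
  · exact .inr ⟨h1, j, j', h2, h3, h4, h5, fun l l' hs => h6 l l' (hS l l' hs)⟩

lemma exec_searchBody {τ : State} (h : HasInput P τ) {S : Fin P.n → Fin P.n → Prop}
    {j j' : Fin P.n} (hj : τ.nat 8 0 0 = j) (hj' : τ.nat 9 0 0 = j')
    (hI : Searched (τ.nat 6 0 0) (P.row τ 10 0) S τ) :
    Searched (τ.nat 6 0 0) (P.row τ 10 0) (fun l l' => S l l' ∨ (l = j ∧ l' = j'))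
      (searchBody.exec O τ) := by
  set i := τ.nat 6 0 0 with hi
  set V := P.row τ 10 0 with hV
  have m1 : 1 ≤ τ.nat 10 0 j ↔ j ∈ V := by rw [hV, mem_row, Nat.one_le_iff_ne_zero]
  have m2 : τ.nat 10 0 j' ≤ 0 ↔ j' ∉ V := by rw [hV, mem_row]; simp
  have hsw : ((j ∈ V ∧ j' ∉ V) ∧ ¬ P.input.real 0 i j' ≤ P.input.real 0 i j) ↔
      IsSwap i V j j' := by rw [IsSwap, not_le, and_assoc]
  have hsl : (P.input.real 1 i j - P.input.real 1 i j') /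
      (P.input.real 0 i j' - P.input.real 0 i j) = slope i j j' := rfl
  rw [searchBody]
  set test : Test := .and (.and (.natLe (.const 1) (.get 10 (.const 0) (natVar 8)))
      (.natLe (.get 10 (.const 0) (natVar 9)) (.const 0)))
    (.and (.neg (.realLe (.get 0 (natVar 6) (natVar 9)) (.get 0 (natVar 6) (natVar 8))))
      (.neg (.and (.natLe (.const 1) (natVar 11)) (.realLe (realVar 2)
        (.div (.sub (.get 1 (natVar 6) (natVar 8)) (.get 1 (natVar 6) (natVar 9)))
          (.sub (.get 0 (natVar 6) (natVar 9)) (.get 0 (natVar 6) (natVar 8)))))))) with htest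
  have hcond : test.Holds O τ ↔
      IsSwap i V j j' ∧ ¬ (1 ≤ τ.nat 11 0 0 ∧ τ.real 2 0 0 ≤ slope i j j') := by
    simp only [htest, Test.Holds, NatExp.eval, RealExp.eval, natVar_eval, realVar_eval, hj, hj',
      ← hi, h.real_zero, h.real_one, m1, m2, ← and_assoc, hsw, hsl]
  by_cases hc : test.Holds O τ
  · rw [exec_ite_pos hc]
    obtain ⟨hs, hc⟩ := hcond.1 hc
    refine .inr ⟨by simp [LoopProg.exec, NatExp.eval], j, j', ?_, ?_, hs, ?_, ?_⟩
    · simp [LoopProg.exec, NatExp.eval, State.setNat_nat, hj]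
    · simp [LoopProg.exec, NatExp.eval, State.setNat_nat, hj']
    · simp [LoopProg.exec, NatExp.eval, RealExp.eval, State.setNat_nat, hj, hj', ← hi, h.real_zero,
        h.real_one, hsl]
    · rintro a a' (ha | ⟨rfl, rfl⟩) hsa
      · rcases hI with ⟨_, h2⟩ | ⟨h1, l, l', _, _, _, h5, h6⟩
        · exact absurd hsa (h2 a a' ha)
        · rw [h1, h5, not_and] at hc
          exact (not_le.1 (hc le_rfl)).le.trans (h6 a a' ha hsa)
      · exact le_rfl
  · rw [exec_ite_neg hc]
    simp only [LoopProg.exec]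
    rcases hI with ⟨h1, h2⟩ | ⟨h1, l, l', h2, h3, h4, h5, h6⟩
    · refine .inl ⟨h1, ?_⟩
      rintro a a' (ha | ⟨rfl, rfl⟩)
      · exact h2 a a' ha
      · exact fun hs => hc (hcond.2 ⟨hs, by simp [h1]⟩)
    · refine .inr ⟨h1, l, l', h2, h3, h4, h5, ?_⟩
      rintro a a' (ha | ⟨rfl, rfl⟩) hsa
      · exact h6 a a' ha hsa
      · by_contra hle
        exact hc (hcond.2 ⟨hsa, fun h => hle (h5 ▸ h.2)⟩)

lemma exec_searchProg {σ : State} (h : HasInput P σ) :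
    Searched (σ.nat 6 0 0) (P.row σ 10 0) (fun _ _ => True) (searchProg.exec O σ) := by
  set i := σ.nat 6 0 0 with hi
  set V := P.row σ 10 0 with hV
  set σ' := σ.setNat 11 0 0 0 with hσ'
  have h' : HasInput P σ' := h.of_eq (fun y hy => State.setNat_nat_of_ne _ _ _ _ (by
    rintro rfl; simp at hy)) fun y _ => rfl
  have key := exec_loop_induction (O := O) (b := 2) σ' (x := 8) (p := loop 9 2 searchBody)
    (by decide) (fun J τ => Searched i V (fun l _ => l.val < J) τ) ?_ ?_
  · rw [h'.n_eq] at key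
    -- Writing a cell with its own content changes nothing; it serves to turn the bound on the first
    -- index into `True`.
    have := key.setNat (S' := fun _ _ => True) 8 (((loop 8 2 (loop 9 2 searchBody)).exec O σ').nat 8 0 0)
      (by decide) (fun j _ _ => j.2)
    have e : (((loop 8 2 (loop 9 2 searchBody)).exec O σ').setNat 8 0 0
      (((loop 8 2 (loop 9 2 searchBody)).exec O σ').nat 8 0 0)) =
        (loop 8 2 (loop 9 2 searchBody)).exec O σ' := by
      rcases hh : (loop 8 2 (loop 9 2 searchBody)).exec O σ' with ⟨nt, rl⟩
      simp only [State.setNat, State.mk.injEq, and_true]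
      funext a b c
      split_ifs with hc
      · rw [hc.1, hc.2.1, hc.2.2]
      · rfl
    rwa [e] at this
  · refine .inl ⟨by simp [hσ', State.setNat_nat], fun j j' hj => absurd hj (by simp)⟩
  · intro k hk τ hk8 hn hr hI
    rw [h'.n_eq] at hk
    have hτ : HasInput P τ := h'.of_loop hn hr (by decide) (by decide)
    have e10 : τ.nat 10 = σ.nat 10 :=
      (hn 10 (by decide)).trans (State.setNat_nat_of_ne _ _ _ _ (by decide))
    have e6 : τ.nat 6 = σ.nat 6 :=
      (hn 6 (by decide)).trans (State.setNat_nat_of_ne _ _ _ _ (by decide))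
    have key := exec_loop_induction (O := O) (b := 2) τ (x := 9) (p := searchBody) (by decide)
      (fun J τ => Searched i V (fun l l' => l.val < k ∨ (l.val = k ∧ l'.val < J)) τ) ?_ ?_
    · rw [hτ.n_eq] at key
      refine key.setNat 8 (k + 1) (by decide) fun j j' hj => ?_
      rcases Nat.lt_succ_iff_lt_or_eq.1 hj with hj | hj
      exacts [.inl hj, .inr ⟨hj, j'.2⟩]
    · exact hI.setNat 9 0 (by decide) fun j j' hj => by simpa using hj
    · intro k' hk' υ hk9 hn' hr' hI'
      rw [hτ.n_eq] at hk'
      have hυ : HasInput P υ := hτ.of_loop hn' hr' (by decide) (by decide)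
      have f10 : υ.nat 10 = σ.nat 10 := (hn' 10 (by decide)).trans e10
      have f6 : υ.nat 6 = σ.nat 6 := (hn' 6 (by decide)).trans e6
      have f8 : υ.nat 8 = τ.nat 8 := hn' 8 (by decide)
      have fV : P.row υ 10 0 = V := row_congr fun j _ => by rw [f10]
      have fi : υ.nat 6 0 0 = i := by rw [f6]
      have := exec_searchBody (O := O) hυ (j := ⟨k, hk⟩) (j' := ⟨k', hk'⟩) (by rw [f8, hk8]) hk9
        (by rw [fV, fi]; exact hI')
      rw [fV, fi] at this
      refine this.setNat 9 (k' + 1) (by decide) fun j j' hj => ?_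
      simp only [Fin.ext_iff]
      omega

end MultiTop.Problem

/-! ### Correctness of the construction of the chains -/

namespace MultiTop.Problem

open RealRAM RealRAM.LoopProg

variable {P : Problem} {O : Oracles}

/-- The set with `k + 1` elements is copied to the array 15 between the insertion of the new result
and the removal of the old one. The derivatives are evaluated at the scores of the set before the
swap. -/
lemma exec_recordProg {σ : State} (h : HasInput P σ) {j j' : Fin P.n} (hj : σ.nat 12 0 0 = j)
    (hj' : σ.nat 13 0 0 = j') :
    let τ := recordProg.exec O σ
    let M := σ.nat 5 0 0
    let i := σ.nat 6 0 0
    let V := P.row σ 10 0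
    τ.nat 5 0 0 = M + 1 ∧ (∀ l, τ.nat 14 l 0 = if l = M then i else σ.nat 14 l 0) ∧
    (∀ l, τ.real 3 l 0 = if l = M then σ.real 2 0 0 else σ.real 3 l 0) ∧
    (∀ l, τ.real 4 l 0 = if l = M then O.loc i .dfst (P.pt i V).1 (P.pt i V).2 -
      σ.real 2 0 0 * O.loc i .dsnd (P.pt i V).1 (P.pt i V).2 else σ.real 4 l 0) ∧
    (∀ l, P.row τ 15 l = if l = M then insert j' V else P.row σ 15 l) ∧
    P.row τ 10 0 = (insert j' V).erase j := by
  intro τ M i V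
  obtain ⟨p1, p2⟩ := exec_sumProg (O := O) (x := 10) (r := 0) (e := .const 0) h (by decide)
    fun _ _ => rfl
  set σ₁ := (sumProg 10 (.const 0)).exec O σ with hσ₁
  have n1 : ∀ y ≠ 8, σ₁.nat y = σ.nat y := fun y hy => exec_nat_eq _ (by
    simpa [sumProg, natWrites] using hy) _
  have r1 : ∀ y, y ≠ 10 → y ≠ 11 → σ₁.real y = σ.real y := fun y h1 h2 => exec_real_eq _ (by
    simp [sumProg, realWrites, h1, h2]) _
  set σ₂ := recordData.exec O σ₁ with hσ₂
  have n2 : ∀ y, y ≠ 10 → y ≠ 14 → σ₂.nat y = σ₁.nat y := fun y h1 h2 => exec_nat_eq _ (by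
    simpa [recordData, natWrites] using ⟨h2, h1⟩) _
  have m14 : ∀ l, σ₂.nat 14 l 0 = if l = M then i else σ.nat 14 l 0 := by
    intro l
    simp [hσ₂, recordData, LoopProg.exec, NatExp.eval, State.setNat_nat, n1, M, i]
  have m10 : ∀ l, σ₂.nat 10 0 l = if l = j' then 1 else σ.nat 10 0 l := by
    intro l
    simp [hσ₂, recordData, LoopProg.exec, NatExp.eval, State.setNat_nat, n1, hj']
  have m3 : ∀ l, σ₂.real 3 l 0 = if l = M then σ.real 2 0 0 else σ.real 3 l 0 := by
    intro l
    simp [hσ₂, recordData, LoopProg.exec, NatExp.eval, RealExp.eval, State.setNat_nat,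
      State.setReal_real, n1, r1, M]
  have m4 : ∀ l, σ₂.real 4 l 0 = if l = M then O.loc i .dfst (P.pt i V).1 (P.pt i V).2 -
      σ.real 2 0 0 * O.loc i .dsnd (P.pt i V).1 (P.pt i V).2 else σ.real 4 l 0 := by
    intro l
    simp [hσ₂, recordData, LoopProg.exec, NatExp.eval, RealExp.eval, State.setNat_nat,
      State.setReal_real, n1, r1, M, p1, p2, i, V]
  have n12 : ∀ y, y ≠ 8 → y ≠ 10 → y ≠ 14 → σ₂.nat y = σ.nat y := fun y h1 h2 h3 =>
    (n2 y h2 h3).trans (n1 y h1)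
  have e2 : σ₂.nat 2 0 0 = P.n := by rw [n12 2 (by decide) (by decide) (by decide), h.n_eq]
  have e5 : σ₂.nat 5 = σ.nat 5 := n12 5 (by decide) (by decide) (by decide)
  have hfill := exec_fill (O := O) (x := 15) (i := natVar 5) (e := .get 10 (.const 0) (natVar 8))
    (σ := σ₂) (r := M) (g := fun j => σ₂.nat 10 0 j) (by decide) fun υ hυ => by
      simp only [natVar_eval, NatExp.eval]
      rw [hυ 5 (by decide), hυ 10 (by decide), e5]
      exact ⟨rfl, rfl⟩
  rw [e2] at hfill
  set σ₃ := (fill 15 (natVar 5) (.get 10 (.const 0) (natVar 8))).exec O σ₂ with hσ₃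
  have n3 : ∀ y, y ≠ 8 → y ≠ 15 → σ₃.nat y = σ₂.nat y := fun y h1 h2 => exec_nat_eq _ (by
    simpa [fill, natWrites] using ⟨h1, h2⟩) _
  have r3 : σ₃.real = σ₂.real := by
    funext y; exact exec_real_eq _ (by simp [fill, realWrites]) _
  have hτ : τ = (σ₃.setNat 10 0 j 0).setNat 5 0 0 (M + 1) := by
    have e12 : σ₃.nat 12 0 0 = j := by
      rw [n3 12 (by decide) (by decide), n12 12 (by decide) (by decide) (by decide), hj]
    have e5' : σ₃.nat 5 0 0 = M := by rw [n3 5 (by decide) (by decide), e5]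
    have : τ = (σ₃.setNat 10 0 (σ₃.nat 12 0 0) 0).setNat 5 0 0
      ((σ₃.setNat 10 0 (σ₃.nat 12 0 0) 0).nat 5 0 0 + 1) := rfl
    rw [this, State.setNat_nat_of_ne _ _ _ _ (by decide), e12, e5']
  rw [hτ]
  simp only [State.setNat_real, r3]
  refine ⟨by simp, fun l => ?_, m3, m4, fun l => ?_, ?_⟩
  · rw [State.setNat_nat_of_ne _ _ _ _ (by decide), State.setNat_nat_of_ne _ _ _ _ (by decide),
      n3 14 (by decide) (by decide), m14]
  · have e : P.row ((σ₃.setNat 10 0 j 0).setNat 5 0 0 (M + 1)) 15 l = P.row σ₃ 15 l :=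
      row_congr fun a _ => by
        rw [State.setNat_nat_of_ne _ _ _ _ (by decide), State.setNat_nat_of_ne _ _ _ _ (by decide)]
    rw [e]
    split_ifs with hl
    · subst hl
      ext a
      rw [mem_row, hfill.1 a a.2, Finset.mem_insert, mem_row, m10, Fin.ext_iff]
      split_ifs with ha <;> simp [ha]
    · refine row_congr fun a _ => ?_
      rw [hfill.2 l hl, n12 15 (by decide) (by decide) (by decide)]
  · ext a
    rw [mem_row, State.setNat_nat_of_ne _ _ _ _ (by decide), State.setNat_nat,
      n3 10 (by decide) (by decide), m10, Finset.mem_erase, Finset.mem_insert, mem_row]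
    simp only [true_and, ne_eq, Fin.ext_iff]
    split_ifs with h1 h2 <;> simp [h1]
    · exact .inl h2
    · exact fun h3 => absurd h3 h2

/-- The set `V` has the largest first score in instance `i`. -/
def IsLast (i : ℕ) (V : Finset (Fin P.n)) : Prop :=
  ∀ T : Finset (Fin P.n), T.card = P.k → (P.pt i T).1 ≤ (P.pt i V).1

/-- The chains that are stored in the memory. -/
def Stores (P : Problem) (I : ℕ) (σ : State) (W W' cur : ℕ → Finset (Fin P.n)) : Prop :=
  IsChains P I (σ.nat 5 0 0) (fun l => σ.nat 14 l 0) (fun l => σ.real 3 l 0)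
    (fun l => σ.real 4 l 0) (P.row σ 16) (P.row σ 15) W W' cur

/-- The chain of instance `i` is under construction, after `t` rounds. -/
def IsGrowing (P : Problem) (i t : ℕ) (σ : State) : Prop :=
  ∃ W W' cur, Stores P (i + 1) σ W W' cur ∧ P.row σ 10 0 = cur i ∧
    (∃ r, 0 ≤ r ∧ IsTop i r (cur i) ∧ ∀ l < σ.nat 5 0 0, σ.nat 14 l 0 = i → σ.real 3 l 0 ≤ r) ∧
    (∀ i' < i, IsLast i' (cur i')) ∧ σ.nat 5 0 0 ≤ i * (P.n * P.n) + t ∧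
    ((∀ j j', ¬ IsSwap i (cur i) j j') ∨ t ≤ rankSum i (cur i))

/-- The first `I` chains are complete. -/
def IsComplete (P : Problem) (I : ℕ) (σ : State) : Prop :=
  ∃ W W' cur, Stores P I σ W W' cur ∧ (∀ i < I, IsLast i (cur i)) ∧
    σ.nat 5 0 0 ≤ I * (P.n * P.n)

lemma IsGrowing.of_eq {i t : ℕ} {σ τ : State} (h : IsGrowing P i t σ)
    (hn : ∀ y ∈ [5, 10, 14, 15, 16], τ.nat y = σ.nat y) (hr : ∀ y ∈ [3, 4], τ.real y = σ.real y) :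
    IsGrowing P i t τ := by
  have e15 : P.row τ 15 = P.row σ 15 := funext fun l => row_congr fun a _ => by
    rw [hn 15 (by simp)]
  have e16 : P.row τ 16 = P.row σ 16 := funext fun l => row_congr fun a _ => by
    rw [hn 16 (by simp)]
  have e10 : P.row τ 10 = P.row σ 10 := funext fun l => row_congr fun a _ => by
    rw [hn 10 (by simp)]
  unfold IsGrowing Stores at *
  rwa [e15, e16, e10, hn 5 (by simp), hn 14 (by simp), hr 3 (by simp), hr 4 (by simp)]

lemma IsComplete.of_eq {I : ℕ} {σ τ : State} (h : IsComplete P I σ)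
    (hn : ∀ y ∈ [5, 14, 15, 16], τ.nat y = σ.nat y) (hr : ∀ y ∈ [3, 4], τ.real y = σ.real y) :
    IsComplete P I τ := by
  have e15 : P.row τ 15 = P.row σ 15 := funext fun l => row_congr fun a _ => by
    rw [hn 15 (by simp)]
  have e16 : P.row τ 16 = P.row σ 16 := funext fun l => row_congr fun a _ => by
    rw [hn 16 (by simp)]
  unfold IsComplete Stores at *
  rwa [e15, e16, hn 5 (by simp), hn 14 (by simp), hr 3 (by simp), hr 4 (by simp)]

/-- A round either finds no swap, and then all later rounds are idle, or it performs one and raises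
`rankSum`. The weight `r` of the invariant becomes the slope of the swap, so slopes along a chain
never decrease. -/
lemma exec_chainStep {σ : State} (h : HasInput P σ) {t : ℕ}
    (hI : IsGrowing P (σ.nat 6 0 0) t σ) :
    IsGrowing P (σ.nat 6 0 0) (t + 1) (chainStep.exec P.oracles σ) := by
  set i := σ.nat 6 0 0 with hi
  have hs := exec_searchProg (O := P.oracles) h
  set τ := searchProg.exec P.oracles σ with hτ
  have nτ : ∀ y ∉ searchProg.natWrites, τ.nat y = σ.nat y := fun y hy => exec_nat_eq _ hy _
  have rτ : ∀ y ∉ searchProg.realWrites, τ.real y = σ.real y := fun y hy => exec_real_eq _ hy _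
  have hIτ : IsGrowing P i t τ := hI.of_eq (fun y hy => nτ y (by
      revert y; decide)) fun y hy => rτ y (by revert y; decide)
  have h' : HasInput P τ := h.exec (by decide) (by decide)
  have e6 : τ.nat 6 0 0 = i := by rw [nτ 6 (by decide)]
  have hV : P.row σ 10 0 = P.row τ 10 0 := row_congr fun a _ => by rw [nτ 10 (by decide)]
  rw [hV, ← hi] at hs
  change IsGrowing P i (t + 1) ((LoopProg.ite _ _ _).exec P.oracles τ)
  clear_value τ
  obtain ⟨W, W', cur, hst, hrow, ⟨r, hr, htop, hle⟩, hlast, hM, hrank⟩ := hIτ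
  rw [hrow] at hs
  rcases hs with ⟨h1, h2⟩ | ⟨h1, j, j', h2, h3, h4, h5, h6⟩
  · rw [exec_ite_neg (by simp [Test.Holds, NatExp.eval, h1])]
    exact ⟨W, W', cur, hst, hrow, ⟨r, hr, htop, hle⟩, hlast,
      hM.trans (by omega), .inl fun j j' => h2 j j' trivial⟩
  · rw [exec_ite_pos (by simp [Test.Holds, NatExp.eval, h1])]
    obtain ⟨q5, q14, q3, q4, q15, q10⟩ := exec_recordProg (O := P.oracles) h' h2 h3
    have q16 : P.row (recordProg.exec P.oracles τ) 16 = P.row τ 16 :=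
      funext fun l => row_congr fun a _ => by rw [exec_nat_eq _ (by decide)]
    set υ := recordProg.exec P.oracles τ with hυ
    rw [e6] at q14 q4
    rw [hrow] at q15 q4 q10
    rw [h5] at q3 q4
    refine ⟨Function.update W (τ.nat 5 0 0) (cur i),
      Function.update W' (τ.nat 5 0 0) ((insert j' (cur i)).erase j),
      Function.update cur i ((insert j' (cur i)).erase j), ?_, ?_, ?_, ?_, ?_, ?_⟩
    · unfold Stores
      rw [q5, q16]
      exact IsChains.append hst (Nat.lt_succ_self i)
        (fun l hl => by rw [q14, if_neg hl.ne])
        (fun l hl => by rw [q3, if_neg hl.ne])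
        (fun l hl => by rw [q4, if_neg hl.ne])
        (fun l hl => by rw [q15, if_neg hl.ne]) hr htop hle h4
        (fun l l' => h6 l l' trivial)
        (by rw [q14, if_pos rfl]) (by rw [q3, if_pos rfl]) (by rw [q15, if_pos rfl])
        (by rw [q4, if_pos rfl])
    · rw [q10, Function.update_self]
    · refine ⟨slope i j j', hr.trans (htop.le_slope h4), ?_, ?_⟩
      · rw [Function.update_self]
        exact (htop.of_slope_min h4 fun l l' => h6 l l' trivial).swap h4
      · intro l hl ho
        rw [q5] at hl
        rw [q3]
        split_ifs with hlM
        · exact le_rfl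
        · rw [q14, if_neg hlM] at ho
          exact (hle l (by omega) ho).trans (htop.le_slope h4)
    · intro i' hi'
      rw [Function.update_of_ne hi'.ne]
      exact hlast i' hi'
    · rw [q5]; omega
    · right
      rw [Function.update_self]
      rcases hrank with hrank | hrank
      · exact absurd h4 (hrank j j')
      · exact (Nat.succ_le_succ hrank).trans (rankSum_swap h4.1 h4.2.1 h4.2.2)

/-- After `n * n` rounds the potential cannot have grown in each of them, so no swap is left and the
first score is maximal. -/
lemma IsGrowing.isComplete {i : ℕ} {σ : State} (h : IsGrowing P i (P.n * P.n) σ) :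
    IsComplete P (i + 1) σ := by
  obtain ⟨W, W', cur, hst, hrow, -, hlast, hM, hrank⟩ := h
  have hno : ∀ j j', ¬ IsSwap i (cur i) j j' := by
    rcases hrank with h | h
    · exact h
    · intro j
      exact absurd h (not_le.2 (rankSum_lt (cur i) (by have := j.2; omega)))
  refine ⟨W, W', cur, hst, fun i' hi' => ?_, by rw [add_mul]; omega⟩
  rcases Nat.lt_succ_iff_lt_or_eq.1 hi' with hi' | rfl
  · exact hlast i' hi'
  · intro T hT
    exact fst_le_of_no_swap hno (by rw [hT, hst.card_cur i' hi'])

lemma exec_chainProg (hP : P.IsValid) {σ : State} (h : HasInput P σ)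
    (h4 : σ.nat 4 0 0 = P.n * P.n) (hI : IsComplete P (σ.nat 6 0 0) σ) :
    IsComplete P (σ.nat 6 0 0 + 1) (chainProg.exec P.oracles σ) := by
  set i := σ.nat 6 0 0 with hi
  obtain ⟨hc, ht⟩ := exec_selectProg (O := P.oracles) hP h
  set σ₁ := selectProg.exec P.oracles σ with hσ₁
  have n1 : ∀ y ∉ selectProg.natWrites, σ₁.nat y = σ.nat y := fun y hy => exec_nat_eq _ hy _
  have r1 : ∀ y, σ₁.real y = σ.real y := fun y => exec_real_eq _ (by
    simp [selectProg, selectStep, argmaxBody, fill, realWrites]) _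
  have h₁ : HasInput P σ₁ := h.exec (by decide) (by decide)
  have hI₁ : IsComplete P i σ₁ := hI.of_eq (fun y hy => n1 y (by revert y; decide)) fun y _ => r1 y
  have e6 : σ₁.nat 6 0 0 = i := by rw [n1 6 (by decide)]
  have hfill := exec_fill (O := P.oracles) (x := 16) (i := natVar 6)
    (e := .get 10 (.const 0) (natVar 8)) (σ := σ₁) (r := i) (g := fun j => σ₁.nat 10 0 j)
    (by decide) fun υ hυ => by
      simp only [natVar_eval, NatExp.eval]
      rw [hυ 6 (by decide), hυ 10 (by decide), e6]
      exact ⟨rfl, rfl⟩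
  rw [h₁.n_eq] at hfill
  set p : LoopProg := fill 16 (natVar 6) (.get 10 (.const 0) (natVar 8)) with hp
  set σ₂ := p.exec P.oracles σ₁ with hσ₂
  have n2 : ∀ y ∉ p.natWrites, σ₂.nat y = σ₁.nat y := fun y hy => exec_nat_eq _ hy _
  have r2 : ∀ y, σ₂.real y = σ₁.real y := fun y => exec_real_eq _ (by
    simp [hp, fill, realWrites]) _
  have h₂ : HasInput P σ₂ := h₁.exec (by decide) (by decide)
  have e6₂ : σ₂.nat 6 0 0 = i := by rw [n2 6 (by decide), e6]
  have e16 : P.row σ₂ 16 i = P.row σ₂ 10 0 := by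
    ext a
    rw [mem_row, mem_row, hfill.1 a a.2, n2 10 (by decide)]
  have e10 : P.row σ₂ 10 0 = P.row σ₁ 10 0 := row_congr fun a _ => by rw [n2 10 (by decide)]
  have hI₂ : IsGrowing P i 0 σ₂ := by
    obtain ⟨W, W', cur, hst, hlast, hM⟩ := hI₁
    have hst₂ := hst.start (V₀' := P.row σ₂ 16) (fun i' hi' => row_congr fun a _ => by
      rw [hfill.2 i' hi'.ne]) (by rw [e16, e10, hc]) (by rw [e16, e10]; exact ht)
    refine ⟨W, W', Function.update cur i (P.row σ₂ 16 i), ?_, ?_, ⟨0, le_rfl, ?_, ?_⟩, ?_, ?_, .inr (Nat.zero_le _)⟩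
    · unfold Stores
      rw [n2 5 (by decide), n2 14 (by decide), r2, r2]
      have e15 : P.row σ₂ 15 = P.row σ₁ 15 := funext fun l => row_congr fun a _ => by
        rw [n2 15 (by decide)]
      rw [e15]
      exact hst₂
    · rw [Function.update_self, e16]
    · rw [Function.update_self, e16, e10]; exact ht
    · intro l hl ho
      rw [n2 5 (by decide)] at hl
      rw [n2 14 (by decide)] at ho
      exact absurd ho (hst.own_lt l hl).ne
    · intro i' hi'
      rw [Function.update_of_ne hi'.ne]
      exact hlast i' hi'
    · rw [n2 5 (by decide)]; exact hM
  have h4₂ : σ₂.nat 4 0 0 = P.n * P.n := by rw [n2 4 (by decide), n1 4 (by decide), h4]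
  have key := exec_loop_induction (O := P.oracles) (b := 4) σ₂ (x := 7) (p := chainStep) (by decide)
    (fun J τ => IsGrowing P i J τ) ?_ ?_
  · rw [h4₂] at key
    exact key.isComplete
  · exact hI₂.of_eq (fun y hy => State.setNat_nat_of_ne _ _ _ _ (by revert y; decide)) fun y _ => rfl
  · intro k _ τ _ hn hr hIk
    have hτ : HasInput P τ := h₂.of_loop hn hr (by decide) (by decide)
    have e : τ.nat 6 0 0 = i := by rw [hn 6 (by decide), e6₂]
    have := exec_chainStep hτ (t := k) (by rw [e]; exact hIk)
    rw [e] at this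
    exact this.of_eq (fun y hy => State.setNat_nat_of_ne _ _ _ _ (by revert y; decide))
      fun y _ => rfl

lemma hasInput_input : HasInput P P.input := ⟨fun _ _ => rfl, fun _ _ => rfl⟩

lemma exec_squareProg : (squareProg.exec O P.input).nat 4 0 0 = P.n * P.n := by
  have key := exec_loop_induction (O := O) (b := 2) P.input (x := 7)
    (p := .setNat 4 (.const 0) (.const 0) (.add (natVar 4) (natVar 2))) (by decide)
    (fun J τ => τ.nat 4 0 0 = J * P.n) (by simp [input, State.setNat_nat]) ?_
  · rwa [hasInput_input.n_eq] at key
  · intro k _ τ _ hn _ hI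
    rw [State.setNat_nat_of_ne _ _ _ _ (by decide)]
    simp only [LoopProg.exec, NatExp.eval, natVar_eval, State.setNat_nat_self]
    rw [hI, hn 2 (by decide), hasInput_input.n_eq, Nat.succ_mul]

lemma exec_chainsProg (hP : P.IsValid) {σ : State} (h : HasInput P σ)
    (h4 : σ.nat 4 0 0 = P.n * P.n) (h5 : σ.nat 5 0 0 = 0) :
    IsComplete P P.m (chainsProg.exec P.oracles σ) := by
  have key := exec_loop_induction (O := P.oracles) (b := 1) σ (x := 6) (p := chainProg) (by decide)
    (fun J τ => IsComplete P J τ) ?_ ?_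
  · rwa [h.m_eq] at key
  · refine ⟨fun _ => ∅, fun _ => ∅, fun _ => ∅, ?_, by simp, ?_⟩
    · unfold Stores
      rw [State.setNat_nat_of_ne _ _ _ _ (by decide), h5]
      exact IsChains.empty ..
    · rw [State.setNat_nat_of_ne _ _ _ _ (by decide), h5]; simp
  · intro k _ τ hk hn hr hI
    have hτ : HasInput P τ := h.of_loop hn hr (by decide) (by decide)
    have := exec_chainProg hP hτ (by rw [hn 4 (by decide), h4]) (by rw [hk]; exact hI)
    rw [hk] at this
    exact this.of_eq (fun y hy => State.setNat_nat_of_ne _ _ _ _ (by revert y; decide))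
      fun y _ => rfl

end MultiTop.Problem

/-! ### Programs that enumerate the candidates -/

namespace RealRAM.LoopProg

variable {O : Oracles}

/-- Copy the rows from 0 to `m - 1` of the integer array `y` to the array `x`. -/
def copyRows (x y : ℕ) : LoopProg := .loop 6 1 (fill x (natVar 6) (.get y (natVar 6) (natVar 8)))

/-- The value of a line at the abscissa. -/
def lineExp (x : ℕ) : RealExp :=
  .sub (.mul (.get 3 (natVar x) (.const 0)) (realVar 9)) (.get 4 (natVar x) (.const 0))

/-- The order of lines by slope, and then by index. -/
def slopeTest (up : Bool) : Test :=
  .neg (.and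
    (if up then .realLe (.get 3 (natVar 17) (.const 0)) (.get 3 (natVar 20) (.const 0))
      else .realLe (.get 3 (natVar 20) (.const 0)) (.get 3 (natVar 17) (.const 0)))
    (.neg (.and (.and (.realLe (.get 3 (natVar 20) (.const 0)) (.get 3 (natVar 17) (.const 0)))
      (.realLe (.get 3 (natVar 17) (.const 0)) (.get 3 (natVar 20) (.const 0))))
      (.natLe (natVar 20) (natVar 17)))))

/-- The choice of a swap by the position of its line. -/
def belowTest (up : Bool) : Test :=
  .neg (.and (.realLe (lineExp 17) (lineExp 20))
    (.neg (.and (.and (.realLe (lineExp 20) (lineExp 17)) (.realLe (lineExp 17) (lineExp 20)))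
      (.and (.natLe (natVar 20) (natVar 19)) (slopeTest up)))))

/-- Compute the candidate, given the abscissa. -/
def candidateProg (up : Bool) : LoopProg :=
  .loop 20 5 (.ite (belowTest up)
    (fill 21 (.get 14 (natVar 20) (.const 0)) (.get 15 (natVar 20) (natVar 8))) .skip)

/-- Add the scores and the local objective of one instance. -/
def evalStep : LoopProg :=
  .seq (sumProg 21 (natVar 6)) <|
  .seq (.setReal 5 (.const 0) (.const 0) (.add (realVar 5) (realVar 10))) <|
  .seq (.setReal 6 (.const 0) (.const 0) (.add (realVar 6) (realVar 11))) <|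
  .setReal 7 (.const 0) (.const 0)
    (.add (realVar 7) (.loc (natVar 6) .value (realVar 10) (realVar 11)))

/-- Set the accumulators to zero. -/
def evalInit : LoopProg :=
  .seq (.setReal 5 (.const 0) (.const 0) (.const 0)) <|
  .seq (.setReal 6 (.const 0) (.const 0) (.const 0)) <|
  .setReal 7 (.const 0) (.const 0) (.const 0)

/-- Compute the objective of the candidate. -/
def evalProg : LoopProg :=
  .seq evalInit <| .seq (.loop 6 1 evalStep) <|
  .setReal 7 (.const 0) (.const 0) (.add (.glob .value (realVar 5) (realVar 6)) (realVar 7))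

/-- Keep the candidate. -/
def saveProg : LoopProg :=
  .seq (.setReal 8 (.const 0) (.const 0) (realVar 7)) (copyRows 0 21)

/-- Compute the abscissa where two lines meet. -/
def crossingProg : LoopProg :=
  .setReal 9 (.const 0) (.const 0)
    (.div (.sub (.get 4 (natVar 17) (.const 0)) (.get 4 (natVar 18) (.const 0)))
      (.sub (.get 3 (natVar 17) (.const 0)) (.get 3 (natVar 18) (.const 0))))

/-- Compute a candidate, and keep it if it is better than the best one so far. -/
def tryProg (up : Bool) : LoopProg :=
  .seq crossingProg <| .seq (copyRows 21 16) <| .seq (candidateProg up) <| .seq evalProg <|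
  .ite (.realLe (realVar 7) (realVar 8)) .skip saveProg

/-- Try all candidates. -/
def enumProg : LoopProg :=
  .seq (copyRows 21 16) <| .seq evalProg <| .seq saveProg <|
  .loop 17 5 <| .loop 18 5 <| .loop 19 5 <| .seq (tryProg true) (tryProg false)

end RealRAM.LoopProg

/-! ### Correctness of the enumeration -/

namespace MultiTop.Problem

open RealRAM RealRAM.LoopProg

variable {P : Problem} {O : Oracles}

lemma candidate_congr {n : ℕ} (own : ℕ → ℕ) (V₀ U : ℕ → Finset (Fin n)) {χ χ' : ℕ → Prop} {L : ℕ}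
    (h : ∀ l < L, χ l ↔ χ' l) (i : ℕ) : candidate own V₀ U χ L i = candidate own V₀ U χ' L i := by
  induction L with
  | zero => rfl
  | succ L ih =>
    rw [candidate, candidate, ih fun l hl => h l (hl.trans (Nat.lt_succ_self L))]
    classical exact if_congr (and_congr_left' (h L (Nat.lt_succ_self L))) rfl rfl

lemma candidate_of_forall_not {n : ℕ} (own : ℕ → ℕ) (V₀ U : ℕ → Finset (Fin n)) {χ : ℕ → Prop}
    {L : ℕ} (h : ∀ l < L, ¬ χ l) (i : ℕ) : candidate own V₀ U χ L i = V₀ i := by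
  rcases candidate_cases own V₀ U χ L i with ⟨h1, _⟩ | ⟨l, hl, _, h1, _⟩
  exacts [h1, absurd h1 (h l hl)]

lemma exec_copyRows {σ : State} (h : HasInput P σ) {x y : ℕ} (hx : x ∉ [1, 2, 3, 6, 8])
    (hy : y ∉ [6, 8, x]) {i : ℕ} (hi : i < P.m) :
    P.row ((copyRows x y).exec O σ) x i = P.row σ y i := by
  simp only [List.mem_cons, List.not_mem_nil, or_false, not_or] at hx hy
  have key := exec_loop_induction (O := O) (b := 1) σ (x := 6)
    (p := fill x (natVar 6) (.get y (natVar 6) (natVar 8)))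
    (by simp [fill, natWrites, Ne.symm hx.2.2.2.1])
    (fun J τ => ∀ i < J, P.row τ x i = P.row σ y i) (by simp) ?_
  · rw [h.m_eq] at key
    exact key i hi
  · intro k _ τ hk hn hr hI i' hi'
    have n1 : ∀ z, z ≠ 6 → z ≠ 8 → z ≠ x → τ.nat z = σ.nat z := fun z h1 h2 h3 => hn z (by
      simp [fill, natWrites, h1, h2, h3])
    have hfill := exec_fill (O := O) (x := x) (i := natVar 6)
      (e := .get y (natVar 6) (natVar 8)) (σ := τ) (r := k) (g := fun j => σ.nat y k j)
      hx.2.2.2.2 fun υ hυ => by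
        simp only [natVar_eval, NatExp.eval]
        rw [hυ 6 (by simp [Ne.symm hx.2.2.2.1]), hυ y (by simp [hy]), hk, n1 y hy.1 hy.2.1 hy.2.2]
        exact ⟨rfl, rfl⟩
    rw [n1 2 (by decide) (by decide) (Ne.symm hx.2.1), h.n_eq] at hfill
    rcases Nat.lt_succ_iff_lt_or_eq.1 hi' with hi' | rfl
    · rw [← hI i' hi']
      refine row_congr fun a _ => ?_
      rw [State.setNat_nat_of_ne _ _ _ _ hx.2.2.2.1, hfill.2 i' hi'.ne]
    · refine row_congr fun a ha => ?_
      rw [State.setNat_nat_of_ne _ _ _ _ hx.2.2.2.1, hfill.1 a ha]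

/-- Tests provide only `≤`, negation and conjunction, so strict inequalities, equalities and
disjunctions are spelled out through these. -/
lemma holds_belowTest {σ : State} (up : Bool) :
    (belowTest up).Holds O σ ↔ IsBelow (fun l => σ.real 3 l 0) (fun l => σ.real 4 l 0)
      (σ.real 9 0 0) (σ.nat 17 0 0) (σ.nat 19 0 0) up (σ.nat 20 0 0) := by
  cases up <;>
  simp only [belowTest, slopeTest, lineExp, Test.Holds, NatExp.eval, RealExp.eval, natVar_eval,
    realVar_eval, IsBelow, SlopeLE, not_and_or, not_le, if_true, if_false, Bool.false_eq_true,
    ← le_antisymm_iff] <;>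
  simp only [not_or, not_and_or, not_not, not_lt, not_le]

lemma exec_candidateProg {σ : State} (h : HasInput P σ) (up : Bool)
    (h0 : ∀ i < P.m, P.row σ 21 i = P.row σ 16 i) {i : ℕ} (hi : i < P.m) :
    P.row ((candidateProg up).exec O σ) 21 i =
      candidate (fun l => σ.nat 14 l 0) (P.row σ 16) (P.row σ 15)
        (IsBelow (fun l => σ.real 3 l 0) (fun l => σ.real 4 l 0) (σ.real 9 0 0) (σ.nat 17 0 0)
          (σ.nat 19 0 0) up) (σ.nat 5 0 0) i := by
  refine exec_loop_induction (O := O) (b := 5) σ (x := 20) (p := .ite (belowTest up)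
    (fill 21 (.get 14 (natVar 20) (.const 0)) (.get 15 (natVar 20) (natVar 8))) .skip)
    (by simp [fill, natWrites])
    (fun J τ => P.row τ 21 i = candidate (fun l => σ.nat 14 l 0) (P.row σ 16) (P.row σ 15)
        (IsBelow (fun l => σ.real 3 l 0) (fun l => σ.real 4 l 0) (σ.real 9 0 0) (σ.nat 17 0 0)
          (σ.nat 19 0 0) up) J i) ?_ ?_
  · rw [candidate, ← h0 i hi]
    exact row_congr fun a _ => by rw [State.setNat_nat_of_ne _ _ _ _ (by decide)]
  · intro k _ τ hk hn hr hI
    have n1 : ∀ z ∉ [20, 8, 21], τ.nat z = σ.nat z := fun z hz => hn z (by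
      simpa [fill, natWrites] using hz)
    have r1 : ∀ z, τ.real z = σ.real z := fun z => hr z (by simp [fill, realWrites])
    have hχ := holds_belowTest (O := O) (σ := τ) up
    rw [r1, r1, r1, n1 17 (by decide), n1 19 (by decide), hk] at hχ
    have e : ∀ τ' : State, P.row (τ'.setNat 20 0 0 (k + 1)) 21 i = P.row τ' 21 i := fun τ' =>
      row_congr fun a _ => by rw [State.setNat_nat_of_ne _ _ _ _ (by decide)]
    rw [e, candidate, ← hI, ← hχ]
    by_cases hc : (belowTest up).Holds O τ
    · rw [exec_ite_pos hc]
      have hfill := exec_fill (O := O) (x := 21) (i := .get 14 (natVar 20) (.const 0))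
        (e := .get 15 (natVar 20) (natVar 8)) (σ := τ) (r := σ.nat 14 k 0)
        (g := fun j => σ.nat 15 k j) (by decide) fun υ hυ => by
          simp only [natVar_eval, NatExp.eval]
          rw [hυ 14 (by decide), hυ 20 (by decide), hυ 15 (by decide), hk, n1 14 (by decide),
            n1 15 (by decide)]
          exact ⟨rfl, rfl⟩
      rw [n1 2 (by decide), h.n_eq] at hfill
      split_ifs with ho
      · rw [← ho.2]
        exact row_congr fun a ha => hfill.1 a ha
      · refine row_congr fun a ha => ?_
        rw [hfill.2 i fun hio => ho ⟨hc, hio.symm⟩]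
    · rw [exec_ite_neg hc, if_neg fun ho => hc ho.1]
      rfl

lemma exec_evalProg {σ : State} (h : HasInput P σ) :
    (evalProg.exec P.oracles σ).real 7 0 0 = P.co fun i => P.row σ 21 i := by
  set σ₁ := evalInit.exec P.oracles σ with hσ₁
  have h₁ : HasInput P σ₁ := h.exec (by decide) (by decide)
  have n1 : σ₁.nat = σ.nat := rfl
  have key := exec_loop_induction (O := P.oracles) (b := 1) σ₁ (x := 6) (p := evalStep) (by decide)
    (fun J τ =>
      (τ.real 5 0 0, τ.real 6 0 0) = ∑ i ∈ Finset.range J, P.pt i (P.row σ 21 i) ∧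
      τ.real 7 0 0 = ∑ i ∈ Finset.range J, P.oracles.loc i .value (P.pt i (P.row σ 21 i)).1
        (P.pt i (P.row σ 21 i)).2) ?_ ?_
  · rw [h₁.m_eq] at key
    set τ := (loop 6 1 evalStep).exec P.oracles σ₁ with hτ
    have e : (evalProg.exec P.oracles σ).real 7 0 0 =
        P.F (τ.real 5 0 0, τ.real 6 0 0) + τ.real 7 0 0 := by
      change (State.setReal τ 7 0 0 _).real 7 0 0 = _
      rw [State.setReal_real_self]
      rfl
    rw [e, key.1, key.2, co, IsChains.globalScore_eq, Finset.sum_range, Finset.sum_range]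
    congr 1
    · congr 1
      exact Finset.sum_congr rfl fun i _ => pt_eq_score i _
    · refine Finset.sum_congr rfl fun i _ => ?_
      rw [← pt_eq_score]
      simp only [oracles, dif_pos i.2, answer]
  · simp [hσ₁, evalInit, LoopProg.exec, RealExp.eval, NatExp.eval, State.setReal_real]
  · intro k _ τ hk hn hr ⟨h5, h7⟩
    have hτ : HasInput P τ := h₁.of_loop hn hr (by decide) (by decide)
    obtain ⟨s1, s2⟩ := exec_sumProg (O := P.oracles) (x := 21) (r := k) (e := natVar 6) hτ
      (by decide) fun υ hυ => by rw [natVar_eval, hυ 6 (by decide), hk]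
    have hrow : P.row τ 21 k = P.row σ 21 k := row_congr fun a _ => by
      rw [hn 21 (by decide), n1]
    rw [hrow, hk] at s1 s2
    set υ := (sumProg 21 (natVar 6)).exec P.oracles τ with hυ
    have q5 : υ.real 5 = τ.real 5 := exec_real_eq _ (by decide) _
    have q6 : υ.real 6 = τ.real 6 := exec_real_eq _ (by decide) _
    have q7 : υ.real 7 = τ.real 7 := exec_real_eq _ (by decide) _
    have q6' : υ.nat 6 0 0 = k := by rw [exec_nat_eq _ (by decide), hk]
    have e : evalStep.exec P.oracles τ = ((υ.setReal 5 0 0 (υ.real 5 0 0 + υ.real 10 0 0)).setReal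
        6 0 0 (υ.real 6 0 0 + υ.real 11 0 0)).setReal 7 0 0 (υ.real 7 0 0 +
          P.oracles.loc (υ.nat 6 0 0) .value (υ.real 10 0 0) (υ.real 11 0 0)) := by
      simp [evalStep, LoopProg.exec, NatExp.eval, RealExp.eval, State.setReal_real, hυ]
    rw [State.setNat_real, Finset.sum_range_succ, Finset.sum_range_succ, ← h5, ← h7, e, s1, s2, q5,
      q6, q7, q6']
    simp [State.setReal_real]
    rfl

/-- The best sequence so far has at most `k + 1` results for each instance, its objective is known,
and it is at least every number in `A`. -/
def Beats (P : Problem) (A : Set ℝ) (σ : State) : Prop :=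
  σ.real 8 0 0 = P.co (P.output σ) ∧ (∀ i, (P.output σ i).card ≤ P.k + 1) ∧
    ∀ v ∈ A, v ≤ σ.real 8 0 0

lemma Beats.of_eq {A : Set ℝ} {σ τ : State} (h : Beats P A σ) (hn : τ.nat 0 = σ.nat 0)
    (hr : τ.real 8 = σ.real 8) : Beats P A τ := by
  have e : P.output τ = P.output σ := by
    funext i; simp only [output, hn]
  unfold Beats at *
  rwa [e, hr]

lemma exec_saveProg {σ : State} (h : HasInput P σ) {A : Set ℝ}
    (h7 : σ.real 7 0 0 = P.co fun i => P.row σ 21 i)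
    (hc : ∀ i < P.m, (P.row σ 21 i).card ≤ P.k + 1) (hA : ∀ v ∈ A, v ≤ σ.real 7 0 0) :
    Beats P A (saveProg.exec O σ) := by
  set σ₁ := σ.setReal 8 0 0 (σ.real 7 0 0) with hσ₁
  have h₁ : HasInput P σ₁ := h.of_eq (fun _ _ => rfl) fun y hy =>
    State.setReal_real_of_ne _ _ _ _ (by rintro rfl; simp at hy)
  have hout : P.output (saveProg.exec O σ) = fun i : Fin P.m => P.row σ 21 i := by
    funext i
    exact exec_copyRows (O := O) h₁ (x := 0) (y := 21) (by decide) (by decide) i.2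
  have h8 : (saveProg.exec O σ).real 8 0 0 = σ.real 7 0 0 := by
    change ((copyRows 0 21).exec O σ₁).real 8 0 0 = _
    rw [exec_real_eq _ (by decide), State.setReal_real_self]
  unfold Beats
  rw [h8, hout]
  exact ⟨h7, fun i => hc i i.2, hA⟩

/-- The value of a candidate. -/
noncomputable def candidateValue (P : Problem) (σ : State) (l₁ l₂ s : ℕ) (up : Bool) : ℝ :=
  P.co fun i => candidate (fun l => σ.nat 14 l 0) (P.row σ 16) (P.row σ 15)
    (IsBelow (fun l => σ.real 3 l 0) (fun l => σ.real 4 l 0)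
      (crossing (fun l => σ.real 3 l 0) (fun l => σ.real 4 l 0) l₁ l₂) l₁ s up) (σ.nat 5 0 0) i

/-- The arrays that are fixed after the construction of the chains. -/
structure SameData (σ τ : State) : Prop where
  nat : ∀ y ∈ [1, 2, 3, 5, 14, 15, 16], τ.nat y = σ.nat y
  real : ∀ y ∈ [0, 1, 3, 4], τ.real y = σ.real y

namespace SameData

variable {σ τ : State} (h : SameData σ τ)
include h

lemma exec {p : LoopProg} (hn : ∀ y ∈ [1, 2, 3, 5, 14, 15, 16], y ∉ p.natWrites)
    (hr : ∀ y ∈ [0, 1, 3, 4], y ∉ p.realWrites) : SameData σ (p.exec O τ) :=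
  ⟨fun y hy => (exec_nat_eq p (hn y hy) τ).trans (h.nat y hy),
    fun y hy => (exec_real_eq p (hr y hy) τ).trans (h.real y hy)⟩

lemma of_loop {υ : State} {x : ℕ} {p : LoopProg} (hn : ∀ y ∉ x :: p.natWrites, υ.nat y = τ.nat y)
    (hr : ∀ y ∉ p.realWrites, υ.real y = τ.real y)
    (h1 : ∀ y ∈ [1, 2, 3, 5, 14, 15, 16], y ∉ x :: p.natWrites)
    (h2 : ∀ y ∈ [0, 1, 3, 4], y ∉ p.realWrites) : SameData σ υ :=
  ⟨fun y hy => (hn y (h1 y hy)).trans (h.nat y hy),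
    fun y hy => (hr y (h2 y hy)).trans (h.real y hy)⟩

lemma hasInput (hσ : HasInput P σ) : HasInput P τ :=
  hσ.of_eq (fun y hy => h.nat y (by revert y; decide)) fun y hy => h.real y (by revert y; decide)

lemma row_eq {x : ℕ} (hx : x ∈ [1, 2, 3, 5, 14, 15, 16]) : P.row τ x = P.row σ x :=
  funext fun i => row_congr fun a _ => by rw [h.nat x hx]

lemma candidateValue_eq : candidateValue P τ = candidateValue P σ := by
  funext l₁ l₂ s up
  unfold candidateValue
  rw [h.row_eq (by simp), h.row_eq (by simp), h.nat 14 (by simp), h.nat 5 (by simp),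
    h.real 3 (by simp), h.real 4 (by simp)]

lemma stores {I : ℕ} {W W' cur : ℕ → Finset (Fin P.n)} (hs : Stores P I σ W W' cur) :
    Stores P I τ W W' cur := by
  unfold Stores at *
  rwa [h.row_eq (by simp), h.row_eq (by simp), h.nat 14 (by simp), h.nat 5 (by simp),
    h.real 3 (by simp), h.real 4 (by simp)]

end SameData

/-- The data of the chains stay untouched, so the candidate belongs to the original state; it
replaces the stored sequence exactly if its value is strictly larger. -/
lemma exec_tryProg {σ : State} (h : HasInput P σ) {W W' cur : ℕ → Finset (Fin P.n)}
    (hst : Stores P P.m σ W W' cur) (up : Bool) {A : Set ℝ} (hA : Beats P A σ) :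
    Beats P (insert (candidateValue P σ (σ.nat 17 0 0) (σ.nat 18 0 0) (σ.nat 19 0 0) up) A)
      ((tryProg up).exec P.oracles σ) := by
  set O := P.oracles
  set σ₁ := crossingProg.exec O σ with hσ₁
  have h9 : σ₁.real 9 0 0 = crossing (fun l => σ.real 3 l 0) (fun l => σ.real 4 l 0)
      (σ.nat 17 0 0) (σ.nat 18 0 0) := by
    simp [hσ₁, crossingProg, LoopProg.exec, RealExp.eval, NatExp.eval, crossing]
  have n1 : σ₁.nat = σ.nat := rfl
  have d1 : SameData σ σ₁ := SameData.exec ⟨fun _ _ => rfl, fun _ _ => rfl⟩ (by decide) (by decide)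
  have b1 : σ₁.real 8 = σ.real 8 := exec_real_eq _ (by decide) _
  set σ₂ := (copyRows 21 16).exec O σ₁ with hσ₂
  have n2 : ∀ y ∉ (copyRows 21 16).natWrites, σ₂.nat y = σ₁.nat y := fun y hy => exec_nat_eq _ hy _
  have r2 : ∀ y ∉ (copyRows 21 16).realWrites, σ₂.real y = σ₁.real y :=
    fun y hy => exec_real_eq _ hy _
  have d2 : SameData σ σ₂ := d1.exec (by decide) (by decide)
  have c2 : ∀ i < P.m, P.row σ₂ 21 i = P.row σ₂ 16 i := by
    intro i hi
    rw [exec_copyRows (d1.hasInput h) (by decide) (by decide) hi, d1.row_eq (by simp),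
      d2.row_eq (by simp)]
  set σ₃ := (candidateProg up).exec O σ₂ with hσ₃
  have w3 : (candidateProg up).natWrites = [20, 8, 21] := rfl
  have v3 : (candidateProg up).realWrites = [] := rfl
  have d3 : SameData σ σ₃ := d2.exec (by rw [w3]; decide) (by rw [v3]; decide)
  have c3 : ∀ i < P.m, P.row σ₃ 21 i = candidate (fun l => σ.nat 14 l 0) (P.row σ 16) (P.row σ 15)
      (IsBelow (fun l => σ.real 3 l 0) (fun l => σ.real 4 l 0)
        (crossing (fun l => σ.real 3 l 0) (fun l => σ.real 4 l 0) (σ.nat 17 0 0) (σ.nat 18 0 0))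
        (σ.nat 17 0 0) (σ.nat 19 0 0) up) (σ.nat 5 0 0) i := by
    intro i hi
    rw [exec_candidateProg (d2.hasInput h) up c2 hi, d2.row_eq (by simp), d2.row_eq (by simp),
      d2.nat 14 (by simp), d2.nat 5 (by simp), d2.real 3 (by simp), d2.real 4 (by simp),
      n2 17 (by decide), n2 19 (by decide), r2 9 (by decide), h9, n1]
  have v4 := exec_evalProg (d3.hasInput h)
  have hval : P.co (fun i => P.row σ₃ 21 i) =
      candidateValue P σ (σ.nat 17 0 0) (σ.nat 18 0 0) (σ.nat 19 0 0) up := by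
    rw [candidateValue]
    congr 1
    funext i
    exact c3 i i.2
  set σ₄ := evalProg.exec O σ₃ with hσ₄
  have d4 : SameData σ σ₄ := d3.exec (by decide) (by decide)
  have e21 : ∀ i, P.row σ₄ 21 i = P.row σ₃ 21 i := fun i => row_congr fun a _ => by
    rw [hσ₄, exec_nat_eq _ (by decide)]
  have b4 : Beats P A σ₄ := by
    refine hA.of_eq ?_ ?_
    · rw [hσ₄, exec_nat_eq _ (by decide), hσ₃, exec_nat_eq _ (by rw [w3]; decide),
        n2 0 (by decide), n1]
    · rw [hσ₄, exec_real_eq _ (by decide), hσ₃, exec_real_eq _ (by rw [v3]; decide),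
        r2 8 (by decide), b1]
  change Beats P _ ((LoopProg.ite _ _ _).exec O σ₄)
  by_cases hc : Test.Holds O σ₄ (.realLe (realVar 7) (realVar 8))
  · rw [exec_ite_pos hc]
    refine ⟨b4.1, b4.2.1, ?_⟩
    rintro v (rfl | hv)
    · rw [← hval, ← v4]; exact hc
    · exact b4.2.2 v hv
  · rw [exec_ite_neg hc]
    refine exec_saveProg (d4.hasInput h) ?_ ?_ ?_
    · rw [v4]
      congr 1
      funext i
      exact (e21 i).symm
    · intro i hi
      rw [e21, c3 i hi]
      exact hst.card_candidate _ hi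
    · rintro v (rfl | hv)
      · rw [← hval, ← v4]
      · exact (b4.2.2 v hv).trans (not_le.1 hc).le

/-- Passing from single values to sets of values makes the rule applicable to nested loops: each
level takes a union. -/
lemma exec_loop_beats {x b : ℕ} {p : LoopProg} (σ : State) (hx : x ∉ p.natWrites) (hx0 : x ≠ 0)
    (B : ℕ → Set ℝ) (hs : ∀ k < σ.nat b 0 0, ∀ τ : State, τ.nat x 0 0 = k →
      (∀ y ∉ x :: p.natWrites, τ.nat y = σ.nat y) → (∀ y ∉ p.realWrites, τ.real y = σ.real y) →
      ∀ A, Beats P A τ → Beats P (B k ∪ A) (p.exec O τ)) {A : Set ℝ} (hA : Beats P A σ) :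
    Beats P ((⋃ k < σ.nat b 0 0, B k) ∪ A) ((loop x b p).exec O σ) := by
  refine exec_loop_induction σ hx (fun J τ => Beats P ((⋃ k < J, B k) ∪ A) τ) ?_ ?_
  · have e : (⋃ k < 0, B k) ∪ A = A := by simp
    rw [e]
    exact hA.of_eq (State.setNat_nat_of_ne _ _ _ _ hx0.symm) rfl
  · intro k hk τ hτ hn hr hI
    have e : (⋃ l < k + 1, B l) ∪ A = B k ∪ ((⋃ l < k, B l) ∪ A) := by
      rw [Set.biUnion_lt_succ, Set.union_comm _ (B k), Set.union_assoc]
    rw [e]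
    exact (hs k hk τ hτ hn hr _ hI).of_eq (State.setNat_nat_of_ne _ _ _ _ hx0.symm) rfl

lemma exec_enumProg {σ : State} (h : HasInput P σ) {W W' cur : ℕ → Finset (Fin P.n)}
    (hst : Stores P P.m σ W W' cur) :
    let M := σ.nat 5 0 0
    Beats P ((⋃ l₁ < M, ⋃ l₂ < M, ⋃ s < M, {candidateValue P σ l₁ l₂ s true,
      candidateValue P σ l₁ l₂ s false}) ∪ {P.co fun i => P.row σ 16 i})
      (enumProg.exec P.oracles σ) := by
  intro M
  set O := P.oracles
  set σ₁ := (copyRows 21 16).exec O σ with hσ₁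
  have d1 : SameData σ σ₁ := SameData.exec ⟨fun _ _ => rfl, fun _ _ => rfl⟩ (by decide) (by decide)
  have c1 : ∀ i < P.m, P.row σ₁ 21 i = P.row σ 16 i := fun i hi =>
    exec_copyRows h (by decide) (by decide) hi
  have hval : P.co (fun i => P.row σ₁ 21 i) = P.co fun i => P.row σ 16 i := by
    congr 1
    funext i
    exact c1 i i.2
  have v2 := exec_evalProg (d1.hasInput h)
  set σ₂ := evalProg.exec O σ₁ with hσ₂
  have d2 : SameData σ σ₂ := d1.exec (by decide) (by decide)
  have e21 : ∀ i, P.row σ₂ 21 i = P.row σ₁ 21 i := fun i => row_congr fun a _ => by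
    rw [hσ₂, exec_nat_eq _ (by decide)]
  -- The starts of the chains are stored without comparison: the initial zero in the real array 8 is
  -- not the value of a sequence, and objectives may be negative. They are also the candidate for
  -- the case that no segment is selected.
  have b3 : Beats P {P.co fun i => P.row σ 16 i} (saveProg.exec O σ₂) := by
    refine exec_saveProg (d2.hasInput h) ?_ ?_ ?_
    · rw [v2]
      congr 1
      funext i
      exact (e21 i).symm
    · intro i hi
      rw [e21, c1 i hi, hst.card_V₀ i hi]
      omega
    · rintro v rfl
      rw [v2, hval]
  set σ₃ := saveProg.exec O σ₂ with hσ₃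
  have d3 : SameData σ σ₃ := d2.exec (by decide) (by decide)
  have e5 : ∀ τ, SameData σ τ → τ.nat 5 0 0 = M := fun τ d => by rw [d.nat 5 (by simp)]
  change Beats P _ ((loop 17 5 _).exec O σ₃)
  have key := exec_loop_beats (P := P) (O := O) (x := 17) (b := 5)
    (p := .loop 18 5 <| .loop 19 5 <| .seq (tryProg true) (tryProg false)) σ₃ (by decide)
    (by decide) (fun l₁ => ⋃ l₂ < M, ⋃ s < M, {candidateValue P σ l₁ l₂ s true,
      candidateValue P σ l₁ l₂ s false}) ?_ b3
  · rwa [e5 _ d3] at key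
  intro l₁ _ τ₁ t17 hn₁ hr₁ A₁ hA₁
  have dτ₁ : SameData σ τ₁ := d3.of_loop hn₁ hr₁ (by decide) (by decide)
  have key := exec_loop_beats (P := P) (O := O) (x := 18) (b := 5)
    (p := .loop 19 5 <| .seq (tryProg true) (tryProg false)) τ₁ (by decide)
    (by decide) (fun l₂ => ⋃ s < M, {candidateValue P σ l₁ l₂ s true,
      candidateValue P σ l₁ l₂ s false}) ?_ hA₁
  · rwa [e5 _ dτ₁] at key
  intro l₂ _ τ₂ t18 hn₂ hr₂ A₂ hA₂
  have dτ₂ : SameData σ τ₂ := dτ₁.of_loop hn₂ hr₂ (by decide) (by decide)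
  have key := exec_loop_beats (P := P) (O := O) (x := 19) (b := 5)
    (p := .seq (tryProg true) (tryProg false)) τ₂ (by decide)
    (by decide) (fun s => {candidateValue P σ l₁ l₂ s true,
      candidateValue P σ l₁ l₂ s false}) ?_ hA₂
  · rwa [e5 _ dτ₂] at key
  intro s _ τ t19 hn hr A hA
  have dτ : SameData σ τ := dτ₂.of_loop hn hr (by decide) (by decide)
  have e17 : τ.nat 17 0 0 = l₁ := by rw [hn 17 (by decide), hn₂ 17 (by decide), t17]
  have e18 : τ.nat 18 0 0 = l₂ := by rw [hn 18 (by decide), t18]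
  have k1 := exec_tryProg (dτ.hasInput h) (dτ.stores hst) true hA
  have dυ : SameData σ ((tryProg true).exec O τ) := dτ.exec (by decide) (by decide)
  have k2 := exec_tryProg (dυ.hasInput h) (dυ.stores hst) false k1
  rw [dυ.candidateValue_eq, dτ.candidateValue_eq, exec_nat_eq _ (by decide),
    exec_nat_eq _ (by decide), exec_nat_eq _ (by decide), e17, e18, t19, Set.insert_comm] at k2
  rw [Set.insert_union, Set.singleton_union]
  exact k2

/-- The running time of a loop program on inputs with small bounds. -/
lemma exists_run_of_le (P : Problem) (p : LoopProg) (hp : p.CountersSafe)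
    (hw : ∀ b ∈ p.bounds, b ∉ p.natWrites) {σ : State} {D : ℕ} (hD : p.depth ≤ D)
    (hB : ∀ b ∈ p.bounds, σ.nat b 0 0 ≤ (P.m + P.n + 1) ^ 3) :
    ∃ t, Run O p.toProg σ t (p.exec O σ) ∧
      t ≤ p.size * 2 ^ D * (P.m + P.n + 1) ^ (3 * D) := by
  obtain ⟨t, h1, h2⟩ := exists_run (O := O) p hp _ σ hw hB
  refine ⟨t, h1, h2.trans ?_⟩
  rw [mul_assoc, pow_mul, ← mul_pow]
  have h3 : 1 ≤ (P.m + P.n + 1) ^ 3 := Nat.one_le_pow _ _ (by omega)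
  -- For `B = (m + n + 1) ^ 3`, which is at least 1, one has `B + 1 ≤ 2 * B`; this is the source of
  -- the factor `2 ^ D`.
  refine Nat.mul_le_mul_left _ ((Nat.pow_le_pow_left (by omega) _).trans
    (Nat.pow_le_pow_right (by omega) hD))

end MultiTop.Problem

/-! ### The polynomial-time algorithm -/

open RealRAM.LoopProg MultiTop.Problem in
theorem corollary2 :
    ∃ (p : RealRAM.Prog) (C d : ℕ), ∀ P : MultiTop.Problem, P.IsValid →
      ∃ (t : ℕ) (τ : RealRAM.State),
        RealRAM.Run P.oracles p P.input t τ ∧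
        t ≤ C * (P.m + P.n + 1) ^ d ∧
        (∀ i, (P.output τ i).card ≤ P.k + 1) ∧
        ∀ T : Fin P.m → Finset (Fin P.n), (∀ i, (T i).card = P.k) →
          P.co T ≤ P.co (P.output τ) := by
  set D := squareProg.depth + chainsProg.depth + enumProg.depth with hD
  refine ⟨.seq squareProg.toProg (.seq chainsProg.toProg enumProg.toProg),
    (squareProg.size + chainsProg.size + enumProg.size) * 2 ^ D, 3 * D, fun P hP => ?_⟩
  have hm : P.m ≤ (P.m + P.n + 1) ^ 3 := (by omega : P.m ≤ P.m + P.n + 1).trans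
    (Nat.le_self_pow (by decide) _)
  have hn : P.n ≤ (P.m + P.n + 1) ^ 3 := (by omega : P.n ≤ P.m + P.n + 1).trans
    (Nat.le_self_pow (by decide) _)
  have hk : P.k ≤ (P.m + P.n + 1) ^ 3 := hP.k_le.trans hn
  -- The largest loop bound is the number of swaps, at most `m * n * n`; this is why the exponent is
  -- `3 * D`.
  have hmnn : P.m * (P.n * P.n) ≤ (P.m + P.n + 1) ^ 3 := by
    have h1 : P.m ≤ P.m + P.n + 1 := by omega
    have h2 : P.n ≤ P.m + P.n + 1 := by omega
    calc P.m * (P.n * P.n) ≤ (P.m + P.n + 1) * ((P.m + P.n + 1) * (P.m + P.n + 1)) :=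
          Nat.mul_le_mul h1 (Nat.mul_le_mul h2 h2)
      _ = (P.m + P.n + 1) ^ 3 := by ring
  have hnn : P.n * P.n ≤ (P.m + P.n + 1) ^ 3 := by
    have h2 : P.n ≤ P.m + P.n + 1 := by omega
    calc P.n * P.n ≤ (P.m + P.n + 1) ^ 2 := by rw [sq]; exact Nat.mul_le_mul h2 h2
      _ ≤ (P.m + P.n + 1) ^ 3 := Nat.pow_le_pow_right (by omega) (by decide)
  set O := P.oracles with hO
  have h₀ : HasInput P P.input := hasInput_input
  obtain ⟨t₁, run₁, ht₁⟩ := exists_run_of_le (O := O) P squareProg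
    (by simp [squareProg, CountersSafe, natWrites]) (by decide) (σ := P.input) (D := D) (by omega)
    (by simp [squareProg, bounds, h₀.n_eq, hn])
  set σ₁ := squareProg.exec O P.input with hσ₁
  have h₁ : HasInput P σ₁ := h₀.exec (by decide) (by decide)
  have h4 : σ₁.nat 4 0 0 = P.n * P.n := exec_squareProg
  have h5 : σ₁.nat 5 0 0 = 0 := by rw [hσ₁, exec_nat_eq _ (by decide)]; simp [input]
  obtain ⟨t₂, run₂, ht₂⟩ := exists_run_of_le (O := O) P chainsProg
    (by simp [chainsProg, chainProg, selectProg, selectStep, argmaxBody, fill, chainStep,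
      searchProg, searchBody, recordProg, recordData, sumProg, CountersSafe, natWrites])
    (by decide) (σ := σ₁) (D := D) (by omega) (by
      simp [chainsProg, chainProg, selectProg, selectStep, argmaxBody, fill, chainStep,
        searchProg, searchBody, recordProg, recordData, sumProg, bounds, h₁.n_eq, h₁.m_eq, h₁.k_eq,
        h4, hn, hm, hk, hnn])
  obtain ⟨W, W', cur, hst, hlast, hM⟩ := exec_chainsProg hP h₁ h4 h5
  rw [← hO] at hst hM
  set σ₂ := chainsProg.exec O σ₁ with hσ₂
  have h₂ : HasInput P σ₂ := h₁.exec (by decide) (by decide)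
  obtain ⟨t₃, run₃, ht₃⟩ := exists_run_of_le (O := O) P enumProg
    (by simp [enumProg, tryProg, crossingProg, copyRows, fill, candidateProg, evalProg, evalInit,
      evalStep, saveProg, sumProg, CountersSafe, natWrites])
    (by decide) (σ := σ₂) (D := D) (by omega) (by
      simp [enumProg, tryProg, crossingProg, copyRows, fill, candidateProg, evalProg, evalInit,
        evalStep, saveProg, sumProg, bounds, h₂.n_eq, h₂.m_eq, hn, hm, hM.trans hmnn])
  obtain ⟨h8, hcard, hbest⟩ := exec_enumProg h₂ hst
  rw [← hO] at h8 hcard hbest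
  refine ⟨_, _, .seq run₁ (.seq run₂ run₃), ?_, hcard, fun T hT => ?_⟩
  · calc t₁ + (t₂ + t₃) ≤ _ := add_le_add ht₁ (add_le_add ht₂ ht₃)
      _ = _ := by ring
  · obtain ⟨χ, hχ, hT'⟩ := hst.exists_candidate hP hlast
    refine (hT' T hT).trans ?_
    rw [← h8]
    rcases hχ with hχ | ⟨l₁, hl₁, l₂, hl₂, s, hs, up, hχ⟩
    · refine hbest _ (.inr ?_)
      simp only [candidate_of_forall_not _ _ _ hχ, Set.mem_singleton_iff]
    · refine hbest _ (.inl ?_)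
      simp only [candidate_congr _ _ _ hχ, Set.mem_iUnion]
      refine ⟨l₁, hl₁, l₂, hl₂, s, hs, ?_⟩
      cases up
      exacts [.inr rfl, .inl rfl]
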